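/- **Setting.** Let $(A=(a_{ij})_{i,j\in I},P,\{\alpha_i\},\{h_i\})$ be a Cartan superdatum with arbitrary index set $I$: $A$ is a Cartan matrix ($a_{ii}=2$; $a_{ij}\in\mathbb Z_{\le 0}$ for $i\ne j$; $a_{ij}=0$ if $a_{ji}=0$) with positive integers $d_i$ such that $d_ia_{ij}=d_ja_{ji}$; $P$ is a free abelian group; $\alpha_i\in P$ are linearly independent; $h_i\in\mathrm{Hom}(P,\mathbb Z)$ satisfy $\langle h_i,\alpha_j\rangle=a_{ij}$; and there is a parity $\mathrm p:I\to\{0,1\}$ such that $a_{ij}$ is even for all $j$ whenever $\mathrm p(i)=1$. Put $Q^+=\sum_i\mathbb Z_{\ge0}\alpha_i$ and $P^+=\{\Lambda\in P:\langle h_i,\Lambda\rangle\ge0\ \forall i\}$. Let $\pi$ be an indeterminate with $\pi^2=1$, $\Bbbk=\mathbb Q(q)^\pi=\mathbb Q(q)\otimes\mathbb Z[\pi]$, $\mathbb A^\pi=\mathbb Z[q,q^{-1}]\otimes\mathbb Z[\pi]\subset\Bbbk$, $q_i=q^{d_i}$, $\pi_i=\pi^{\mathrm p(i)}$, $[n]_i^\pi=\sum_{k=0}^{n-1}q_i^{1-n+2k}\pi_i^k$,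 $[n]_i^\pi!=\prod_{k=1}^n[k]_i^\pi$, and $x^{\{n\}}=x^n/[n]^\pi_i!$ for $x=e_i,f_i$. Let $U(\mathfrak g)$ be the $\Bbbk$-algebra generated by $e_i,f_i,\tilde K_i^{\pm1}$ $(i\in I)$ with the relations $\tilde K_i\tilde K_j=\tilde K_j\tilde K_i$, $\tilde K_ie_j\tilde K_i^{-1}=q_i^{2a_{ij}}e_j$, $\tilde K_if_j\tilde K_i^{-1}=q_i^{-2a_{ij}}f_j$, $e_if_j-\pi^{\mathrm p(i)\mathrm p(j)}q_i^{-a_{ij}}f_je_i=\delta_{ij}\frac{1-\tilde K_i}{1-q_i^2\pi_i}$, and, for $i\ne j$ and both $x=e$ and $x=f$, $$\sum_{k=0}^{1-a_{ij}}(-\pi^{\mathrm p(i)\mathrm p(j)})^k\pi_i^{k(k-1)/2}x_i^{\{1-a_{ij}-k\}}x_jx_i^{\{k\}}=0.$$ A $P$-weighted $U(\mathfrak g)$-module is a module with a decomposition $M=\bigoplus_{\mu\in P}M_\mu$ into $\Bbbk$-submodules such that $e_iM_\mu\subset M_{\mu+\alpha_i}$, $f_iM_\mu\subset M_{\mu-\alpha_i}$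 and $\tilde K_i$ acts on $M_\mu$ by $(q_i^2\pi_i)^{\langle h_i,\mu\rangle}$. It is in $\mathcal O_{int}^P$ if every $M_\mu$ is finitely generated over $\Bbbk$, the weights lie in a finite union of sets $\lambda_k-Q^+$, and all $e_i,f_i$ act locally nilpotently. For $\Lambda\in P^+$ let $V(\Lambda)$ be the $P$-weighted $U(\mathfrak g)$-module generated by $v_\Lambda$ of weight $\Lambda$ with defining relations $\tilde K_iv_\Lambda=(q_i^2\pi_i)^{\langle h_i,\Lambda\rangle}v_\Lambda$, $e_iv_\Lambda=0$, $f_i^{\langle h_i,\Lambda\rangle+1}v_\Lambda=0$. Let $U_{\mathbb A^\pi}(\mathfrak g)$ be the $\mathbb A^\pi$-subalgebra of $U(\mathfrak g)$ generated by $e_i^{\{n\}},f_i^{\{n\}},\tilde K_i^{\pm1}$ $(i\in I,\ n>0)$, and $V_{\mathbb A^\pi}(\Lambda)=U_{\mathbb A^\pi}(\mathfrak g)v_\Lambda$. There is a unique non-degenerate symmetric $\Bbbk$-bilinear form $(\ ,\ )$ on $V(\Lambda)$ with $(v_\Lambda,v_\Lambda)=1$ and $(e_iu,v)=(u,f_iv)$;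 put $V_{\mathbb A^\pi}(\Lambda)^\vee=\{u\in V(\Lambda):(u,V_{\mathbb A^\pi}(\Lambda))\subset\mathbb A^\pi\}$. For an $\mathbb A^\pi$-submodule $L$ of a $P$-weighted module write $L_\mu$ for its intersection with the weight space of weight $\mu$. For a nonzero $v$ in a module $M\in\mathcal O_{int}^P$ let $\varepsilon_i(v)=\min\{n\ge0:e_i^{n+1}v=0\}$. A $\Bbbk$-basis $B$ of $M$ consisting of weight vectors is a *perfect basis* if (1) for all $b\in B$, $i\in I$ with $e_ib\ne0$ there is a unique $\tilde{\mathsf e}_i(b)\in B$ such that $e_ib-c_i(b)\,\tilde{\mathsf e}_i(b)\in\operatorname{Ker}e_i^{\varepsilon_i(b)-1}$ for some $c_i(b)\in\Bbbk^\times$; and (2) $\varepsilon_i(b)=\varepsilon_i(b')>0$ and $\tilde{\mathsf e}_i(b)=\tilde{\mathsf e}_i(b')$ imply $b=b'$. It is *strong* if moreover each $c_i(b)$ is of the form $\pi^{\epsilon}q^m[\varepsilon_i(b)]_i^\pi$ with $\epsilon\in\{0,1\}$, $m\in\mathbb Z$. Put $B^H=\{b\in B:e_ib=0\ \forall i\in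 I\}$. **Theorem.** Let $\Lambda\in P^+$, and let $M$ be a $U(\mathfrak g)$-module in $\mathcal O_{int}^P$ all of whose weights lie in $\Lambda-Q^+$. Let $M_{\mathbb A^\pi}$ be an $\mathbb A^\pi$-submodule of $M$ such that (a) $e_i^{\{n\}}M_{\mathbb A^\pi}\subset M_{\mathbb A^\pi}$ for all $i\in I$ and $n\ge0$; (b) $(M_{\mathbb A^\pi})_\Lambda=\mathbb A^\pi v'_\Lambda$ for some $v'_\Lambda\in M_\Lambda$; (c) $M$ has a strong perfect basis $B\subset M_{\mathbb A^\pi}$ with $B^H=\{v'_\Lambda\}$. Then, with the form $(\ ,\ )$ on $V(\Lambda)$ as above (whose existence and uniqueness is part of the assertion): (i) $M_{\mathbb A^\pi}\simeq V_{\mathbb A^\pi}(\Lambda)^\vee$; precisely, there is an isomorphism $M\to V(\Lambda)$ of $P$-weighted $U(\mathfrak g)$-modules that sends $v'_\Lambda$ to $v_\Lambda$ and $M_{\mathbb A^\pi}$ onto $V_{\mathbb A^\pi}(\Lambda)^\vee$; (ii) $B$ is an $\mathbb A^\pi$-basis of $M_{\mathbb A^\pi}$; (iii) for every $\mu\in P$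 the form induces an isomorphism $V_{\mathbb A^\pi}(\Lambda)_\mu\simeq\operatorname{Hom}_{\mathbb A^\pi}\bigl(V_{\mathbb A^\pi}(\Lambda)^\vee_\mu,\mathbb A^\pi\bigr)$, $y\mapsto(x\mapsto(x,y))$. -/

import Mathlib

namespace QuantumSuper

noncomputable section

universe u v w

/-! ### The ground ring `ℚ(q)^π` and its subring `𝔸^π` -/

/-- The ring `ℚ(q)^π = ℚ(q) ⊗ ℤ[π]`, `π ^ 2 = 1`: its elements are `x + y π` with `x, y ∈ ℚ(q)`. -/
abbrev QPi : Type := QuadraticAlgebra (RatFunc ℚ) 1 0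

/-- The indeterminate `q`, as a unit of `ℚ(q)^π`. -/
def q : QPiˣ :=
  Units.map (algebraMap (RatFunc ℚ) QPi : RatFunc ℚ →* QPi) (Units.mk0 RatFunc.X RatFunc.X_ne_zero)

/-- The element `π` with `π ^ 2 = 1`, as a unit of `ℚ(q)^π`. -/
def ϖ : QPiˣ where
  val := QuadraticAlgebra.omega
  inv := QuadraticAlgebra.omega
  val_inv := by simp [QuadraticAlgebra.omega_mul_omega_eq_algebraMap]
  inv_val := by simp [QuadraticAlgebra.omega_mul_omega_eq_algebraMap]

/-- The subring `𝔸^π = ℤ[q, q⁻¹]^π` of `ℚ(q)^π`. -/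
def APi : Subring QPi :=
  Subring.closure {(q : QPi), ((q⁻¹ : QPiˣ) : QPi), (ϖ : QPi)}

/-! ### Cartan superdata -/

/-- A Cartan superdatum with index set `I` and weight lattice `P`: a Cartan matrix `a`
symmetrized by positive integers `d i`, linearly independent simple roots `α i ∈ P`,
simple coroots `h i ∈ Hom(P, ℤ)` with `⟨h i, α j⟩ = a i j`, and a set `odd` of odd indices
such that `a i j` is even whenever `i` is odd. -/
structure CartanSuperdatum (I : Type u) (P : Type v) [AddCommGroup P] where
  a : I → I → ℤ
  a_diag : ∀ i, a i i = 2
  a_nonpos : ∀ i j, i ≠ j → a i j ≤ 0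
  a_zero : ∀ i j, a j i = 0 → a i j = 0
  d : I → ℕ
  d_pos : ∀ i, 0 < d i
  symm : ∀ i j, (d i : ℤ) * a i j = (d j : ℤ) * a j i
  α : I → P
  h : I → P →+ ℤ
  pairing : ∀ i j, h i (α j) = a i j
  α_indep : LinearIndependent ℤ α
  odd : Set I
  even_of_odd : ∀ i ∈ odd, ∀ j, Even (a i j)

/-- The letters naming the generators `e_i`, `f_i`, `K̃_i`, `K̃_i⁻¹`. -/
inductive Gen (I : Type u) : Type u
  | e (i : I)
  | f (i : I)
  | K (i : I)
  | Kinv (i : I)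

variable {I : Type u} {P : Type v} [AddCommGroup P]

namespace CartanSuperdatum

variable (D : CartanSuperdatum I P)

open Classical in
/-- The parity function `p : I → {0, 1}`. -/
def parity (i : I) : ℕ := if i ∈ D.odd then 1 else 0

/-- `q_i = q ^ (d_i)`. -/
def qi (i : I) : QPiˣ := q ^ D.d i

/-- `π_i = π ^ p(i)`. -/
def pii (i : I) : QPiˣ := ϖ ^ D.parity i

/-- `p̃_i = q_i² π_i`. -/
def pt (i : I) : QPiˣ := D.qi i ^ 2 * D.pii i

/-- `[n]_i^π = ∑_{k < n} q_i ^ (1 - n + 2k) π_i ^ k = ((π_i q_i)^n - q_i^{-n}) / (π_i q_i - q_i⁻¹)`. -/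
def qint (i : I) (n : ℕ) : QPi :=
  ∑ k ∈ Finset.range n, ((D.qi i ^ (1 - (n : ℤ) + 2 * (k : ℤ)) * D.pii i ^ k : QPiˣ) : QPi)

/-- `[n]_i^π ! = [1]_i^π ⋯ [n]_i^π`. -/
def qfact (i : I) (n : ℕ) : QPi := ∏ k ∈ Finset.range n, D.qint i (k + 1)

/-- The divided power `x^{{n}} = x ^ n / [n]_i^π !` (`[n]_i^π !` is invertible,
see `isUnit_qfact`). -/
def divPow {A : Type*} [Ring A] [Algebra QPi A] (i : I) (x : A) (n : ℕ) : A :=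
  Ring.inverse (D.qfact i n) • x ^ n

/-- `ℚ(q)^π → ℚ(q)`, `π ↦ s` for a sign `s`. -/
def ev (s : ℤˣ) : QPi →+* RatFunc ℚ where
  toFun x := x.re + ((s : ℤ) : RatFunc ℚ) * x.im
  map_one' := by simp [QuadraticAlgebra.re_one, QuadraticAlgebra.im_one]
  map_zero' := by simp
  map_add' x y := by simp; ring
  map_mul' x y := by
    have hs : ((s : ℤ) : RatFunc ℚ) * ((s : ℤ) : RatFunc ℚ) = 1 := by
      rcases Int.units_eq_one_or s with h | h <;> simp [h]
    simp only [QuadraticAlgebra.re_mul, QuadraticAlgebra.im_mul]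
    linear_combination (- x.im * y.im) * hs

lemma isUnit_of_ev {x : QPi} (h : ∀ s : ℤˣ, ev s x ≠ 0) : IsUnit x := by
  rw [QuadraticAlgebra.isUnit_iff_norm_isUnit, isUnit_iff_ne_zero]
  have h1 := h 1
  have h2 := h (-1)
  have : QuadraticAlgebra.norm x = ev 1 x * ev (-1) x := by
    simp [QuadraticAlgebra.norm_def, ev]; ring
  rw [this]
  exact mul_ne_zero h1 h2

lemma ev_pt_pow_ne (s : ℤˣ) (i : I) (n : ℕ) (hn : 0 < n) :
    ev s (D.pt i : QPi) ^ n ≠ 1 := by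
  have hd := D.d_pos i
  obtain ⟨t, ht⟩ : ∃ t : ℤˣ, ev s (D.pt i : QPi) =
      RatFunc.X ^ (2 * D.d i) * ((t : ℤ) : RatFunc ℚ) := by
    refine ⟨s ^ D.parity i, ?_⟩
    have hq : ev s (q : QPi) = RatFunc.X := by
      simp [ev, q, ← QuadraticAlgebra.C_eq_algebraMap]
    have hp : ev s (ϖ : QPi) = ((s : ℤ) : RatFunc ℚ) := by simp [ev, ϖ]
    simp only [pt, qi, pii, Units.val_mul, Units.val_pow_eq_pow_val, map_mul, map_pow, hq, hp]
    push_cast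
    ring
  intro h
  rw [ht, mul_pow, ← pow_mul] at h
  have h2 : (RatFunc.X : RatFunc ℚ) ^ (2 * D.d i * n * 2) = 1 := by
    have ht2 : ((t : ℤ) : RatFunc ℚ) ^ 2 = 1 := by
      rcases Int.units_eq_one_or t with h | h <;> simp [h]
    have := congrArg (· ^ 2) h
    simp only [mul_pow, ← pow_mul, one_pow] at this
    rwa [mul_comm n 2, pow_mul _ 2 n, ht2, one_pow, mul_one] at this
  have h3 : (Polynomial.X : Polynomial ℚ) ^ (2 * D.d i * n * 2) = 1 := by
    apply RatFunc.algebraMap_injective ℚ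
    simpa [RatFunc.algebraMap_X] using h2
  have h4 := congrArg Polynomial.natDegree h3
  simp at h4
  omega

/-- `1 - p̃_i` is invertible, so that one may divide by it. -/
theorem isUnit_one_sub_pt (i : I) : IsUnit (1 - (D.pt i : QPi)) := by
  refine isUnit_of_ev fun s h => D.ev_pt_pow_ne s i 1 one_pos ?_
  rw [map_sub, map_one, sub_eq_zero] at h
  rw [pow_one, ← h]

theorem isUnit_qint (i : I) (n : ℕ) (hn : 0 < n) : IsUnit (D.qint i n) := by
  have key : D.qint i n = ((D.qi i ^ (1 - (n : ℤ)) : QPiˣ) : QPi) *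
      ∑ k ∈ Finset.range n, (D.pt i : QPi) ^ k := by
    rw [qint, Finset.mul_sum]
    refine Finset.sum_congr rfl fun k _ => ?_
    rw [← Units.val_pow_eq_pow_val, ← Units.val_mul, pt, zpow_add, mul_pow, zpow_mul]
    norm_cast
    simp [mul_assoc]
  rw [key]
  refine (Units.isUnit _).mul (isUnit_of_ev fun s h => D.ev_pt_pow_ne s i n hn ?_)
  rw [map_sum] at h
  simp only [map_pow] at h
  have := geom_sum_mul (ev s (D.pt i : QPi)) n
  rw [h, zero_mul] at this
  exact (sub_eq_zero.1 this.symm)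

/-- `[n]_i^π !` is invertible, so that one may divide by it. -/
theorem isUnit_qfact (i : I) (n : ℕ) : IsUnit (D.qfact i n) := by
  unfold qfact
  induction n with
  | zero => simp
  | succ n ih =>
    rw [Finset.prod_range_succ]
    exact ih.mul (D.isUnit_qint i (n + 1) n.succ_pos)

/-- The positive cone `Q⁺ = ∑ ℤ_{≥ 0} α_i`. -/
def Qplus : AddSubmonoid P := AddSubmonoid.closure (Set.range D.α)

/-- `Λ ∈ P⁺`. -/
def IsDominant (Λ : P) : Prop := ∀ i, 0 ≤ D.h i Λ

/-! ### The algebra `U(𝔤)` -/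

/-- The quantum Serre expression
`∑_{k ≤ 1 - a_ij} (- π^{p(i)p(j)})^k π_i^{k(k-1)/2} x^{{1 - a_ij - k}} y x^{{k}}`. -/
def serre {A : Type*} [Ring A] [Algebra QPi A] (i j : I) (x y : A) : A :=
  ∑ k ∈ Finset.range ((1 - D.a i j).toNat + 1),
    ((-((ϖ ^ (D.parity i * D.parity j) : QPiˣ) : QPi)) ^ k *
        ((D.pii i ^ (k * (k - 1) / 2) : QPiˣ) : QPi)) •
      (D.divPow i x ((1 - D.a i j).toNat - k) * y * D.divPow i x k)

open FreeAlgebra in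
/-- The defining relations of `U(𝔤)`. -/
inductive Rel : FreeAlgebra QPi (Gen I) → FreeAlgebra QPi (Gen I) → Prop
  | K_Kinv (i : I) : Rel (ι QPi (.K i) * ι QPi (.Kinv i)) 1
  | Kinv_K (i : I) : Rel (ι QPi (.Kinv i) * ι QPi (.K i)) 1
  | K_K (i j : I) : Rel (ι QPi (.K i) * ι QPi (.K j)) (ι QPi (.K j) * ι QPi (.K i))
  | K_e (i j : I) : Rel (ι QPi (.K i) * ι QPi (.e j) * ι QPi (.Kinv i))
      (((D.qi i ^ (2 * D.a i j) : QPiˣ) : QPi) • ι QPi (.e j))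
  | K_f (i j : I) : Rel (ι QPi (.K i) * ι QPi (.f j) * ι QPi (.Kinv i))
      (((D.qi i ^ (-(2 * D.a i j)) : QPiˣ) : QPi) • ι QPi (.f j))
  | e_f_same (i : I) : Rel
      (ι QPi (.e i) * ι QPi (.f i) -
        ((ϖ ^ (D.parity i * D.parity i) * D.qi i ^ (-D.a i i) : QPiˣ) : QPi) •
          (ι QPi (.f i) * ι QPi (.e i)))
      (Ring.inverse (1 - (D.pt i : QPi)) • (1 - ι QPi (.K i)))
  | e_f_ne (i j : I) (hij : i ≠ j) : Rel
      (ι QPi (.e i) * ι QPi (.f j) -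
        ((ϖ ^ (D.parity i * D.parity j) * D.qi i ^ (-D.a i j) : QPiˣ) : QPi) •
          (ι QPi (.f j) * ι QPi (.e i)))
      0
  | serre_f (i j : I) (hij : i ≠ j) : Rel (D.serre i j (ι QPi (.f i)) (ι QPi (.f j))) 0
  | serre_e (i j : I) (hij : i ≠ j) : Rel (D.serre i j (ι QPi (.e i)) (ι QPi (.e j))) 0

/-- The `ℚ(q)^π`-algebra `U(𝔤)` attached to a Cartan superdatum. -/
def U : Type u := RingQuot D.Rel

instance : Ring D.U := inferInstanceAs (Ring (RingQuot D.Rel))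

instance : Algebra QPi D.U := inferInstanceAs (Algebra QPi (RingQuot D.Rel))

/-- The image in `U(𝔤)` of a generator. -/
def gen (x : Gen I) : D.U := RingQuot.mkAlgHom QPi D.Rel (FreeAlgebra.ι QPi x)

/-- `e_i ∈ U(𝔤)`. -/
def e (i : I) : D.U := D.gen (.e i)

/-- `f_i ∈ U(𝔤)`. -/
def f (i : I) : D.U := D.gen (.f i)

/-- `K̃_i ∈ U(𝔤)`. -/
def K (i : I) : D.U := D.gen (.K i)

/-- `K̃_i⁻¹ ∈ U(𝔤)`. -/
def Kinv (i : I) : D.U := D.gen (.Kinv i)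

/-- The degree in the root lattice of a generator. -/
def genWeight : Gen I → P
  | .e i => D.α i
  | .f i => -D.α i
  | .K _ => 0
  | .Kinv _ => 0

/-- The root space `U(𝔤)_β`: the span of the monomials in the generators of degree `β`. -/
def rootSpace (β : P) : Submodule QPi D.U :=
  Submodule.span QPi
    {x | ∃ l : List (Gen I), (l.map D.genWeight).sum = β ∧ (l.map D.gen).prod = x}

/-- The `𝔸^π`-form `U_{𝔸^π}(𝔤)`: the `𝔸^π`-subalgebra of `U(𝔤)` generated by the
`e_i^{{n}}`, the `f_i^{{n}}` (`n > 0`) and the `K̃_i^{± 1}`. -/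
def UA : Subalgebra APi D.U :=
  Algebra.adjoin APi
    ({x | ∃ i n, 0 < n ∧ x = D.divPow i (D.e i) n} ∪
      {x | ∃ i n, 0 < n ∧ x = D.divPow i (D.f i) n} ∪
      Set.range D.K ∪ Set.range D.Kinv)

/-! ### Weighted and integrable modules -/

/-- `wt` is a `P`-weight space decomposition of the `U(𝔤)`-module `M`. -/
structure IsWeighted {M : Type w} [AddCommGroup M] [Module QPi M] [Module D.U M]
    (wt : P → Submodule QPi M) : Prop where
  indep : iSupIndep wt
  iSup_eq_top : ⨆ μ, wt μ = ⊤
  e_mem : ∀ i μ, ∀ x ∈ wt μ, D.e i • x ∈ wt (μ + D.α i)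
  f_mem : ∀ i μ, ∀ x ∈ wt μ, D.f i • x ∈ wt (μ - D.α i)
  K_smul : ∀ i μ, ∀ x ∈ wt μ, D.K i • x = ((D.pt i ^ D.h i μ : QPiˣ) : QPi) • x

/-- The `P`-weighted `U(𝔤)`-module `M` belongs to the category `𝒪_int^P(U(𝔤))`. -/
structure IsIntegrable {M : Type w} [AddCommGroup M] [Module QPi M] [Module D.U M]
    (wt : P → Submodule QPi M) : Prop extends D.IsWeighted wt where
  fg : ∀ μ, (wt μ).FG
  bounded : ∃ S : Finset P, ∀ μ, wt μ ≠ ⊥ → ∃ lam ∈ S, lam - μ ∈ D.Qplus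
  e_nilp : ∀ i (x : M), ∃ n : ℕ, D.e i ^ n • x = 0
  f_nilp : ∀ i (x : M), ∃ n : ℕ, D.f i ^ n • x = 0

/-! ### The module `V(Λ)` and its two `𝔸^π`-forms -/

/-- The left ideal generated by `e_i`, `K̃_i - p̃_i^{⟨h_i, Λ⟩}` and `f_i^{⟨h_i, Λ⟩ + 1}`. -/
def hwIdeal (Λ : P) : Submodule D.U D.U :=
  Submodule.span D.U
    (Set.range D.e ∪
      Set.range (fun i => D.K i - algebraMap QPi D.U ((D.pt i ^ D.h i Λ : QPiˣ) : QPi)) ∪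
      Set.range (fun i => D.f i ^ ((D.h i Λ).toNat + 1)))

/-- For `Λ ∈ P⁺`, the `U(𝔤)`-module `V(Λ)` generated by `v_Λ` with the relations
`K̃_i v_Λ = p̃_i^{⟨h_i, Λ⟩} v_Λ`, `e_i v_Λ = 0`, `f_i^{⟨h_i, Λ⟩ + 1} v_Λ = 0`. -/
abbrev V (Λ : P) : Type u := D.U ⧸ D.hwIdeal Λ

/-- The generator `v_Λ` of `V(Λ)`. -/
def vhw (Λ : P) : D.V Λ := (D.hwIdeal Λ).mkQ 1

/-- The weight space `V(Λ)_μ = U(𝔤)_{μ - Λ} v_Λ`. -/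
def Vwt (Λ μ : P) : Submodule QPi (D.V Λ) :=
  (D.rootSpace (μ - Λ)).map (((D.hwIdeal Λ).mkQ).restrictScalars QPi)

/-- The `𝔸^π`-form `V_{𝔸^π}(Λ) = U_{𝔸^π}(𝔤) v_Λ`. -/
def VA (Λ : P) : Submodule APi (D.V Λ) :=
  (Subalgebra.toSubmodule D.UA).map (((D.hwIdeal Λ).mkQ).restrictScalars APi)

/-- The weight space `V_{𝔸^π}(Λ)_μ`. -/
def VAwt (Λ μ : P) : Submodule APi (D.V Λ) := D.VA Λ ⊓ (D.Vwt Λ μ).restrictScalars APi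

/-- `form` is a non-degenerate symmetric bilinear form on `V(Λ)` with `(v_Λ, v_Λ) = 1` and
`(e_i x, y) = (x, f_i y)`. -/
structure IsContravariantForm (Λ : P) (form : LinearMap.BilinForm QPi (D.V Λ)) : Prop where
  symm : ∀ x y, form x y = form y x
  nondegenerate : form.Nondegenerate
  vhw : form (D.vhw Λ) (D.vhw Λ) = 1
  adjoint : ∀ i x y, form (D.e i • x) y = form x (D.f i • y)

/-- The dual form `V_{𝔸^π}(Λ)^∨ = {x ∈ V(Λ) | (x, V_{𝔸^π}(Λ)) ⊆ 𝔸^π}`. -/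
def VAdual (Λ : P) (form : LinearMap.BilinForm QPi (D.V Λ)) : Submodule APi (D.V Λ) where
  carrier := {x | ∀ y ∈ D.VA Λ, form x y ∈ APi}
  add_mem' hx hy z hz := by
    rw [map_add, LinearMap.add_apply]
    exact add_mem (hx z hz) (hy z hz)
  zero_mem' z _ := by
    rw [map_zero, LinearMap.zero_apply]
    exact zero_mem _
  smul_mem' c x hx z hz := by
    have h : form (c • x) z = (c : QPi) * form x z := by
      rw [Subring.smul_def, map_smul, LinearMap.smul_apply, smul_eq_mul]
    rw [h]
    exact mul_mem c.2 (hx z hz)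

/-- The weight space `(V_{𝔸^π}(Λ)^∨)_μ`. -/
def VAdualwt (Λ : P) (form : LinearMap.BilinForm QPi (D.V Λ)) (μ : P) :
    Submodule APi (D.V Λ) :=
  D.VAdual Λ form ⊓ (D.Vwt Λ μ).restrictScalars APi

end CartanSuperdatum

/-! ### Perfect bases -/

section Perfect

variable {V : Type w} [AddCommGroup V] [Module QPi V]

/-- `ε_i(x) = min {n | e_i^{n+1} x = 0}`, used for nonzero `x` only. -/
def eps (e : I → Module.End QPi V) (i : I) (x : V) : ℕ :=
  sInf {n | (e i ^ (n + 1)) x = 0}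

/-- `b' ∈ B` and `e_i b - c b' ∈ V_i^{< ε_i(b) - 1}`, where `V_i^{< k} = Ker e_i^k`;
i.e. `b'` is the element `ẽ_i(b)` and `c` is the coefficient `c_i(b)`.
Used only for `e_i b ≠ 0`, in which case `ε_i(b) ≥ 1`. -/
def IsETilde (e : I → Module.End QPi V) (B : Set V) (i : I) (b b' : V) (c : QPiˣ) : Prop :=
  b' ∈ B ∧ e i b - (c : QPi) • b' ∈ LinearMap.ker (e i ^ (eps e i b - 1))

/-- `B` is a perfect basis of the `P`-graded `ℚ(q)^π`-module `V = ⨁ wt μ` with operators `e_i`. -/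
structure IsPerfectBasis (wt : P → Submodule QPi V) (e : I → Module.End QPi V)
    (B : Set V) : Prop where
  linearIndependent : LinearIndependent QPi (Subtype.val : B → V)
  span_eq_top : Submodule.span QPi B = ⊤
  homogeneous : ∀ b ∈ B, ∃ μ, b ∈ wt μ
  existsUnique_eTilde : ∀ b ∈ B, ∀ i, e i b ≠ 0 → ∃! b', ∃ c : QPiˣ, IsETilde e B i b b' c
  eTilde_injective : ∀ i, ∀ b₁ ∈ B, ∀ b₂ ∈ B, eps e i b₁ = eps e i b₂ → 0 < eps e i b₁ →
    ∀ b' c₁ c₂, IsETilde e B i b₁ b' c₁ → IsETilde e B i b₂ b' c₂ → b₁ = b₂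

/-- A perfect basis is strong if `c_i(b) ∈ {π^s q^m [ε_i(b)]_i^π | s ∈ {0, 1}, m ∈ ℤ}` for all
`b` and `i` with `e_i b ≠ 0`. -/
structure IsStrongPerfectBasis (D : CartanSuperdatum I P) (wt : P → Submodule QPi V)
    (e : I → Module.End QPi V) (B : Set V) : Prop extends IsPerfectBasis wt e B where
  strong : ∀ b ∈ B, ∀ i, e i b ≠ 0 → ∀ b' c, IsETilde e B i b b' c →
    ∃ (m : ℤ) (s : Fin 2), (c : QPi) = ((ϖ ^ (s : ℕ) * q ^ m : QPiˣ) : QPi) * D.qint i (eps e i b)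

end Perfect

/-- The operators by which the `e_i` act on a `U(𝔤)`-module. -/
def eOp (D : CartanSuperdatum I P) (M : Type w) [AddCommGroup M] [Module QPi M] [Module D.U M]
    [IsScalarTower QPi D.U M] (i : I) : Module.End QPi M :=
  Algebra.lsmul QPi QPi M (D.e i)

end

end QuantumSuper

open QuantumSuper

/-!
The argument rests on two facts: `V(Λ)` has no singular vectors besides those of weight `Λ`, and the
divided powers `e_i^{{l}}` act on a strong perfect basis in a triangular way, with units of `𝔸^π` on
the diagonal.

*Signs.* All structure constants of `U(𝔤)` are expressed by the bicharacter
`χ_ij = π^{p(i)p(j)} q_i^{-a_ij}` (`CartanSuperdatum.chi`), which is symmetric and satisfies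
`χ_ij² = p̃_i^{-a_ij}`, where `p̃_i = q_i² π_i`. With `χ` in place of the usual powers of `q` the
theory of the quantum group carries over without case distinctions between even and odd indices
(`IsQuantumModule`).

*No singular vectors.* The free algebra on letters `θ_i` carries the bilinear form for which left
multiplication by `θ_i` is adjoint to a twisted derivation (`form`). The ring `ℚ(q)^π` is not a
field, but it is semisimple, so that Gram matrices have generalized inverses; these define canonical
tensors and a Casimir operator (`casimir`). It acts on the part of degree `-β` of a highest weight
module by a scalar of the form `π^k q^m` (`IsQuantumModule.casimir_hw`), as long as the radical of
the form acts by zero. If the weight is dominant, then `m > 0`, hence the scalar differs from `1` by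
a unit, while a singular vector has Casimir eigenvalue `1`. That the radical acts by zero on an
integrable highest weight module (`opHom_f_of_mem_radical`, the analogue of a theorem of Gabber and
Kac) is proved by the same means: an element of minimal degree `β` not acting by zero is an operator
commuting with each `e_i` up to a unit. If `⟨h_i, β⟩ > 0` for some `i`, the representation theory of
the quantum `sl₂` makes it vanish (`IsRankOne.eq_zero_of_intertwiner`); otherwise it is a singular
vector, with Casimir eigenvalue different from `1`, in a quotient of the Verma module of highest
weight zero (`radical_mem_of_isUnit`). The result is `V_eq_zero_of_singular`: a submodule of `V(Λ)`
stable under the `e_i` is detected on the highest weight line (`V_eq_zero_of_mem`).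

*The form.* Integrability of `M` shows that `v_Λ ↦ v_Λ'` defines a homomorphism `V(Λ) → M`
(`IsPerfectForm.toModule`), and that `(m, y v_Λ) ↦` the coefficient of `v_Λ'` in `yᵗ m`, with `ᵗ` the
antiautomorphism exchanging `e_i` and `f_i`, is a well-defined pairing of `M` with `V(Λ)`
(`IsPerfectForm.pair`). Composing the two gives the contravariant form. Both the injectivity of
`V(Λ) → M` and the non-degeneracy of the form follow from the absence of singular vectors.

*Integrality.* The commutation relation of divided powers has coefficients in `𝔸^π`, so that
`V_{𝔸^π}(Λ)` is spanned by the divided power words in the `f_i` (`VA_eq_divSpan`), and the form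
`M_{𝔸^π}` pairs with it into `𝔸^π`. Let `l = ε_i(b)` be maximal among the basis vectors `b` in the
support of `m`. Then `e_i^{{l}} m` has the coefficient of `m` at `b`, up to a unit of `𝔸^π`, as its
coefficient at another basis vector (`exists_repr_divPow`). Descending on the depth of the weights, one
concludes that elements of `M_{𝔸^π}` have coordinates in `𝔸^π` (`IsPerfectForm.repr_mem_APi`), which
makes `B` a basis of `M_{𝔸^π}`. The transposed argument constructs vectors of `V_{𝔸^π}(Λ)` which
represent the coordinate functionals (`IsPerfectForm.exists_dual`). They show that `V(Λ) → M` is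
surjective, that `M_{𝔸^π}` corresponds to the dual form of `V(Λ)`, and that `V_{𝔸^π}(Λ)_μ` is the full
dual of the part of weight `μ` of the latter.
-/

namespace QuantumSuper

noncomputable section

universe u v w

/-! ### Twisted derivations and the bilinear form on the free algebra -/

section FreeForm

variable {R : Type*} [CommRing R] {I : Type*}

/-- Induction on a free algebra by left multiplication with the generators. -/
theorem freeAlgebra_induction_left {p : FreeAlgebra R I → Prop} (one : p 1)
    (add : ∀ x y, p x → p y → p (x + y)) (smul : ∀ (c : R) x, p x → p (c • x))
    (ι_mul : ∀ i x, p x → p (FreeAlgebra.ι R i * x)) (x : FreeAlgebra R I) : p x := by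
  suffices h : ∀ y, p y → p (x * y) by simpa using h 1 one
  induction x using FreeAlgebra.induction with
  | grade0 r =>
    intro y hy
    rw [← Algebra.smul_def]
    exact smul r y hy
  | grade1 i => exact fun y hy => ι_mul i y hy
  | mul a b ha hb =>
    intro y hy
    rw [mul_assoc]
    exact ha _ (hb _ hy)
  | add a b ha hb =>
    intro y hy
    rw [add_mul]
    exact add _ _ (ha _ hy) (hb _ hy)

/-- The monomial of the free algebra given by a word. -/
def word (R : Type*) [CommRing R] {I : Type*} (w : List I) : FreeAlgebra R I :=
  (w.map (FreeAlgebra.ι R)).prod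

@[simp] lemma word_nil : word R ([] : List I) = 1 := rfl

@[simp] lemma word_cons (i : I) (w : List I) :
    word R (i :: w) = FreeAlgebra.ι R i * word R w := by simp [word]

lemma word_append (u w : List I) : word R (u ++ w) = word R u * word R w := by simp [word]

/-- The homogeneous part of multidegree `β` of the free algebra: the span of the words with
content `β`. -/
def homog (R : Type*) [CommRing R] {I : Type*} (β : Multiset I) : Submodule R (FreeAlgebra R I) :=
  Submodule.span R {x | ∃ w : List I, (w : Multiset I) = β ∧ word R w = x}

lemma word_mem_homog (w : List I) : word R w ∈ homog R (w : Multiset I) :=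
  Submodule.subset_span ⟨w, rfl, rfl⟩

lemma homog_induction {β : Multiset I} {p : ∀ x : FreeAlgebra R I, x ∈ homog R β → Prop}
    (hw : ∀ (w : List I) (h : (w : Multiset I) = β),
      p (word R w) (Submodule.subset_span ⟨w, h, rfl⟩))
    (zero : p 0 (zero_mem _))
    (add : ∀ x y hx hy, p x hx → p y hy → p (x + y) (add_mem hx hy))
    (smul : ∀ (c : R) x hx, p x hx → p (c • x) (Submodule.smul_mem _ c hx))
    {x : FreeAlgebra R I} (hx : x ∈ homog R β) : p x hx := by
  unfold homog at hx
  induction hx using Submodule.span_induction with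
  | mem x h => obtain ⟨w, h1, rfl⟩ := h; exact hw w h1
  | zero => exact zero
  | add x y hx' hy' hx hy => exact add x y hx' hy' hx hy
  | smul c x hx' hx => exact smul c x hx' hx

lemma ι_mul_mem_homog (i : I) {β : Multiset I} {x : FreeAlgebra R I} (hx : x ∈ homog R β) :
    FreeAlgebra.ι R i * x ∈ homog R (i ::ₘ β) := by
  induction hx using homog_induction with
  | hw w h =>
    subst h
    rw [← word_cons]
    exact word_mem_homog (i :: w)
  | zero => simp
  | add x y _ _ hx hy => rw [mul_add]; exact add_mem hx hy
  | smul c x _ hx => rw [mul_smul_comm]; exact Submodule.smul_mem _ _ hx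

lemma mul_ι_mem_homog (i : I) {β : Multiset I} {x : FreeAlgebra R I} (hx : x ∈ homog R β) :
    x * FreeAlgebra.ι R i ∈ homog R (i ::ₘ β) := by
  induction hx using homog_induction with
  | hw w h =>
    subst h
    have h1 : word R w * FreeAlgebra.ι R i = word R (w ++ [i]) := by simp [word_append]
    have h2 : (i ::ₘ (w : Multiset I)) = ((w ++ [i] : List I) : Multiset I) := by
      rw [Multiset.cons_coe, Multiset.coe_eq_coe]
      exact (List.perm_append_singleton i w).symm
    rw [h1, h2]
    exact word_mem_homog _
  | zero => simp
  | add x y _ _ hx hy => rw [add_mul]; exact add_mem hx hy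
  | smul c x _ hx => rw [smul_mul_assoc]; exact Submodule.smul_mem _ _ hx

lemma exists_eq_sum_homog (x : FreeAlgebra R I) :
    ∃ (s : Finset (Multiset I)) (y : Multiset I → FreeAlgebra R I),
      (∀ β, y β ∈ homog R β) ∧ x = ∑ β ∈ s, y β := by
  suffices h : x ∈ ⨆ β : Multiset I, homog R β by
    rw [Submodule.mem_iSup_iff_exists_finsupp] at h
    obtain ⟨f, hf, rfl⟩ := h
    exact ⟨f.support, f, hf, rfl⟩
  induction x using freeAlgebra_induction_left with
  | one => exact Submodule.mem_iSup_of_mem (([] : List I) : Multiset I) (word_mem_homog [])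
  | add x y hx hy => exact add_mem hx hy
  | smul c x hx => exact Submodule.smul_mem _ _ hx
  | ι_mul i x hx =>
    induction hx using Submodule.iSup_induction' with
    | mem β x hx => exact Submodule.mem_iSup_of_mem _ (ι_mul_mem_homog i hx)
    | zero => simp
    | add x y _ _ hx hy => rw [mul_add]; exact add_mem hx hy

variable (χ : I → I → Rˣ)

/-- The value of the bicharacter at `α_i` and at a multidegree. -/
def chiM (i : I) (β : Multiset I) : Rˣ := (β.map (χ i)).prod

@[simp] lemma chiM_cons (i j : I) (β : Multiset I) :
    chiM χ i (j ::ₘ β) = χ i j * chiM χ i β := by simp [chiM]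

@[simp] lemma chiM_zero (i : I) : chiM χ i 0 = 1 := by simp [chiM]

/-- The automorphism of the free algebra scaling the generator `j` by `χ i j`. -/
def twist (i : I) : FreeAlgebra R I →ₐ[R] FreeAlgebra R I :=
  FreeAlgebra.lift R fun j => (χ i j : R) • FreeAlgebra.ι R j

@[simp] lemma twist_ι_mul (i j : I) (x : FreeAlgebra R I) :
    twist χ i (FreeAlgebra.ι R j * x) = (χ i j : R) • (FreeAlgebra.ι R j * twist χ i x) := by
  simp [twist]

lemma twist_of_homog (i : I) {β : Multiset I} {x : FreeAlgebra R I} (hx : x ∈ homog R β) :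
    twist χ i x = (chiM χ i β : R) • x := by
  induction hx using homog_induction with
  | hw w h =>
    subst h
    induction w with
    | nil => simp
    | cons j w ih =>
      rw [word_cons, twist_ι_mul, ih, ← Multiset.cons_coe, chiM_cons, mul_smul_comm, smul_smul]
      push_cast
      rfl
  | zero => simp
  | add x y _ _ hx hy => rw [map_add, hx, hy, smul_add]
  | smul c x _ hx => rw [map_smul, hx, smul_comm]

open scoped Classical in
/-- Upper triangular matrices over the free algebra whose corner entry is the left twisted
derivation. -/
def derivLAux (i : I) : FreeAlgebra R I →ₐ[R] Matrix (Fin 2) (Fin 2) (FreeAlgebra R I) :=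
  FreeAlgebra.lift R fun j =>
    !![(χ i j : R) • FreeAlgebra.ι R j, if i = j then 1 else 0; 0, FreeAlgebra.ι R j]

/-- The left twisted derivation `D_i` with `D_i (θ_j y) = δ_ij y + χ_ij θ_j D_i y`. -/
def derivL (i : I) : FreeAlgebra R I →ₗ[R] FreeAlgebra R I where
  toFun y := derivLAux χ i y 0 1
  map_add' x y := by simp
  map_smul' c x := by simp

open scoped Classical in
/-- Upper triangular matrices over the free algebra whose corner entry is the right twisted
derivation. -/
def derivRAux (i : I) : FreeAlgebra R I →ₐ[R] Matrix (Fin 2) (Fin 2) (FreeAlgebra R I) :=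
  FreeAlgebra.lift R fun j =>
    !![FreeAlgebra.ι R j, if i = j then 1 else 0; 0, (χ i j : R) • FreeAlgebra.ι R j]

/-- The right twisted derivation `r_i`, with `r_i (θ_j y) = θ_j r_i y + δ_ij χ(α_i, |y|) y`. -/
def derivR (i : I) : FreeAlgebra R I →ₗ[R] FreeAlgebra R I where
  toFun y := derivRAux χ i y 0 1
  map_add' x y := by simp
  map_smul' c x := by simp

@[simp] lemma derivL_one (i : I) : derivL χ i 1 = 0 := by
  simp [derivL]

@[simp] lemma derivR_one (i : I) : derivR χ i 1 = 0 := by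
  simp [derivR]

open scoped Classical in
@[simp] lemma derivL_ι_mul (i j : I) (y : FreeAlgebra R I) :
    derivL χ i (FreeAlgebra.ι R j * y) =
      (if i = j then y else 0) + (χ i j : R) • (FreeAlgebra.ι R j * derivL χ i y) := by
  have h : ∀ y, derivLAux χ i y 1 1 = y := by
    intro y
    induction y using freeAlgebra_induction_left with
    | one => simp
    | add x y hx hy => simp [hx, hy]
    | smul c x hx => simp [hx]
    | ι_mul j x hx =>
      simp [derivLAux, Matrix.mul_apply, Fin.sum_univ_two] at hx ⊢
      rw [hx]
  have h2 := h y
  simp only [derivL, LinearMap.coe_mk, AddHom.coe_mk]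
  rw [map_mul, Matrix.mul_apply, Fin.sum_univ_two, h2]
  simp [derivLAux, add_comm]

open scoped Classical in
@[simp] lemma derivR_ι_mul (i j : I) (y : FreeAlgebra R I) :
    derivR χ i (FreeAlgebra.ι R j * y) =
      FreeAlgebra.ι R j * derivR χ i y + (if i = j then twist χ i y else 0) := by
  have h : ∀ y, derivRAux χ i y 1 1 = twist χ i y := by
    intro y
    induction y using freeAlgebra_induction_left with
    | one => simp
    | add x y hx hy => simp [hx, hy]
    | smul c x hx => simp [hx]
    | ι_mul j x hx =>
      simp [derivRAux, Matrix.mul_apply, Fin.sum_univ_two] at hx ⊢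
      rw [hx]
  have h2 := h y
  simp only [derivR, LinearMap.coe_mk, AddHom.coe_mk]
  rw [map_mul, Matrix.mul_apply, Fin.sum_univ_two, h2]
  simp [derivRAux]

lemma twist_comm (i j : I) (y : FreeAlgebra R I) :
    twist χ i (twist χ j y) = twist χ j (twist χ i y) := by
  induction y using freeAlgebra_induction_left with
  | one => simp
  | add x y hx hy => simp [hx, hy]
  | smul c x hx => simp [hx]
  | ι_mul k x hx => simp [hx, smul_smul, mul_comm]

lemma twist_derivL (i j : I) (y : FreeAlgebra R I) :
    derivL χ j (twist χ i y) = (χ i j : R) • twist χ i (derivL χ j y) := by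
  induction y using freeAlgebra_induction_left with
  | one => simp
  | add x y hx hy => simp [hx, hy]
  | smul c x hx => rw [map_smul, map_smul, hx, map_smul, map_smul, smul_comm]
  | ι_mul k x hx =>
    by_cases h : j = k
    · subst h; simp [hx, smul_smul, smul_add, mul_comm]
    · simp only [twist_ι_mul, map_smul, derivL_ι_mul, if_neg h, zero_add, hx, smul_smul,
        mul_smul_comm]
      congr 1
      ring

lemma twist_derivR (i j : I) (y : FreeAlgebra R I) :
    derivR χ j (twist χ i y) = (χ i j : R) • twist χ i (derivR χ j y) := by
  induction y using freeAlgebra_induction_left with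
  | one => simp
  | add x y hx hy => simp [hx, hy]
  | smul c x hx => rw [map_smul, map_smul, hx, map_smul, map_smul, smul_comm]
  | ι_mul k x hx =>
    by_cases h : j = k
    · subst h; simp [hx, smul_smul, smul_add, twist_comm χ i j]
    · simp [hx, h, smul_smul, mul_comm]

lemma derivL_of_notMem {i : I} {β : Multiset I} (hi : i ∉ β) {x : FreeAlgebra R I}
    (hx : x ∈ homog R β) : derivL χ i x = 0 := by
  induction hx using homog_induction with
  | hw w h =>
    subst h
    rw [Multiset.mem_coe] at hi
    induction w with
    | nil => simp
    | cons k w ih =>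
      simp only [List.mem_cons, not_or] at hi
      simp [ih hi.2, hi.1]
  | zero => simp
  | add x y _ _ hx hy => simp [hx, hy]
  | smul c x _ hx => simp [hx]

lemma derivL_mem_homog (i : I) {β : Multiset I} {x : FreeAlgebra R I}
    (hx : x ∈ homog R (i ::ₘ β)) : derivL χ i x ∈ homog R β := by
  induction hx using homog_induction with
  | hw w h =>
    induction w generalizing β with
    | nil => simp at h
    | cons j w ih =>
      rw [word_cons, derivL_ι_mul]
      rw [← Multiset.cons_coe] at h
      refine add_mem ?_ (Submodule.smul_mem _ _ ?_)
      · split_ifs with hij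
        · subst hij
          rw [Multiset.cons_inj_right] at h
          subst h
          exact word_mem_homog w
        · exact zero_mem _
      · rw [Multiset.cons_eq_cons] at h
        by_cases hi : i ∈ w
        · obtain ⟨γ, hγ⟩ := Multiset.exists_cons_of_mem (Multiset.mem_coe.2 hi)
          have hβ : β = j ::ₘ γ := by
            rcases h with ⟨rfl, h⟩ | ⟨hne, cs, h1, h2⟩
            · rw [← h, hγ]
            · rw [h2]
              rw [hγ, Multiset.cons_inj_right] at h1
              rw [h1]
          rw [hβ]
          exact ι_mul_mem_homog j (ih hγ)
        · rw [derivL_of_notMem χ (mt Multiset.mem_coe.1 hi) (word_mem_homog w)]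
          simp
  | zero => simp
  | add x y _ _ hx hy => rw [map_add]; exact add_mem hx hy
  | smul c x _ hx => rw [map_smul]; exact Submodule.smul_mem _ _ hx

lemma derivR_of_notMem {i : I} {β : Multiset I} (hi : i ∉ β) {x : FreeAlgebra R I}
    (hx : x ∈ homog R β) : derivR χ i x = 0 := by
  induction hx using homog_induction with
  | hw w h =>
    subst h
    rw [Multiset.mem_coe] at hi
    induction w with
    | nil => simp
    | cons k w ih =>
      simp only [List.mem_cons, not_or] at hi
      simp [ih hi.2, hi.1]
  | zero => simp
  | add x y _ _ hx hy => simp [hx, hy]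
  | smul c x _ hx => simp [hx]

lemma derivR_mem_homog (i : I) {β : Multiset I} {x : FreeAlgebra R I}
    (hx : x ∈ homog R (i ::ₘ β)) : derivR χ i x ∈ homog R β := by
  induction hx using homog_induction with
  | hw w h =>
    induction w generalizing β with
    | nil => simp at h
    | cons j w ih =>
      rw [word_cons, derivR_ι_mul]
      rw [← Multiset.cons_coe] at h
      refine add_mem ?_ ?_
      · rw [Multiset.cons_eq_cons] at h
        by_cases hi : i ∈ w
        · obtain ⟨γ, hγ⟩ := Multiset.exists_cons_of_mem (Multiset.mem_coe.2 hi)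
          have hβ : β = j ::ₘ γ := by
            rcases h with ⟨rfl, h⟩ | ⟨hne, cs, h1, h2⟩
            · rw [← h, hγ]
            · rw [h2]
              rw [hγ, Multiset.cons_inj_right] at h1
              rw [h1]
          rw [hβ]
          exact ι_mul_mem_homog j (ih hγ)
        · rw [derivR_of_notMem χ (mt Multiset.mem_coe.1 hi) (word_mem_homog w)]
          simp
      · split_ifs with hij
        · subst hij
          rw [Multiset.cons_inj_right] at h
          subst h
          rw [twist_of_homog χ i (word_mem_homog w)]
          exact Submodule.smul_mem _ _ (word_mem_homog w)
        · exact zero_mem _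
  | zero => simp
  | add x y _ _ hx hy => rw [map_add]; exact add_mem hx hy
  | smul c x _ hx => rw [map_smul]; exact Submodule.smul_mem _ _ hx

variable {χ}

lemma derivL_derivR (hχ : ∀ i j, χ i j = χ j i) (i j : I) (y : FreeAlgebra R I) :
    derivL χ i (derivR χ j y) = derivR χ j (derivL χ i y) := by
  induction y using freeAlgebra_induction_left with
  | one => simp
  | add x y hx hy => simp [hx, hy]
  | smul c x hx => simp [hx]
  | ι_mul k x hx =>
    by_cases h : j = k
    · subst h
      by_cases h' : i = j
      · subst h'; simp [hx, twist_derivL, smul_add]; abel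
      · simp [hx, h', twist_derivL, smul_add, hχ j i]
    · by_cases h' : i = k
      · subst h'; simp [hx, h]
      · simp [hx, h, h']

variable (χ) in
/-- The operators `y ↦ D_{i_n} ⋯ D_{i_1} y` attached to the words `i_1 ⋯ i_n`. -/
def derivLHom : FreeAlgebra R I →ₐ[R] (Module.End R (FreeAlgebra R I))ᵐᵒᵖ :=
  FreeAlgebra.lift R fun i => MulOpposite.op (derivL χ i)

variable (R I) in
/-- The constant term of an element of the free algebra. -/
abbrev counit : FreeAlgebra R I →ₐ[R] R := FreeAlgebra.algebraMapInv

@[simp] lemma counit_ι_mul (i : I) (x : FreeAlgebra R I) :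
    counit R I (FreeAlgebra.ι R i * x) = 0 := by
  rw [map_mul]
  simp [FreeAlgebra.algebraMapInv]

variable (χ) in
/-- The bilinear form on the free algebra with `(θ_i x, y) = (x, D_i y)` and `(1, 1) = 1`. -/
def form : FreeAlgebra R I →ₗ[R] FreeAlgebra R I →ₗ[R] R :=
  LinearMap.mk₂ R (fun x y => counit R I ((derivLHom χ x).unop y))
    (by simp) (by simp) (by simp) (by simp)

@[simp] lemma form_one (y : FreeAlgebra R I) : form χ 1 y = counit R I y := by
  simp [form]

@[simp] lemma form_ι_mul (i : I) (x y : FreeAlgebra R I) :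
    form χ (FreeAlgebra.ι R i * x) y = form χ x (derivL χ i y) := by
  simp [form, derivLHom]

lemma counit_twist (i : I) (y : FreeAlgebra R I) :
    counit R I (twist χ i y) = counit R I y := by
  induction y using freeAlgebra_induction_left with
  | one => simp
  | add x y hx hy => simp [hx, hy]
  | smul c x hx => simp [hx]
  | ι_mul j x hx => simp

lemma counit_derivL_eq (i : I) (y : FreeAlgebra R I) :
    counit R I (derivL χ i y) = counit R I (derivR χ i y) := by
  induction y using freeAlgebra_induction_left with
  | one => simp
  | add x y hx hy => simp [hx, hy]
  | smul c x hx => simp [hx]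
  | ι_mul j x hx =>
    by_cases h : i = j
    · subst h; simp [counit_twist]
    · simp [h]

/-- Right multiplication by `θ_i` is adjoint to the right derivation. Together with `form_ι_mul` this
gives the symmetry of the form. -/
lemma form_mul_ι (hχ : ∀ i j, χ i j = χ j i) (i : I) (x y : FreeAlgebra R I) :
    form χ (x * FreeAlgebra.ι R i) y = form χ x (derivR χ i y) := by
  induction x using freeAlgebra_induction_left generalizing y with
  | one =>
    have := form_ι_mul (χ := χ) i 1 y
    rw [mul_one] at this
    rw [one_mul, this, form_one, form_one, counit_derivL_eq]
  | add a b ha hb => simp [add_mul, ha, hb]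
  | smul c a ha => simp [ha]
  | ι_mul j a ha => rw [mul_assoc, form_ι_mul, ha, form_ι_mul, derivL_derivR hχ]

lemma form_apply_ι_mul (hχ : ∀ i j, χ i j = χ j i) (i : I) (x y : FreeAlgebra R I) :
    form χ x (FreeAlgebra.ι R i * y) = form χ (derivL χ i x) y := by
  induction x using freeAlgebra_induction_left generalizing y with
  | one => simp
  | add a b ha hb => simp [ha, hb]
  | smul c a ha => simp [ha]
  | ι_mul j a ha =>
    by_cases h : i = j
    · subst h; simp [ha]
    · simp [ha, h, Ne.symm h, hχ j i]

lemma form_symm (hχ : ∀ i j, χ i j = χ j i) (x y : FreeAlgebra R I) :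
    form χ x y = form χ y x := by
  induction y using freeAlgebra_induction_left generalizing x with
  | one =>
    rw [form_one]
    induction x using freeAlgebra_induction_left with
    | one => simp
    | add a b ha hb => simp [ha, hb]
    | smul c a ha => simp [ha]
    | ι_mul i a ha => simp
  | add a b ha hb => simp [ha, hb]
  | smul c a ha => simp [ha]
  | ι_mul i a ha => rw [form_apply_ι_mul hχ, ha, form_ι_mul]

lemma form_of_ne {β γ : Multiset I} (h : β ≠ γ) {x y : FreeAlgebra R I}
    (hx : x ∈ homog R β) (hy : y ∈ homog R γ) : form χ x y = 0 := by
  induction hx using homog_induction with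
  | hw w hw =>
    subst hw
    induction w generalizing γ y with
    | nil =>
      rw [word_nil, form_one]
      induction hy using homog_induction with
      | hw w hw =>
        cases w with
        | nil => exact absurd hw h
        | cons i w => simp
      | zero => simp
      | add x y _ _ hx hy => simp [hx, hy]
      | smul c x _ hx => simp [hx]
    | cons i w ih =>
      rw [word_cons, form_ι_mul]
      by_cases hi : i ∈ γ
      · obtain ⟨δ, rfl⟩ := Multiset.exists_cons_of_mem hi
        refine ih (γ := δ) (derivL_mem_homog χ i hy) ?_
        rintro rfl
        exact h rfl
      · rw [derivL_of_notMem χ hi hy, map_zero]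
  | zero => simp
  | add x y _ _ hx' hy' => simp [hx', hy']
  | smul c x _ hx' => simp [hx']

variable (χ) in
/-- The radical of the form on the free algebra. -/
def radical : Submodule R (FreeAlgebra R I) where
  carrier := {y | ∀ x, form χ x y = 0}
  add_mem' hx hy z := by rw [map_add, hx z, hy z, add_zero]
  zero_mem' z := by simp
  smul_mem' c x hx z := by rw [map_smul, hx z, smul_zero]

lemma derivL_mem_radical (i : I) {y : FreeAlgebra R I} (hy : y ∈ radical χ) :
    derivL χ i y ∈ radical χ := fun x => by rw [← form_ι_mul, hy]

lemma derivR_mem_radical (hχ : ∀ i j, χ i j = χ j i) (i : I) {y : FreeAlgebra R I}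
    (hy : y ∈ radical χ) : derivR χ i y ∈ radical χ := fun x => by rw [← form_mul_ι hχ, hy]

lemma form_twist (i : I) (x y : FreeAlgebra R I) :
    form χ x (twist χ i y) = form χ (twist χ i x) y := by
  induction x using freeAlgebra_induction_left generalizing y with
  | one => simp [counit_twist]
  | add a b ha hb => simp [ha, hb]
  | smul c a ha => simp [ha]
  | ι_mul j a ha => simp [twist_derivL, ha]

lemma twist_mem_radical (i : I) {y : FreeAlgebra R I} (hy : y ∈ radical χ) :
    twist χ i y ∈ radical χ := fun x => by rw [form_twist, hy]

lemma counit_of_mem_radical {y : FreeAlgebra R I} (hy : y ∈ radical χ) : counit R I y = 0 := by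
  rw [← form_one (χ := χ), hy]

/-- An element of degree `β` orthogonal to all words of degree `β` lies in the radical. -/
lemma mem_radical_of_homog {β : Multiset I} {y : FreeAlgebra R I} (hy : y ∈ homog R β)
    (h : ∀ w : List I, (w : Multiset I) = β → form χ (word R w) y = 0) : y ∈ radical χ := by
  intro x
  obtain ⟨s, z, hz, rfl⟩ := exists_eq_sum_homog x
  rw [map_sum, LinearMap.sum_apply]
  refine Finset.sum_eq_zero fun γ _ => ?_
  by_cases hγ : γ = β
  · subst hγ
    refine homog_induction (p := fun x _ => form χ x y = 0) h ?_ ?_ ?_ (hz γ)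
    · simp
    · intro a b _ _ ha hb; simp [ha, hb]
    · intro c a _ ha; simp [ha]
  · exact form_of_ne hγ (hz γ) hy

end FreeForm

/-! ### Generalized inverses of the Gram matrices -/

section GeneralizedInverse

/-- Over a semisimple commutative ring every square matrix has a generalized inverse: the
surjection onto the image of `G` splits, and the splitting extends to the whole free module. -/
theorem exists_generalized_inverse {R : Type*} [CommRing R] [IsSemisimpleRing R] {n : Type*}
    [Fintype n] [DecidableEq n] (G : Matrix n n R) : ∃ H : Matrix n n R, G * H * G = G := by
  set g := Matrix.toLin' G with hg
  obtain ⟨s, hs⟩ := IsSemisimpleModule.lifting_property (R := R) g.rangeRestrict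
    g.surjective_rangeRestrict LinearMap.id
  obtain ⟨h, hh⟩ := IsSemisimpleModule.extension_property (R := R) (LinearMap.range g).subtype
    (Submodule.subtype_injective _) s
  refine ⟨LinearMap.toMatrix' h, Matrix.toLin'.injective ?_⟩
  rw [Matrix.toLin'_mul, Matrix.toLin'_mul, Matrix.toLin'_toMatrix', ← hg]
  ext1 i
  ext1
  simp only [LinearMap.comp_apply]
  set x := LinearMap.single R (fun _ => R) i 1
  have h1 := LinearMap.congr_fun hs (g.rangeRestrict x)
  have h2 := LinearMap.congr_fun hh (g.rangeRestrict x)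
  simp only [LinearMap.comp_apply, LinearMap.id_apply, Submodule.subtype_apply] at h1 h2
  have h3 := congrArg Subtype.val h1
  simp only [LinearMap.codRestrict_apply, LinearMap.rangeRestrict] at h2 h3
  rw [h2, h3]

end GeneralizedInverse

section CanonicalTensor

variable {R : Type*} [CommRing R] {I : Type*}

open scoped Classical in
/-- The finite set of all words with content `β`. -/
def wordsOf (β : Multiset I) : Finset (List I) := β.lists.toFinset

@[simp] lemma mem_wordsOf {β : Multiset I} {w : List I} :
    w ∈ wordsOf β ↔ (w : Multiset I) = β := by
  simp [wordsOf, eq_comm]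

variable (χ : I → I → Rˣ)

lemma exists_gramInv [IsSemisimpleRing R] (β : Multiset I) : ∃ H : List I → List I → R,
    ∀ a ∈ wordsOf β, ∀ d ∈ wordsOf β,
      ∑ b ∈ wordsOf β, ∑ c ∈ wordsOf β,
        form χ (word R a) (word R b) * H b c * form χ (word R c) (word R d) =
      form χ (word R a) (word R d) := by
  classical
  set G := Matrix.of fun a b : wordsOf β => form χ (word R a.1) (word R b.1) with hG
  obtain ⟨H, hH⟩ : ∃ H : wordsOf β → wordsOf β → R, G * Matrix.of H * G = G :=
    exists_generalized_inverse G
  refine ⟨fun a b => if h : a ∈ wordsOf β ∧ b ∈ wordsOf β then H ⟨a, h.1⟩ ⟨b, h.2⟩ else 0, ?_⟩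
  intro a ha d hd
  have h := congrFun (congrFun hH ⟨a, ha⟩) ⟨d, hd⟩
  simp only [hG, Matrix.mul_apply, Matrix.of_apply] at h
  rw [← h, Finset.sum_comm, ← Finset.sum_coe_sort (wordsOf β)]
  refine Finset.sum_congr rfl fun c _ => ?_
  rw [Finset.sum_mul, ← Finset.sum_coe_sort (wordsOf β)]
  refine Finset.sum_congr rfl fun b _ => ?_
  simp only [dif_pos (And.intro b.2 c.2)]

variable [IsSemisimpleRing R]

/-- A generalized inverse of the Gram matrix of the words of content `β`. The tensor
`∑ gramInv β a b • a ⊗ b` is the canonical element of the form on the quotient of the free algebra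
by its radical. -/
def gramInv (β : Multiset I) : List I → List I → R := (exists_gramInv χ β).choose

variable {χ}

/-- The reproducing property of the canonical tensor, for all elements of degree `β`. -/
lemma gramInv_spec (β : Multiset I) {x y : FreeAlgebra R I} (hx : x ∈ homog R β)
    (hy : y ∈ homog R β) :
    ∑ b ∈ wordsOf β, ∑ c ∈ wordsOf β,
        form χ x (word R b) * gramInv χ β b c * form χ (word R c) y = form χ x y := by
  induction hx using homog_induction with
  | hw a ha =>
    induction hy using homog_induction with
    | hw d hd =>
      exact (exists_gramInv χ β).choose_spec a (mem_wordsOf.2 ha) d (mem_wordsOf.2 hd)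
    | zero => simp
    | add x y _ _ hx hy => simp only [map_add, mul_add, Finset.sum_add_distrib, hx, hy]
    | smul c x _ hx =>
      rw [map_smul, smul_eq_mul, ← hx, Finset.mul_sum]
      refine Finset.sum_congr rfl fun _ _ => ?_
      rw [Finset.mul_sum]
      refine Finset.sum_congr rfl fun _ _ => ?_
      rw [map_smul, smul_eq_mul]
      ring
  | zero => simp
  | add a b _ _ ha hb =>
    simp only [map_add, LinearMap.add_apply, add_mul, Finset.sum_add_distrib, ha, hb]
  | smul c a _ ha =>
    rw [map_smul, LinearMap.smul_apply, smul_eq_mul, ← ha, Finset.mul_sum]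
    refine Finset.sum_congr rfl fun _ _ => ?_
    rw [Finset.mul_sum]
    refine Finset.sum_congr rfl fun _ _ => ?_
    rw [LinearMap.smul_apply, smul_eq_mul]
    ring

omit [IsSemisimpleRing R] in
lemma sum_word_mem_homog (β : Multiset I) (g : List I → List I → R) :
    ∑ b ∈ wordsOf β, ∑ c ∈ wordsOf β, g b c • word R c ∈ homog R β :=
  sum_mem fun _ _ => sum_mem fun _ hc => Submodule.smul_mem _ _
    ((mem_wordsOf.1 hc) ▸ word_mem_homog _)

omit [IsSemisimpleRing R] in
lemma sum_word_mem_homog' (β : Multiset I) (g : List I → List I → R) :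
    ∑ b ∈ wordsOf β, ∑ c ∈ wordsOf β, g b c • word R b ∈ homog R β :=
  sum_mem fun _ hb => sum_mem fun _ _ => Submodule.smul_mem _ _
    ((mem_wordsOf.1 hb) ▸ word_mem_homog _)

/-- Expansion of an element of degree `β` in the second factors of the canonical tensor, up to the
radical. -/
lemma sub_expand_mem_radical (hχ : ∀ i j, χ i j = χ j i) {β : Multiset I} {z : FreeAlgebra R I}
    (hz : z ∈ homog R β) :
    z - ∑ b ∈ wordsOf β, ∑ c ∈ wordsOf β,
      (form χ z (word R b) * gramInv χ β b c) • word R c ∈ radical χ := by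
  refine mem_radical_of_homog (β := β) (sub_mem hz (sum_word_mem_homog β _)) fun w hw => ?_
  rw [map_sub, sub_eq_zero, form_symm hχ, ← gramInv_spec β hz (hw ▸ word_mem_homog w)]
  simp only [map_sum, map_smul, smul_eq_mul]
  refine Finset.sum_congr rfl fun b _ => Finset.sum_congr rfl fun c _ => ?_
  rw [form_symm hχ (word R c)]

/-- Expansion of an element of degree `β` in the first factors of the canonical tensor, up to the
radical. -/
lemma sub_expand_mem_radical' {β : Multiset I} {z : FreeAlgebra R I} (hz : z ∈ homog R β) :
    z - ∑ b ∈ wordsOf β, ∑ c ∈ wordsOf β,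
      (gramInv χ β b c * form χ (word R c) z) • word R b ∈ radical χ := by
  refine mem_radical_of_homog (β := β) (sub_mem hz (sum_word_mem_homog' β _)) fun w hw => ?_
  rw [map_sub, sub_eq_zero, ← gramInv_spec β (hw ▸ word_mem_homog w) hz]
  simp only [map_sum, map_smul, smul_eq_mul]
  refine Finset.sum_congr rfl fun b _ => Finset.sum_congr rfl fun c _ => ?_
  ring

/-- The canonical tensors of degrees `β'` and `β` are exchanged by a pair of adjoint operators
`L : F_β' → F_β` and `L' : F_β → F_β'`, up to the radical. -/
lemma canonical_transfer (hχ : ∀ i j, χ i j = χ j i) {X : Type*} [AddCommGroup X] [Module R X]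
    {β β' : Multiset I} (L L' : FreeAlgebra R I →ₗ[R] FreeAlgebra R I)
    (hL : ∀ z ∈ homog R β', L z ∈ homog R β) (hL' : ∀ z ∈ homog R β, L' z ∈ homog R β')
    (adj : ∀ x y, form χ (L' x) y = form χ x (L y))
    (Φ : FreeAlgebra R I →ₗ[R] FreeAlgebra R I →ₗ[R] X) (W : Submodule R X)
    (h1 : ∀ a, ∀ z ∈ homog R β, z ∈ radical χ → Φ a z = 0)
    (h2 : ∀ z ∈ homog R β', z ∈ radical χ → ∀ d ∈ wordsOf β, Φ z (word R d) ∈ W) :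
    ∑ a ∈ wordsOf β', ∑ b ∈ wordsOf β', gramInv χ β' a b • Φ (word R a) (L (word R b)) -
      ∑ c ∈ wordsOf β, ∑ d ∈ wordsOf β, gramInv χ β c d • Φ (L' (word R c)) (word R d) ∈ W := by
  have e1 : ∀ a, ∀ b ∈ wordsOf β', Φ (word R a) (L (word R b)) =
      ∑ c ∈ wordsOf β, ∑ d ∈ wordsOf β,
        (form χ (word R b) (L' (word R c)) * gramInv χ β c d) • Φ (word R a) (word R d) := by
    intro a b hb
    have hb' : word R b ∈ homog R β' := (mem_wordsOf.1 hb) ▸ word_mem_homog b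
    have h := h1 (word R a) _ (sub_mem (hL _ hb') (sum_word_mem_homog β _))
      (sub_expand_mem_radical hχ (hL _ hb'))
    rw [map_sub, sub_eq_zero] at h
    rw [h]
    simp only [map_sum, map_smul]
    refine Finset.sum_congr rfl fun c _ => Finset.sum_congr rfl fun d _ => ?_
    rw [form_symm hχ (L (word R b)), ← adj, form_symm hχ]
  have e2 : ∑ a ∈ wordsOf β', ∑ b ∈ wordsOf β', gramInv χ β' a b • Φ (word R a) (L (word R b)) =
      ∑ c ∈ wordsOf β, ∑ d ∈ wordsOf β, gramInv χ β c d •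
        Φ (∑ a ∈ wordsOf β', ∑ b ∈ wordsOf β',
          (gramInv χ β' a b * form χ (word R b) (L' (word R c))) • word R a) (word R d) := by
    have : ∑ a ∈ wordsOf β', ∑ b ∈ wordsOf β', gramInv χ β' a b •
          Φ (word R a) (L (word R b)) =
        ∑ a ∈ wordsOf β', ∑ b ∈ wordsOf β', ∑ c ∈ wordsOf β, ∑ d ∈ wordsOf β,
          gramInv χ β' a b • (form χ (word R b) (L' (word R c)) * gramInv χ β c d) •
            Φ (word R a) (word R d) := by
      refine Finset.sum_congr rfl fun a _ => Finset.sum_congr rfl fun b hb => ?_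
      rw [e1 a b hb]
      simp only [Finset.smul_sum]
    rw [this]
    simp only [map_sum, map_smul, LinearMap.sum_apply, LinearMap.smul_apply, Finset.smul_sum]
    have h4 : ∀ f : List I → List I → List I → List I → X,
        ∑ a ∈ wordsOf β', ∑ b ∈ wordsOf β', ∑ c ∈ wordsOf β, ∑ d ∈ wordsOf β, f a b c d =
        ∑ c ∈ wordsOf β, ∑ d ∈ wordsOf β, ∑ a ∈ wordsOf β', ∑ b ∈ wordsOf β', f a b c d := by
      intro f
      rw [Finset.sum_congr rfl fun a _ => Finset.sum_comm, Finset.sum_comm]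
      refine Finset.sum_congr rfl fun c _ => ?_
      rw [Finset.sum_congr rfl fun a _ => Finset.sum_comm]
      rw [Finset.sum_congr rfl fun a _ => Finset.sum_congr rfl fun d _ => rfl, Finset.sum_comm]
    rw [h4]
    refine Finset.sum_congr rfl fun c _ => Finset.sum_congr rfl fun d _ =>
      Finset.sum_congr rfl fun a _ => Finset.sum_congr rfl fun b _ => ?_
    simp only [smul_smul]
    ring_nf
  rw [e2, ← Finset.sum_sub_distrib]
  refine sum_mem fun c hc => ?_
  rw [← Finset.sum_sub_distrib]
  refine sum_mem fun d hd => ?_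
  rw [← smul_sub, ← LinearMap.sub_apply, ← map_sub]
  refine Submodule.smul_mem _ _ ?_
  have hc' : L' (word R c) ∈ homog R β' := hL' _ ((mem_wordsOf.1 hc) ▸ word_mem_homog c)
  refine h2 _ (sub_mem (sum_word_mem_homog' β' _) hc') ?_ d hd
  rw [← neg_sub]
  exact neg_mem (sub_expand_mem_radical' hc')

end CanonicalTensor

/-! ### Rank one: weight modules over the quantum `sl₂` -/

section RankOne

variable {R : Type*} [CommRing R]

/-- The number `⟨n⟩ = N (1 - p ^ n)`, which is `(1 - p ^ n) / (1 - p)` for `N = 1 / (1 - p)`. -/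
def bra (p : Rˣ) (N : R) (n : ℤ) : R := N * (1 - ((p ^ n : Rˣ) : R))

@[simp] lemma bra_zero (p : Rˣ) (N : R) : bra p N 0 = 0 := by simp [bra]

variable {X : Type*} [AddCommGroup X] [Module R X]

/-- A pair of operators raising and lowering the weights by two, which satisfies the commutation
relation `e f = p⁻¹ f e + (1 - p ^ n) / (1 - p)` on the vectors of weight `n`. -/
structure IsRankOne (p : Rˣ) (N : R) (e f : Module.End R X) (W : ℤ → Submodule R X) : Prop where
  e_mem : ∀ n, ∀ u ∈ W n, e u ∈ W (n + 2)
  f_mem : ∀ n, ∀ u ∈ W n, f u ∈ W (n - 2)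
  comm : ∀ n, ∀ u ∈ W n, e (f u) = ((p⁻¹ : Rˣ) : R) • f (e u) + bra p N n • u
  hN : N * (1 - (p : R)) = 1

namespace IsRankOne

variable {p : Rˣ} {N : R} {e f : Module.End R X} {W : ℤ → Submodule R X}

/-- The roles of `e` and `f` can be exchanged, replacing `p` by its inverse. -/
lemma swap (h : IsRankOne p N e f W) :
    IsRankOne p⁻¹ (-((p : R) * N)) f e (fun n => W (-n)) where
  e_mem n u hu := by
    have := h.f_mem _ u hu
    rwa [show -(n + 2) = -n - 2 by ring]
  f_mem n u hu := by
    have := h.e_mem _ u hu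
    rwa [show -(n - 2) = -n + 2 by ring]
  comm n u hu := by
    have hp : (p : R) * ((p⁻¹ : Rˣ) : R) = 1 := by simp
    have h1 : bra p⁻¹ (-((p : R) * N)) n = -((p : R) * bra p N (-n)) := by
      simp only [bra, inv_zpow, zpow_neg]; ring
    rw [h1, h.comm _ u hu, inv_inv, smul_add, smul_smul, smul_smul, hp, one_smul, add_assoc,
      ← add_smul, add_neg_cancel, zero_smul, add_zero]
  hN := by
    have hp : (p : R) * ((p⁻¹ : Rˣ) : R) = 1 := by simp
    have := h.hN
    linear_combination this + N * hp

lemma f_pow_mem (h : IsRankOne p N e f W) (k : ℕ) {n : ℤ} {u : X} (hu : u ∈ W n) :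
    (f ^ k) u ∈ W (n - 2 * k) := by
  induction k with
  | zero => simpa using hu
  | succ k ih =>
    rw [pow_succ', Module.End.mul_apply]
    have := h.f_mem _ _ ih
    rwa [show n - 2 * ((k + 1 : ℕ) : ℤ) = n - 2 * k - 2 by push_cast; ring]

lemma e_pow_mem (h : IsRankOne p N e f W) (k : ℕ) {n : ℤ} {u : X} (hu : u ∈ W n) :
    (e ^ k) u ∈ W (n + 2 * k) := by
  induction k with
  | zero => simpa using hu
  | succ k ih =>
    rw [pow_succ', Module.End.mul_apply]
    have := h.e_mem _ _ ih
    rwa [show n + 2 * ((k + 1 : ℕ) : ℤ) = n + 2 * k + 2 by push_cast; ring]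

/-- The commutation of `e` with a power of `f`. On a highest weight vector of weight `n` the first
term drops out, and `f ^ (n + 1)` yields another vector killed by `e`. -/
lemma e_f_pow (h : IsRankOne p N e f W) (k : ℕ) {n : ℤ} {u : X} (hu : u ∈ W n) :
    e ((f ^ (k + 1)) u) = ((p ^ (-(k + 1 : ℤ)) : Rˣ) : R) • (f ^ (k + 1)) (e u) +
      (((p ^ (-(k : ℤ)) : Rˣ) : R) * bra p N (k + 1) * bra p N (n - k)) • (f ^ k) u := by
  induction k generalizing n u with
  | zero =>
    have h1 : bra p N 1 = 1 := by simpa [bra] using h.hN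
    simp [h.comm n u hu, h1]
  | succ k ih =>
    rw [pow_succ, Module.End.mul_apply, ih (h.f_mem n u hu), h.comm n u hu]
    have e1 : (f ^ k) (f u) = (f ^ (k + 1)) u := by rw [pow_succ, Module.End.mul_apply]
    have e2 : (f ^ (k + 1)) (f (e u)) = (f ^ (k + 1 + 1)) (e u) := by
      rw [pow_succ _ (k + 1), Module.End.mul_apply]
    rw [map_add, map_smul, map_smul, e1, e2, smul_add, smul_smul, smul_smul, add_assoc, ← add_smul]
    congr 2
    · push_cast
      rw [neg_add, neg_add, neg_add, zpow_add, zpow_add, zpow_add]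
      simp
    · have hP : (p : R) * ((p⁻¹ : Rˣ) : R) = 1 := by simp
      have hB : ((p ^ (k : ℤ) : Rˣ) : R) * ((p ^ (-(k : ℤ)) : Rˣ) : R) = 1 := by
        rw [← Units.val_mul, ← zpow_add]; simp
      have hN := h.hN
      simp only [bra]
      push_cast
      rw [show -((k : ℤ) + 1) = -(k : ℤ) + -1 by ring,
        show n - 2 - (k : ℤ) = n + (-(k : ℤ)) + -1 + -1 by ring,
        show n - ((k : ℤ) + 1) = n + (-(k : ℤ)) + -1 by ring]
      simp only [zpow_add, zpow_one, zpow_neg_one, Units.val_mul]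
      generalize ((p ^ (k : ℤ) : Rˣ) : R) = b at *
      generalize ((p ^ (-(k : ℤ)) : Rˣ) : R) = b' at *
      generalize ((p ^ (n : ℤ) : Rˣ) : R) = a at *
      generalize ((p⁻¹ : Rˣ) : R) = P' at *
      generalize (p : R) = P at *
      linear_combination (-b' * P' * N * (1 - a)) * hN - b' * N ^ 2 * (1 - b * P) * hP -
        b' * P' * N ^ 2 * a * (P - 1) * (P * P' * hB + hP)

/-- The commutation of a power of `e` with `f`. -/
lemma e_pow_f (h : IsRankOne p N e f W) (k : ℕ) {n : ℤ} {u : X} (hu : u ∈ W n) :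
    (e ^ (k + 1)) (f u) = ((p ^ (-(k + 1 : ℤ)) : Rˣ) : R) • f ((e ^ (k + 1)) u) +
      (((p ^ (-(k : ℤ)) : Rˣ) : R) * bra p N (k + 1) * bra p N (n + k)) • (e ^ k) u := by
  induction k generalizing n u with
  | zero =>
    have h1 : bra p N 1 = 1 := by simpa [bra] using h.hN
    simp [h.comm n u hu, h1]
  | succ k ih =>
    have e1 : e ((e ^ k) u) = (e ^ (k + 1)) u := by rw [pow_succ', Module.End.mul_apply]
    have e2 : e ((e ^ (k + 1)) u) = (e ^ (k + 1 + 1)) u := by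
      rw [pow_succ' _ (k + 1), Module.End.mul_apply]
    rw [pow_succ', Module.End.mul_apply, ih hu, map_add, map_smul, map_smul, e1,
      h.comm _ _ (h.e_pow_mem (k + 1) hu), e2, smul_add, smul_smul, smul_smul, add_assoc,
      ← add_smul]
    rw [← pow_succ' e (k + 1)]
    congr 2
    · push_cast
      rw [neg_add, neg_add, neg_add, zpow_add, zpow_add, zpow_add]
      simp
    · have hP : (p : R) * ((p⁻¹ : Rˣ) : R) = 1 := by simp
      have hN := h.hN
      simp only [bra]
      push_cast
      rw [show -((k : ℤ) + 1) = -(k : ℤ) + -1 by ring,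
        show n + 2 * ((k : ℤ) + 1) = n + k + k + 1 + 1 by ring,
        show n + ((k : ℤ) + 1) = n + k + 1 by ring]
      simp only [zpow_add, zpow_one, zpow_neg_one, Units.val_mul]
      generalize ((p ^ (k : ℤ) : Rˣ) : R) = b at *
      generalize ((p ^ (-(k : ℤ)) : Rˣ) : R) = b' at *
      generalize ((p ^ (n : ℤ) : Rˣ) : R) = a at *
      generalize ((p⁻¹ : Rˣ) : R) = P' at *
      generalize (p : R) = P at *
      linear_combination (-b' * P' * N * (1 - a * b ^ 2 * P ^ 2)) * hN -
        b' * N ^ 2 * (1 - b * P) * (1 - a * b) * hP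

/-- A vector of weight `-m` killed by `e ^ k` with `k ≤ m` vanishes, if `f` acts nilpotently
on it. -/
lemma eq_zero_of_e_pow (h : IsRankOne p N e f W) (hu : ∀ n : ℤ, n ≠ 0 → IsUnit (bra p N n))
    (s k : ℕ) {m : ℤ} (hk : (k : ℤ) ≤ m) {y : X} (hy : y ∈ W (-m)) (hek : (e ^ k) y = 0)
    (hfs : (f ^ s) y = 0) : y = 0 := by
  induction s generalizing k m y with
  | zero => simpa using hfs
  | succ s ihs =>
    induction k generalizing y with
    | zero => simpa using hek
    | succ k ihk =>
      push_cast at hk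
      set c := ((p ^ (-(k : ℤ)) : Rˣ) : R) * bra p N (k + 1) * bra p N (-m + k) with hc
      have hcu : IsUnit c :=
        ((Units.isUnit _).mul (hu _ (by omega))).mul (hu _ (by omega))
      -- `f y` has weight `-(m + 2)` and is killed by `e ^ (k + 2)`
      have hfy : f y = 0 := by
        refine ihs (k + 2) (m := m + 2) (by push_cast; omega) ?_ ?_ ?_
        · rw [show -(m + 2) = -m - 2 by ring]
          exact h.f_mem _ _ hy
        · rw [h.e_pow_f (k + 1) hy, hek, smul_zero, add_zero, pow_succ', Module.End.mul_apply, hek,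
            map_zero, map_zero, smul_zero]
        · rw [← Module.End.mul_apply, ← pow_succ, hfs]
      -- now `0 = e ^ (k + 1) f y` is the multiple `c` of `e ^ k y`
      have h1 : c • y = 0 := by
        have h2 := h.e_pow_f k hy
        rw [hfy, map_zero, hek, map_zero, smul_zero, zero_add] at h2
        refine ihk (by omega) (Submodule.smul_mem _ _ hy) ?_ ?_
        · rw [map_smul, ← h2]
        · rw [map_smul, hfs, smul_zero]
      rwa [hcu.smul_eq_zero] at h1

/-- An operator which commutes with `e` up to a unit and lowers the weights strictly vanishes on
integrable modules. -/
lemma eq_zero_of_intertwiner (h : IsRankOne p N e f W)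
    (hu : ∀ n : ℤ, n ≠ 0 → IsUnit (bra p N n)) (hu' : ∀ n : ℤ, n ≠ 0 → IsUnit (bra p⁻¹ (-(p * N)) n))
    (he : ∀ u : X, ∃ k, (e ^ k) u = 0) (hf : ∀ u : X, ∃ k, (f ^ k) u = 0)
    (x : Module.End R X) (g : Rˣ) (b : ℤ) (hb : 0 < b) (hx : ∀ n, ∀ u ∈ W n, x u ∈ W (n - b))
    (hxe : ∀ u, e (x u) = (g : R) • x (e u)) {n : ℤ} {u : X} (hn : u ∈ W n) : x u = 0 := by
  obtain ⟨s, hs⟩ := hf u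
  induction s generalizing n u with
  | zero => rw [show u = 0 by simpa using hs, map_zero]
  | succ s ih =>
    -- a vector of weight `m ≥ k` killed by `f ^ k` vanishes
    have hswap : ∀ {k : ℕ} {m : ℤ} {y : X}, (k : ℤ) ≤ m → y ∈ W m → (f ^ k) y = 0 → y = 0 := by
      intro k m y hk hy hfy
      obtain ⟨r, hr⟩ := he y
      exact h.swap.eq_zero_of_e_pow hu' r k hk (by simpa using hy) hfy hr
    by_cases hsn : (s + 1 : ℤ) ≤ n
    · rw [hswap (by exact_mod_cast hsn) hn hs, map_zero]
    cases s with
    | zero =>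
      -- for a lowest weight vector `u` of weight `-l`, a small power of `e` kills `u`, hence `x u`,
      -- whose weight is less than `-l`
      have hfu : f u = 0 := by simpa using hs
      obtain ⟨l, rfl⟩ : ∃ l : ℕ, n = -l := ⟨(-n).toNat, by push_cast at hsn; omega⟩
      have h1 : (e ^ (l + 1)) u = 0 := by
        have h2 := h.e_pow_f l hn
        rw [hfu, map_zero, neg_add_cancel, bra_zero, mul_zero, zero_smul, add_zero, eq_comm,
          (Units.isUnit _).smul_eq_zero] at h2
        refine hswap (k := 1) ?_ (h.e_pow_mem (l + 1) hn) (by simpa using h2)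
        push_cast; omega
      have h3 : ∀ k, (e ^ k) (x u) = ((g ^ k : Rˣ) : R) • x ((e ^ k) u) := by
        intro k
        induction k with
        | zero => simp
        | succ k ih =>
          rw [pow_succ', Module.End.mul_apply, ih, map_smul, hxe, smul_smul,
            Module.End.mul_apply, pow_succ, Units.val_mul]
      obtain ⟨r, hr⟩ := hf (x u)
      refine h.eq_zero_of_e_pow hu r (l + 1) (m := l + b) (by push_cast; omega) ?_ ?_ hr
      · have := hx _ u hn
        rwa [show -((l : ℤ) + b) = -l - b by ring]
      · rw [h3, h1, map_zero, smul_zero]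
    | succ s =>
      -- `x` kills `f u` and `e f u` by induction; a combination of `e f u` and a unit multiple of
      -- `u` is killed by a smaller power of `f`
      have hfu : x (f u) = 0 := ih (h.f_mem _ _ hn) (by
        rw [← Module.End.mul_apply, ← pow_succ, hs])
      have hefu : x (e (f u)) = 0 := by
        have := hxe (f u)
        rwa [hfu, map_zero, eq_comm, (Units.isUnit _).smul_eq_zero] at this
      have h1 := h.e_f_pow s (h.f_mem _ _ hn)
      have e1 : (f ^ (s + 1)) (f u) = 0 := by rw [← Module.End.mul_apply, ← pow_succ, hs]
      have e2 : (f ^ s) (f u) = (f ^ (s + 1)) u := by rw [← Module.End.mul_apply, ← pow_succ]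
      rw [e1, e2, map_zero] at h1
      set c := ((p ^ (-(s : ℤ)) : Rˣ) : R) * bra p N (s + 1) * bra p N (n - 2 - s) with hc
      have hcu : IsUnit c := by
        refine ((Units.isUnit _).mul (hu _ (by omega))).mul (hu _ ?_)
        push_cast at hsn; omega
      set g' := p ^ (-(s + 1 : ℤ)) with hg'
      have h2 : x ((g' : R) • e (f u) + c • u) = 0 := by
        refine ih (n := n) (add_mem (Submodule.smul_mem _ _ ?_) (Submodule.smul_mem _ _ hn)) ?_
        · have := h.e_mem _ _ (h.f_mem _ _ hn)
          rwa [sub_add_cancel] at this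
        · rw [map_add, map_smul, map_smul, ← h1]
      rw [map_add, map_smul, hefu, smul_zero, zero_add, map_smul, hcu.smul_eq_zero] at h2
      exact h2

end IsRankOne

end RankOne

/-! ### The Casimir operator -/

section PairProd

variable {R : Type*} [CommRing R] {I : Type*} (χ : I → I → Rˣ)

/-- The product of the `χ i_k i_l` over the pairs `k < l` of positions of a word. -/
def pairProdList : List I → Rˣ
  | [] => 1
  | i :: w => chiM χ i w * pairProdList w

lemma pairProdList_perm (hχ : ∀ i j, χ i j = χ j i) {u w : List I} (h : u.Perm w) :
    pairProdList χ u = pairProdList χ w := by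
  induction h with
  | nil => rfl
  | cons i h ih => simp only [pairProdList, ih, Multiset.coe_eq_coe.2 h]
  | swap i j w =>
    simp only [pairProdList, ← Multiset.cons_coe, chiM_cons, hχ i j]
    ac_rfl
  | trans _ _ h1 h2 => rw [h1, h2]

/-- The product of the `χ i j` over the unordered pairs of members of a multiset. -/
def pairProd (β : Multiset I) : Rˣ := pairProdList χ β.toList

lemma pairProd_coe (hχ : ∀ i j, χ i j = χ j i) (w : List I) :
    pairProd χ (w : Multiset I) = pairProdList χ w :=
  pairProdList_perm χ hχ (Multiset.coe_eq_coe.1 (Multiset.coe_toList _))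

@[simp] lemma pairProd_zero : pairProd χ 0 = 1 := by simp [pairProd, pairProdList]

lemma pairProd_cons (hχ : ∀ i j, χ i j = χ j i) (i : I) (β : Multiset I) :
    pairProd χ (i ::ₘ β) = chiM χ i β * pairProd χ β := by
  obtain ⟨w, rfl⟩ : ∃ w : List I, (w : Multiset I) = β := ⟨β.toList, β.coe_toList⟩
  rw [Multiset.cons_coe, pairProd_coe χ hχ, pairProd_coe χ hχ]
  rfl

/-- The coefficient with which the canonical tensor of degree `β` enters the Casimir operator. -/
def casimirCoeff (β : Multiset I) : R :=
  (pairProd χ β : R) * (β.map fun i => -(1 - (((χ i i)⁻¹ : Rˣ) : R))).prod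

@[simp] lemma casimirCoeff_zero : casimirCoeff χ 0 = 1 := by simp [casimirCoeff]

lemma casimirCoeff_cons (hχ : ∀ i j, χ i j = χ j i) (i : I) (β : Multiset I) :
    casimirCoeff χ (i ::ₘ β) =
      -(1 - (((χ i i)⁻¹ : Rˣ) : R)) * (chiM χ i β : R) * casimirCoeff χ β := by
  simp only [casimirCoeff, pairProd_cons χ hχ, Multiset.map_cons, Multiset.prod_cons, Units.val_mul]
  ring

/-- The scalar by which the Casimir operator acts in degree `-β` on a highest weight module whose
highest weight vector has the `K_i`-eigenvalue `κ i`. -/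
def casimirScalar (κ : I → Rˣ) (β : Multiset I) : Rˣ := pairProd χ β ^ 2 * (β.map κ).prod

@[simp] lemma casimirScalar_zero (κ : I → Rˣ) : casimirScalar χ κ 0 = 1 := by simp [casimirScalar]

lemma casimirScalar_cons (hχ : ∀ i j, χ i j = χ j i) (κ : I → Rˣ) (i : I) (β : Multiset I) :
    casimirScalar χ κ (i ::ₘ β) = κ i * chiM χ i β ^ 2 * casimirScalar χ κ β := by
  simp only [casimirScalar, pairProd_cons χ hχ, Multiset.map_cons, Multiset.prod_cons, mul_pow]
  ac_rfl

end PairProd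

section CasimirOperator

variable {R : Type*} [CommRing R] {I : Type*}

open scoped Classical in
/-- Operators `e_i`, `f_i`, `K_i` which satisfy the relations of the quantum group attached to the
symmetric bicharacter `χ`, except for the Serre relations. Here `N i` stands for
`1 / (1 - p_i)`, `p_i = χ_ii⁻¹`. -/
structure IsQuantumModule (χ : I → I → Rˣ) (N : I → R) {X : Type*} [AddCommGroup X] [Module R X]
    (e f K : I → Module.End R X) : Prop where
  symm : ∀ i j, χ i j = χ j i
  hN : ∀ i, N i * (1 - (((χ i i)⁻¹ : Rˣ) : R)) = 1
  ef : ∀ i j u, e i (f j u) =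
    (χ i j : R) • f j (e i u) + if i = j then N i • (u - K i u) else 0
  eK : ∀ i j u, e j (K i u) = ((χ i j ^ 2 : Rˣ) : R) • K i (e j u)
  Kf : ∀ i j u, K i (f j u) = ((χ i j ^ 2 : Rˣ) : R) • f j (K i u)

variable {X : Type*} [AddCommGroup X] [Module R X]

/-- The action of the free algebra given by a family of operators. -/
def opHom (e : I → Module.End R X) : FreeAlgebra R I →ₐ[R] Module.End R X := FreeAlgebra.lift R e

@[simp] lemma opHom_ι_mul (e : I → Module.End R X) (i : I) (y : FreeAlgebra R I) (u : X) :
    opHom e (FreeAlgebra.ι R i * y) u = e i (opHom e y u) := by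
  simp [opHom]

lemma opHom_mul_ι (e : I → Module.End R X) (i : I) (y : FreeAlgebra R I) (u : X) :
    opHom e (y * FreeAlgebra.ι R i) u = opHom e y (e i u) := by
  simp [opHom]

/-- The finite set of all multisets contained in `δ`. -/
def below (δ : Multiset I) : Finset (Multiset I) := by
  classical exact δ.powerset.toFinset

@[simp] lemma mem_below {β δ : Multiset I} : β ∈ below δ ↔ β ≤ δ := by simp [below]

/-- The part of degree at most `δ` of the Casimir operator attached to the canonical tensors. The
whole operator is an infinite sum, but on a vector killed by the words in the `e_i` of degree not
at most `δ` only this part matters. -/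
def casimir [IsSemisimpleRing R] (χ : I → I → Rˣ) (e f : I → Module.End R X) (δ : Multiset I) :
    Module.End R X :=
  ∑ β ∈ below δ, casimirCoeff χ β • ∑ a ∈ wordsOf β, ∑ b ∈ wordsOf β,
    gramInv χ β a b • (opHom f (word R a) * opHom e (word R b))

lemma casimir_apply [IsSemisimpleRing R] (χ : I → I → Rˣ) (e f : I → Module.End R X)
    (δ : Multiset I) (x : X) : casimir χ e f δ x =
      ∑ β ∈ below δ, casimirCoeff χ β • ∑ a ∈ wordsOf β, ∑ b ∈ wordsOf β,
        gramInv χ β a b • opHom f (word R a) (opHom e (word R b) x) := by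
  simp [casimir, LinearMap.sum_apply]

namespace IsQuantumModule

variable {χ : I → I → Rˣ} {N : I → R} {e f K : I → Module.End R X}

/-- The commutation of `f_i` with the operators given by the free algebra through the `e_j`, in
terms of the two twisted derivations. -/
lemma opHom_e_f (h : IsQuantumModule χ N e f K) (i : I) (y : FreeAlgebra R I) (u : X) :
    opHom e y (f i u) = f i (opHom e (twist χ i y) u) +
      N i • (opHom e (derivR χ i y) u - K i (opHom e (twist χ i (derivL χ i y)) u)) := by
  induction y using freeAlgebra_induction_left with
  | one => simp
  | add x y hx hy => simp only [map_add, LinearMap.add_apply, hx, hy, smul_sub, smul_add]; abel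
  | smul c x hx =>
    simp only [map_smul, LinearMap.smul_apply, hx, smul_sub, smul_add, smul_comm c (N i)]
  | ι_mul j y hy =>
    rw [opHom_ι_mul, hy, map_add, h.ef, map_smul, map_sub, h.eK]
    by_cases hij : j = i
    · subst hij
      simp only [if_true, twist_ι_mul, derivR_ι_mul, derivL_ι_mul, map_add, map_smul,
        LinearMap.add_apply, LinearMap.smul_apply, opHom_ι_mul, smul_smul, smul_sub, smul_add]
      rw [Units.val_pow_eq_pow_val, pow_two]
      abel
    · simp only [if_neg hij, if_neg (Ne.symm hij), twist_ι_mul, derivR_ι_mul, derivL_ι_mul, map_smul,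
        LinearMap.smul_apply, opHom_ι_mul, smul_smul, smul_sub, add_zero, zero_add,
        h.symm j i]
      rw [Units.val_pow_eq_pow_val, pow_two]

/-- The commutation of `e_i` with the operators given by the free algebra through the `f_j`, in
terms of the two twisted derivations. -/
lemma e_opHom_f (h : IsQuantumModule χ N e f K) (i : I) (y : FreeAlgebra R I) (u : X) :
    e i (opHom f y u) = opHom f (twist χ i y) (e i u) +
      N i • (opHom f (derivL χ i y) u - opHom f (twist χ i (derivR χ i y)) (K i u)) := by
  have hK : ∀ y, K i (opHom f y u) = opHom f (twist χ i (twist χ i y)) (K i u) := by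
    intro y
    induction y using freeAlgebra_induction_left with
    | one => simp
    | add x y hx hy => simp only [map_add, LinearMap.add_apply, hx, hy]
    | smul c x hx => simp only [map_smul, LinearMap.smul_apply, hx]
    | ι_mul j y hy =>
      rw [opHom_ι_mul, h.Kf, hy]
      simp only [twist_ι_mul, map_smul, LinearMap.smul_apply, opHom_ι_mul, smul_smul]
      rw [Units.val_pow_eq_pow_val, pow_two]
  induction y using freeAlgebra_induction_left with
  | one => simp
  | add x y hx hy => simp only [map_add, LinearMap.add_apply, hx, hy, smul_sub, smul_add]; abel
  | smul c x hx =>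
    simp only [map_smul, LinearMap.smul_apply, hx, smul_sub, smul_add, smul_comm c (N i)]
  | ι_mul j y hy =>
    rw [opHom_ι_mul, h.ef, hy, hK]
    by_cases hij : i = j
    · subst hij
      simp only [if_true, twist_ι_mul, derivR_ι_mul, derivL_ι_mul, map_add, map_smul, map_sub,
        LinearMap.add_apply, LinearMap.smul_apply, opHom_ι_mul, smul_smul, smul_sub, smul_add]
      simp only [mul_comm (N i)]
      abel
    · simp only [if_neg hij, twist_ι_mul, derivR_ι_mul, derivL_ι_mul, map_add, map_smul, map_sub,
        LinearMap.smul_apply, opHom_ι_mul, smul_smul, smul_sub, smul_add, add_zero,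
        zero_add]
      simp only [mul_comm (N i)]

lemma opHom_e_K (h : IsQuantumModule χ N e f K) (i : I) (w : List I) (u : X) :
    opHom e (word R w) (K i u) =
      ((chiM χ i (w : Multiset I) ^ 2 : Rˣ) : R) • K i (opHom e (word R w) u) := by
  induction w with
  | nil => simp
  | cons j w ih =>
    rw [word_cons, opHom_ι_mul, ih, map_smul, h.eK, opHom_ι_mul, smul_smul, ← Multiset.cons_coe,
      chiM_cons, mul_pow, mul_comm (χ i j ^ 2), Units.val_mul]

variable [IsSemisimpleRing R]

/-- The Casimir operator satisfies `Ω f_i = f_i Ω K_i` on a vector `x`, up to the action of the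
radical of the form. -/
theorem casimir_f (h : IsQuantumModule χ N e f K) (W : Submodule R X) {x : X} (i : I)
    {δ : Multiset I} (κ : R) (hdepth : ∀ b : List I, ¬ (b : Multiset I) ≤ δ →
      opHom e (word R b) x = 0)
    (hK : K i x = κ • x) (hJe : ∀ z ∈ radical χ, opHom e z x = 0)
    (hJf : ∀ γ ≤ δ, ∀ z ∈ homog R (i ::ₘ γ), z ∈ radical χ → ∀ d ∈ wordsOf γ,
      opHom f z (opHom e (word R d) x) ∈ W) :
    casimir χ e f (i ::ₘ δ) (f i x) - κ • f i (casimir χ e f δ x) ∈ W := by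
  set S1 : Multiset I → X := fun β => ∑ a ∈ wordsOf β, ∑ b ∈ wordsOf β,
    gramInv χ β a b • opHom f (word R a * FreeAlgebra.ι R i) (opHom e (word R b) x) with hS1
  set T1 : Multiset I → X := fun β => ∑ a ∈ wordsOf β, ∑ b ∈ wordsOf β,
    gramInv χ β a b • opHom f (word R a) (opHom e (derivR χ i (word R b)) x) with hT1
  set T2 : Multiset I → X := fun β => ∑ a ∈ wordsOf β, ∑ b ∈ wordsOf β,
    gramInv χ β a b • opHom f (word R a)
      (K i (opHom e (twist χ i (derivL χ i (word R b))) x)) with hT2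
  set S2 : Multiset I → X := fun β => ∑ a ∈ wordsOf β, ∑ b ∈ wordsOf β,
    gramInv χ β a b • opHom f (FreeAlgebra.ι R i * word R a)
      (K i (opHom e (twist χ i (word R b)) x)) with hS2
  have hKe : ∀ w : List I, K i (opHom e (word R w) x) =
      (((chiM χ i (w : Multiset I) ^ 2)⁻¹ : Rˣ) : R) • κ • opHom e (word R w) x := by
    intro w
    have h1 := h.opHom_e_K i w x
    rw [hK, map_smul] at h1
    rw [h1, smul_smul, Units.inv_mul, one_smul]
  have htw : ∀ γ : Multiset I, ∀ w ∈ wordsOf γ, twist χ i (word R w) =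
      (chiM χ i γ : R) • word R w := by
    intro γ w hw
    exact twist_of_homog χ i ((mem_wordsOf.1 hw) ▸ word_mem_homog w)
  -- the canonical tensors of degrees `γ` and `γ + α_i` are exchanged by the right derivation
  have hA : ∀ γ ≤ δ, T1 (i ::ₘ γ) - S1 γ ∈ W := by
    intro γ hγ
    refine canonical_transfer h.symm (derivR χ i) (LinearMap.mulRight R (FreeAlgebra.ι R i))
      (fun z hz => derivR_mem_homog χ i hz) (fun z hz => mul_ι_mem_homog i hz)
      (fun x y => form_mul_ι h.symm i x y)
      (LinearMap.mk₂ R (fun a b => opHom f a (opHom e b x)) (by simp) (by simp) (by simp) (by simp))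
      W (fun a z _ hz => ?_) (fun z hz hzr d hd => hJf γ hγ z hz hzr d hd)
    simp [hJe z hz]
  -- and by the left derivation
  have hB : ∀ γ ≤ δ, T2 (i ::ₘ γ) - S2 γ ∈ W := by
    intro γ hγ
    refine canonical_transfer h.symm (derivL χ i) (LinearMap.mulLeft R (FreeAlgebra.ι R i))
      (fun z hz => derivL_mem_homog χ i hz) (fun z hz => ι_mul_mem_homog i hz)
      (fun x y => form_ι_mul i x y)
      (LinearMap.mk₂ R (fun a b => opHom f a (K i (opHom e (twist χ i b) x)))
        (by simp) (by simp) (by simp) (by simp))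
      W (fun a z _ hz => ?_) (fun z hz hzr d hd => ?_)
    · simp [hJe _ (twist_mem_radical i hz)]
    · simp only [LinearMap.mk₂_apply, htw γ d hd, map_smul, LinearMap.smul_apply, hKe]
      exact W.smul_mem _ (W.smul_mem _ (W.smul_mem _ (hJf γ hγ z hz hzr d hd)))
  have hS2' : ∀ γ, (chiM χ i γ : R) • S2 γ = κ • f i (∑ a ∈ wordsOf γ, ∑ b ∈ wordsOf γ,
      gramInv χ γ a b • opHom f (word R a) (opHom e (word R b) x)) := by
    intro γ
    simp only [hS2, Finset.smul_sum, map_sum]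
    refine Finset.sum_congr rfl fun a _ => Finset.sum_congr rfl fun b hb => ?_
    rw [htw γ b hb, map_smul, LinearMap.smul_apply, map_smul, hKe, opHom_ι_mul, mem_wordsOf.1 hb]
    simp only [map_smul, smul_smul]
    congr 1
    have : (chiM χ i γ : R) ^ 2 * (((chiM χ i γ ^ 2)⁻¹ : Rˣ) : R) = 1 := by
      rw [← Units.val_pow_eq_pow_val, Units.mul_inv]
    linear_combination gramInv χ γ a b * κ * this
  have hterm : ∀ β, ∑ a ∈ wordsOf β, ∑ b ∈ wordsOf β,
      gramInv χ β a b • opHom f (word R a) (opHom e (word R b) (f i x)) =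
      (chiM χ i β : R) • S1 β + N i • (T1 β - T2 β) := by
    intro β
    simp only [hS1, hT1, hT2, ← Finset.sum_sub_distrib, Finset.smul_sum, ← Finset.sum_add_distrib]
    refine Finset.sum_congr rfl fun a _ => Finset.sum_congr rfl fun b hb => ?_
    rw [h.opHom_e_f, htw β b hb, opHom_mul_ι]
    simp only [map_add, map_smul, map_sub, LinearMap.smul_apply, smul_add, smul_sub, smul_smul]
    simp only [mul_comm]
  have hsub : below δ ⊆ below (i ::ₘ δ) := fun β hβ =>
    mem_below.2 ((mem_below.1 hβ).trans (Multiset.le_cons_self δ i))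
  have hsum1 : ∑ β ∈ below (i ::ₘ δ), casimirCoeff χ β • (chiM χ i β : R) • S1 β =
      ∑ β ∈ below δ, casimirCoeff χ β • (chiM χ i β : R) • S1 β := by
    refine (Finset.sum_subset hsub fun β _ hβ => ?_).symm
    have : S1 β = 0 := by
      refine Finset.sum_eq_zero fun a _ => Finset.sum_eq_zero fun b hb => ?_
      rw [hdepth b, map_zero, smul_zero]
      rw [mem_wordsOf.1 hb]
      exact fun hle => hβ (mem_below.2 hle)
    rw [this, smul_zero, smul_zero]
  have hsum2 : ∑ β ∈ below (i ::ₘ δ), casimirCoeff χ β • N i • (T1 β - T2 β) =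
      ∑ γ ∈ below δ, casimirCoeff χ (i ::ₘ γ) • N i • (T1 (i ::ₘ γ) - T2 (i ::ₘ γ)) := by
    classical
    rw [← Finset.sum_image (s := below δ) (g := fun γ => i ::ₘ γ)
      (f := fun β => casimirCoeff χ β • N i • (T1 β - T2 β))
      (fun a _ b _ hab => (Multiset.cons_inj_right i).1 hab)]
    refine (Finset.sum_subset ?_ fun β hβ hβ' => ?_).symm
    · intro β hβ
      obtain ⟨γ, hγ, rfl⟩ := Finset.mem_image.1 hβ
      exact mem_below.2 ((Multiset.cons_le_cons_iff i).2 (mem_below.1 hγ))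
    · have hi : i ∉ β := by
        intro hi
        obtain ⟨γ, rfl⟩ := Multiset.exists_cons_of_mem hi
        exact hβ' (Finset.mem_image.2 ⟨γ, mem_below.2
          ((Multiset.cons_le_cons_iff i).1 (mem_below.1 hβ)), rfl⟩)
      have hw : ∀ b ∈ wordsOf β, word R b ∈ homog R β := fun b hb =>
        (mem_wordsOf.1 hb) ▸ word_mem_homog b
      have h1 : T1 β = 0 := Finset.sum_eq_zero fun a _ => Finset.sum_eq_zero fun b hb => by
        rw [derivR_of_notMem χ hi (hw b hb)]; simp
      have h2 : T2 β = 0 := Finset.sum_eq_zero fun a _ => Finset.sum_eq_zero fun b hb => by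
        rw [derivL_of_notMem χ hi (hw b hb)]; simp
      rw [h1, h2, sub_zero, smul_zero, smul_zero]
  rw [casimir_apply, casimir_apply]
  simp only [hterm, smul_add, Finset.sum_add_distrib]
  rw [hsum1, hsum2, ← Finset.sum_add_distrib, map_sum, Finset.smul_sum, ← Finset.sum_sub_distrib]
  refine sum_mem fun γ hγ => ?_
  rw [map_smul, smul_comm κ, ← hS2', casimirCoeff_cons χ h.symm]
  have key : casimirCoeff χ γ • (chiM χ i γ : R) • S1 γ +
      (-(1 - (((χ i i)⁻¹ : Rˣ) : R)) * (chiM χ i γ : R) * casimirCoeff χ γ) •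
        N i • (T1 (i ::ₘ γ) - T2 (i ::ₘ γ)) - casimirCoeff χ γ • (chiM χ i γ : R) • S2 γ =
      (casimirCoeff χ γ * (chiM χ i γ : R)) •
        ((T2 (i ::ₘ γ) - S2 γ) - (T1 (i ::ₘ γ) - S1 γ)) := by
    have : -(1 - (((χ i i)⁻¹ : Rˣ) : R)) * (chiM χ i γ : R) * casimirCoeff χ γ * N i =
        -(casimirCoeff χ γ * (chiM χ i γ : R)) := by
      linear_combination (-(chiM χ i γ : R) * casimirCoeff χ γ) * h.hN i
    rw [smul_smul, smul_smul, smul_smul, this]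
    module
  rw [key]
  exact W.smul_mem _ (sub_mem (hB γ (mem_below.1 hγ)) (hA γ (mem_below.1 hγ)))

/-- The Casimir operator fixes the vectors killed by all `e_i`, modulo a submodule `W`. -/
theorem casimir_sub_self_mem (W : Submodule R X) (δ : Multiset I) {x : X}
    (hf : ∀ i, ∀ u ∈ W, f i u ∈ W)
    (hx : ∀ (w : List I), w ≠ [] → opHom e (word R w) x ∈ W) :
    casimir χ e f δ x - x ∈ W := by
  have hF : ∀ (w : List I), ∀ u ∈ W, opHom f (word R w) u ∈ W := by
    intro w u hu
    induction w with
    | nil => simpa using hu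
    | cons i w ih => rw [word_cons, opHom_ι_mul]; exact hf i _ ih
  classical
  have h0 : (0 : Multiset I) ∈ below δ := mem_below.2 (Multiset.zero_le δ)
  have hw0 : wordsOf (0 : Multiset I) = {[]} := by
    ext w; simp
  have hg : gramInv χ (0 : Multiset I) [] [] = 1 := by
    have := gramInv_spec (χ := χ) (0 : Multiset I) (word_mem_homog (R := R) ([] : List I))
      (word_mem_homog (R := R) ([] : List I))
    simpa [hw0] using this
  rw [casimir_apply, ← Finset.add_sum_erase _ _ h0]
  simp only [hw0, Finset.sum_singleton, hg, casimirCoeff_zero, one_smul, word_nil, map_one,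
    Module.End.one_apply, add_sub_cancel_left]
  refine sum_mem fun β hβ => W.smul_mem _ (sum_mem fun a _ => sum_mem fun b hb =>
    W.smul_mem _ (hF a _ (hx b ?_)))
  rintro rfl
  exact (Finset.mem_erase.1 hβ).1 (mem_wordsOf.1 hb).symm

end IsQuantumModule

end CasimirOperator

/-! ### Highest weight modules and the radical of the form -/

section HighestWeight

variable {R : Type*} [CommRing R] {I : Type*} {X : Type*} [AddCommGroup X] [Module R X]

/-- `v` is a highest weight vector with `K_i`-eigenvalues `κ i`, generating `X` under the
operators `f_i`. -/
structure IsHighestWeight {χ : I → I → Rˣ} {N : I → R} {e f K : I → Module.End R X}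
    (h : IsQuantumModule χ N e f K) (v : X) (κ : I → Rˣ) : Prop where
  e_hw : ∀ i, e i v = 0
  K_hw : ∀ i, K i v = (κ i : R) • v
  gen : ∀ u : X, ∃ y : FreeAlgebra R I, u = opHom f y v

namespace IsQuantumModule

variable {χ : I → I → Rˣ} {N : I → R} {e f K : I → Module.End R X} {v : X} {κ : I → Rˣ}

lemma K_opHom_f (h : IsQuantumModule χ N e f K) (i : I) {β : Multiset I} {y : FreeAlgebra R I}
    (hy : y ∈ homog R β) (u : X) :
    K i (opHom f y u) = ((chiM χ i β ^ 2 : Rˣ) : R) • opHom f y (K i u) := by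
  induction hy using homog_induction with
  | hw w hw =>
    subst hw
    induction w with
    | nil => simp
    | cons j w ih =>
      rw [word_cons, opHom_ι_mul, h.Kf, ih, map_smul, opHom_ι_mul, smul_smul, ← Multiset.cons_coe,
        chiM_cons, mul_pow, Units.val_mul]
  | zero => simp
  | add a b _ _ ha hb => simp only [map_add, LinearMap.add_apply, ha, hb, smul_add]
  | smul c a _ ha => simp only [map_smul, LinearMap.smul_apply, ha, smul_comm c]

/-- The radical of the form acts by zero through the operators `e_i` on every highest weight
module: the `f_i` normalize it, and it kills the highest weight vector. -/
theorem opHom_e_of_mem_radical (h : IsQuantumModule χ N e f K) (hv : IsHighestWeight h v κ)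
    {z : FreeAlgebra R I} (hz : z ∈ radical χ) (u : X) : opHom e z u = 0 := by
  obtain ⟨y, rfl⟩ := hv.gen u
  induction y using freeAlgebra_induction_left generalizing z with
  | one =>
    have : ∀ z, opHom e z v = counit R I z • v := by
      intro z
      induction z using freeAlgebra_induction_left with
      | one => simp
      | add x y hx hy => simp [hx, hy, add_smul]
      | smul c x hx => simp [hx, mul_smul]
      | ι_mul j y hy => rw [opHom_ι_mul, hy, map_smul, hv.e_hw, counit_ι_mul, smul_zero, zero_smul]
    rw [map_one, Module.End.one_apply, this, counit_of_mem_radical hz, zero_smul]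
  | add x y hx hy => rw [map_add, LinearMap.add_apply, map_add, hx hz, hy hz, add_zero]
  | smul c x hx => rw [map_smul, LinearMap.smul_apply, map_smul, hx hz, smul_zero]
  | ι_mul i y hy =>
    rw [opHom_ι_mul, h.opHom_e_f, hy (twist_mem_radical i hz),
      hy (derivR_mem_radical h.symm i hz),
      hy (twist_mem_radical i (derivL_mem_radical i hz))]
    simp

/-- The operator on the free algebra by which `e_i` acts on the vectors `y v`, where `v` is a highest
weight vector. -/
def lower (χ : I → I → Rˣ) (N : I → R) (κ : I → Rˣ) (i : I) :
    FreeAlgebra R I →ₗ[R] FreeAlgebra R I :=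
  N i • (derivL χ i - (κ i : R) • (twist χ i).toLinearMap ∘ₗ derivR χ i)

lemma lower_apply (i : I) (y : FreeAlgebra R I) : lower χ N κ i y =
    N i • (derivL χ i y - (κ i : R) • twist χ i (derivR χ i y)) := by
  simp [lower]

lemma lower_mem_homog (i : I) {β : Multiset I} {y : FreeAlgebra R I}
    (hy : y ∈ homog R (i ::ₘ β)) : lower χ N κ i y ∈ homog R β := by
  rw [lower_apply, twist_of_homog χ i (derivR_mem_homog χ i hy)]
  exact Submodule.smul_mem _ _ (sub_mem (derivL_mem_homog χ i hy)
    (Submodule.smul_mem _ _ (Submodule.smul_mem _ _ (derivR_mem_homog χ i hy))))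

lemma lower_of_notMem {i : I} {β : Multiset I} (hi : i ∉ β) {y : FreeAlgebra R I}
    (hy : y ∈ homog R β) : lower χ N κ i y = 0 := by
  rw [lower_apply, derivL_of_notMem χ hi hy, derivR_of_notMem χ hi hy]
  simp

lemma lower_mem_radical (hχ : ∀ i j, χ i j = χ j i) (i : I) {y : FreeAlgebra R I}
    (hy : y ∈ radical χ) : lower χ N κ i y ∈ radical χ := by
  rw [lower_apply]
  exact Submodule.smul_mem _ _ (sub_mem (derivL_mem_radical i hy)
    (Submodule.smul_mem _ _ (twist_mem_radical i (derivR_mem_radical hχ i hy))))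

lemma e_opHom_hw (h : IsQuantumModule χ N e f K) (hv : IsHighestWeight h v κ) (i : I)
    (y : FreeAlgebra R I) : e i (opHom f y v) = opHom f (lower χ N κ i y) v := by
  rw [h.e_opHom_f, hv.e_hw, hv.K_hw, lower_apply]
  simp

/-- A word in the `e_i` maps `y v`, with `y` of degree `β`, to zero or to some `y' v` of
complementary degree. -/
lemma opHom_e_word_hw (h : IsQuantumModule χ N e f K) (hv : IsHighestWeight h v κ) (b : List I)
    {β : Multiset I} {y : FreeAlgebra R I} (hy : y ∈ homog R β) :
    opHom e (word R b) (opHom f y v) = 0 ∨ ∃ γ, β = (b : Multiset I) + γ ∧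
      ∃ y' ∈ homog R γ, opHom e (word R b) (opHom f y v) = opHom f y' v := by
  induction b with
  | nil => exact Or.inr ⟨β, by simp, y, hy, by simp⟩
  | cons i b ih =>
    rw [word_cons, opHom_ι_mul]
    rcases ih with h0 | ⟨γ, rfl, y', hy', h1⟩
    · left; rw [h0, map_zero]
    · rw [h1, e_opHom_hw h hv]
      by_cases hi : i ∈ γ
      · obtain ⟨δ, rfl⟩ := Multiset.exists_cons_of_mem hi
        refine Or.inr ⟨δ, ?_, _, lower_mem_homog i hy', rfl⟩
        rw [← Multiset.cons_coe, Multiset.add_cons, Multiset.cons_add]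
      · left; rw [lower_of_notMem hi hy']; simp

lemma opHom_e_word_eq_zero (h : IsQuantumModule χ N e f K) (hv : IsHighestWeight h v κ) {b : List I}
    {β : Multiset I} (hb : ¬ (b : Multiset I) ≤ β) {y : FreeAlgebra R I} (hy : y ∈ homog R β) :
    opHom e (word R b) (opHom f y v) = 0 := by
  rcases opHom_e_word_hw h hv b hy with h0 | ⟨γ, rfl, -⟩
  · exact h0
  · exact absurd (Multiset.le_add_right _ _) hb

variable [IsSemisimpleRing R]

/-- The Casimir operator acts by a scalar on the vectors `y v` with `y` of degree `β`, modulo a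
submodule which contains enough of the image of the radical. -/
theorem casimir_hw (h : IsQuantumModule χ N e f K) (hv : IsHighestWeight h v κ)
    (W : Submodule R X) (hWf : ∀ i, ∀ u ∈ W, f i u ∈ W) (n : ℕ)
    (hJ : ∀ (i : I) (β γ : Multiset I), γ ≤ β → Multiset.card β < n →
      ∀ z ∈ homog R (i ::ₘ γ), z ∈ radical χ → ∀ d ∈ wordsOf γ, ∀ y ∈ homog R β,
        opHom f z (opHom e (word R d) (opHom f y v)) ∈ W)
    {β : Multiset I} (hβ : Multiset.card β ≤ n) {y : FreeAlgebra R I} (hy : y ∈ homog R β) :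
    casimir χ e f β (opHom f y v) - (casimirScalar χ κ β : R) • opHom f y v ∈ W := by
  induction hy using homog_induction with
  | hw w hw =>
    subst hw
    induction w with
    | nil =>
      rw [Multiset.coe_nil, casimirScalar_zero, Units.val_one, one_smul]
      refine casimir_sub_self_mem W 0 hWf fun w hw => ?_
      rw [opHom_e_word_eq_zero h hv _ (word_mem_homog (R := R) ([] : List I))]
      · exact zero_mem _
      · simpa using hw
    | cons i w ih =>
      rw [Multiset.coe_card, List.length_cons] at hβ
      have hw : word R w ∈ homog R (w : Multiset I) := word_mem_homog w
      have hK : K i (opHom f (word R w) v) =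
          ((κ i * chiM χ i (w : Multiset I) ^ 2 : Rˣ) : R) • opHom f (word R w) v := by
        rw [h.K_opHom_f i hw, hv.K_hw, map_smul, smul_smul, mul_comm (κ i), Units.val_mul]
      have h1 := h.casimir_f W i _ (fun b hb => opHom_e_word_eq_zero h hv hb hw) hK
        (fun z hz => opHom_e_of_mem_radical h hv hz _)
        (fun γ hγ z hz hzr d hd => hJ i w γ hγ (by rw [Multiset.coe_card]; omega) z hz hzr d hd _ hw)
      have h2 := ih (by rw [Multiset.coe_card]; omega)
      have h3 := W.smul_mem ((κ i * chiM χ i (w : Multiset I) ^ 2 : Rˣ) : R) (hWf i _ h2)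
      rw [word_cons, opHom_ι_mul, ← Multiset.cons_coe, casimirScalar_cons χ h.symm]
      convert add_mem h1 h3 using 1
      rw [map_sub, map_smul, smul_sub, smul_smul, Units.val_mul (κ i * _)]
      abel
  | zero => simp
  | add a b _ _ ha hb =>
    convert add_mem ha hb using 1
    simp only [map_add, LinearMap.add_apply, smul_add]
    abel
  | smul c a _ ha =>
    convert W.smul_mem c ha using 1
    simp only [map_smul, LinearMap.smul_apply, smul_sub, smul_comm c]

/-- If the radical acts by zero on a highest weight module, then a vector of degree `-β` killed by
all `e_i` vanishes as soon as its Casimir eigenvalue differs from `1`. -/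
theorem eq_zero_of_singular (h : IsQuantumModule χ N e f K) (hv : IsHighestWeight h v κ)
    (hrad : ∀ z ∈ radical χ, opHom f z = 0) {β : Multiset I}
    (hβ : IsUnit ((casimirScalar χ κ β : R) - 1)) {y : FreeAlgebra R I} (hy : y ∈ homog R β)
    (hsing : ∀ i, e i (opHom f y v) = 0) : opHom f y v = 0 := by
  have h1 := casimir_hw h hv ⊥ (by simp) (Multiset.card β)
    (fun i β γ _ _ z _ hz d _ y _ => by rw [hrad z hz]; simp) le_rfl hy
  have h2 := casimir_sub_self_mem (χ := χ) (f := f) (e := e) ⊥ β (x := opHom f y v) (by simp)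
    (fun w hw => by
      obtain ⟨u, i, rfl⟩ := (List.eq_nil_or_concat' w).resolve_left hw
      rw [word_append, word_cons, word_nil, mul_one, opHom_mul_ι, hsing, map_zero]
      exact zero_mem _)
  rw [Submodule.mem_bot, sub_eq_zero] at h1 h2
  rw [h2] at h1
  have h3 : ((casimirScalar χ κ β : R) - 1) • opHom f y v = 0 := by
    rw [sub_smul, one_smul, ← h1, sub_self]
  rwa [hβ.smul_eq_zero] at h3

end IsQuantumModule

/-! ### The Verma module of highest weight zero -/

section Verma

variable {χ : I → I → Rˣ} {N : I → R}

/-- The operator `e_i` on the Verma module of highest weight zero, realized on the free algebra. -/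
abbrev vermaE (χ : I → I → Rˣ) (N : I → R) (i : I) : Module.End R (FreeAlgebra R I) :=
  IsQuantumModule.lower χ N 1 i

/-- The operator `f_i` on the Verma module of highest weight zero. -/
def vermaF (R : Type*) [CommRing R] {I : Type*} (i : I) : Module.End R (FreeAlgebra R I) :=
  LinearMap.mulLeft R (FreeAlgebra.ι R i)

/-- The operator `K_i` on the Verma module of highest weight zero. -/
def vermaK (χ : I → I → Rˣ) (i : I) : Module.End R (FreeAlgebra R I) :=
  (twist χ i).toLinearMap ∘ₗ (twist χ i).toLinearMap

lemma opHom_vermaF (y u : FreeAlgebra R I) : opHom (vermaF R) y u = y * u := by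
  induction y using freeAlgebra_induction_left with
  | one => simp
  | add x y hx hy => simp [hx, hy, add_mul]
  | smul c x hx => simp [hx]
  | ι_mul j y hy => rw [opHom_ι_mul, hy, vermaF, LinearMap.mulLeft_apply, mul_assoc]

lemma isQuantumModule_verma (hχ : ∀ i j, χ i j = χ j i)
    (hN : ∀ i, N i * (1 - (((χ i i)⁻¹ : Rˣ) : R)) = 1) :
    IsQuantumModule χ N (vermaE χ N) (vermaF R) (vermaK χ) where
  symm := hχ
  hN := hN
  ef i j u := by
    simp only [IsQuantumModule.lower_apply, vermaF, vermaK, LinearMap.mulLeft_apply]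
    by_cases hij : i = j
    · subst hij
      simp [smul_sub, smul_add, mul_sub, smul_comm (N i)]
      abel
    · simp [hij, smul_sub, mul_sub, smul_comm (N i)]
  eK i j u := by
    simp only [IsQuantumModule.lower_apply, vermaK, LinearMap.coe_comp, Function.comp_apply,
      AlgHom.toLinearMap_apply, twist_derivL, twist_derivR, map_smul, map_sub, smul_sub, smul_smul,
      twist_comm χ j i]
    simp only [pow_two, Units.val_mul]
    congr 2 <;> ring
  Kf i j u := by
    simp [vermaF, vermaK, smul_smul, pow_two]

lemma isHighestWeight_verma (h : IsQuantumModule χ N (vermaE χ N) (vermaF R) (vermaK χ)) :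
    IsHighestWeight h 1 1 where
  e_hw i := by simp [IsQuantumModule.lower_apply]
  K_hw i := by simp [vermaK]
  gen u := ⟨u, by rw [opHom_vermaF, mul_one]⟩

lemma counit_vermaE (i : I) (y : FreeAlgebra R I) : counit R I (vermaE χ N i y) = 0 := by
  rw [IsQuantumModule.lower_apply, map_smul, map_sub, counit_derivL_eq, map_smul, counit_twist]
  simp

lemma eq_counit_of_homog_zero {y : FreeAlgebra R I} (hy : y ∈ homog R (0 : Multiset I)) :
    y = counit R I y • 1 := by
  induction hy using homog_induction with
  | hw w hw =>
    rw [Multiset.coe_eq_zero] at hw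
    subst hw
    simp
  | zero => simp
  | add a b _ _ ha hb => rw [map_add, add_smul, ← ha, ← hb]
  | smul c a _ ha => rw [map_smul, smul_assoc, ← ha]

lemma eq_zero_of_mem_radical_of_homog_singleton {i : I} {z : FreeAlgebra R I}
    (hz : z ∈ homog R (i ::ₘ 0)) (hzr : z ∈ radical χ) : z = 0 := by
  have h1 : z = form χ (FreeAlgebra.ι R i * 1) z • FreeAlgebra.ι R i := by
    rw [form_ι_mul, form_one]
    clear hzr
    induction hz using homog_induction with
    | hw w hw =>
      have h3 : (w : Multiset I) = (([i] : List I) : Multiset I) := hw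
      rw [Multiset.coe_eq_coe, List.perm_singleton] at h3
      subst h3
      simp only [word_cons, word_nil, derivL_ι_mul]
      simp
    | zero => simp
    | add a b _ _ ha hb =>
      rw [map_add, map_add, add_smul, ← ha, ← hb]
    | smul c a _ ha => rw [map_smul, map_smul, smul_assoc, ← ha]
  rw [h1, hzr, zero_smul]

/-- The heart of the comparison of the radical with the annihilator `W` of a module: a radical
element of minimal degree which is not in `W` is a singular vector of the Verma module of highest
weight zero modulo `W`, so that its Casimir eigenvalue is `1`. -/
theorem radical_mem_of_isUnit [IsSemisimpleRing R] (hχ : ∀ i j, χ i j = χ j i)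
    (hN : ∀ i, N i * (1 - (((χ i i)⁻¹ : Rˣ) : R)) = 1) (W : Submodule R (FreeAlgebra R I))
    (hWl : ∀ y, ∀ z ∈ W, y * z ∈ W) (hWr : ∀ y, ∀ z ∈ W, z * y ∈ W) {β : Multiset I}
    (hβ : IsUnit ((casimirScalar χ 1 β : R) - 1))
    (hmin : ∀ γ : Multiset I, Multiset.card γ < Multiset.card β →
      ∀ z ∈ homog R γ, z ∈ radical χ → z ∈ W)
    {z : FreeAlgebra R I} (hz : z ∈ homog R β) (hzr : z ∈ radical χ) : z ∈ W := by
  have h := isQuantumModule_verma hχ hN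
  have hv := isHighestWeight_verma h
  have hz1 : opHom (vermaF R) z 1 = z := by rw [opHom_vermaF, mul_one]
  have hWf : ∀ i, ∀ u ∈ W, vermaF R i u ∈ W := fun i u hu => hWl _ u hu
  have h1 := IsQuantumModule.casimir_hw h hv W hWf (Multiset.card β) (by
    intro i β' γ hγ hβ' z' hz' hz'r d hd y hy
    rw [opHom_vermaF]
    by_cases hc : Multiset.card (i ::ₘ γ) < Multiset.card β
    · exact hWr _ _ (hmin _ hc z' hz' hz'r)
    rw [Multiset.card_cons] at hc
    have hle := Multiset.card_le_card hγ
    have hγβ : γ = β' := Multiset.eq_of_le_of_card_le hγ (by omega)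
    subst hγβ
    -- in the extreme degree the vector obtained has degree zero and no constant term
    cases d with
    | nil =>
      have hγ0 : γ = 0 := (mem_wordsOf.1 hd).symm
      subst hγ0
      rw [eq_zero_of_mem_radical_of_homog_singleton hz' hz'r, zero_mul]
      exact zero_mem _
    | cons j d =>
      have h3 : opHom (vermaE χ N) (word R (j :: d)) (opHom (vermaF R) y 1) = 0 := by
        rcases IsQuantumModule.opHom_e_word_hw h hv (j :: d) hy with h0 | ⟨δ, hδ, y', hy', h4⟩
        · exact h0
        · rw [mem_wordsOf.1 hd] at hδ
          have hδ0 : δ = 0 := by simpa using hδ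
          subst hδ0
          rw [opHom_vermaF y' 1, mul_one] at h4
          rw [h4, eq_counit_of_homog_zero hy', ← h4, word_cons, opHom_ι_mul, counit_vermaE,
            zero_smul]
      rw [h3, mul_zero]
      exact zero_mem _) le_rfl hz
  have h2 := IsQuantumModule.casimir_sub_self_mem (χ := χ) (f := vermaF R) (e := vermaE χ N) W β
    (x := z) hWf (fun w hw => by
      obtain ⟨u, i, rfl⟩ := (List.eq_nil_or_concat' w).resolve_left hw
      rw [word_append, word_cons, word_nil, mul_one, opHom_mul_ι]
      by_cases hi : i ∈ β
      · obtain ⟨γ, rfl⟩ := Multiset.exists_cons_of_mem hi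
        have h5 := IsQuantumModule.lower_mem_homog (χ := χ) (N := N) (κ := 1) i hz
        have h6 : opHom (vermaE χ N) (word R u) (vermaE χ N i z) ∈ radical χ := by
          induction u with
          | nil => simpa using IsQuantumModule.lower_mem_radical hχ i hzr
          | cons j u ih =>
            rw [word_cons, opHom_ι_mul]
            exact IsQuantumModule.lower_mem_radical hχ j (ih (by simp))
        have h7 := IsQuantumModule.opHom_e_word_hw h hv u h5
        rw [opHom_vermaF, mul_one] at h7
        rcases h7 with h0 | ⟨δ, hδ, y', hy', h4⟩
        · rw [h0]; exact zero_mem _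
        · rw [opHom_vermaF, mul_one] at h4
          rw [h4] at h6 ⊢
          refine hmin δ ?_ y' hy' h6
          rw [hδ, Multiset.card_cons, Multiset.card_add]
          omega
      · rw [IsQuantumModule.lower_of_notMem hi hz, map_zero]
        exact zero_mem _)
  rw [hz1] at h1
  have h3 : ((casimirScalar χ 1 β : R) - 1) • z ∈ W := by
    convert sub_mem h2 h1 using 1
    rw [sub_smul, one_smul]; abel
  obtain ⟨c, hc⟩ := hβ.exists_left_inv
  have := W.smul_mem c h3
  rwa [smul_smul, hc, one_smul] at this

end Verma

end HighestWeight

/-! ### The ground ring and the bicharacter of a Cartan superdatum -/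

/-- The two specializations `π = ±1` embed `ℚ(q)^π` into a product of two fields. -/
instance : IsReduced QPi where
  eq_zero x hx := by
    have h : ∀ s : ℤˣ, CartanSuperdatum.ev s x = 0 := fun s => (hx.map (CartanSuperdatum.ev s)).eq_zero
    have h1 := h 1
    have h2 := h (-1)
    simp only [CartanSuperdatum.ev, RingHom.coe_mk, MonoidHom.coe_mk, OneHom.coe_mk] at h1 h2
    simp only [Units.val_one, Int.cast_one, one_mul, Units.val_neg, Int.cast_neg, neg_mul] at h1 h2
    have hre : x.re = 0 := by
      have : (2 : RatFunc ℚ) * x.re = 0 := by linear_combination h1 + h2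
      exact (mul_eq_zero.1 this).resolve_left two_ne_zero
    have him : x.im = 0 := by rwa [hre, zero_add] at h1
    exact QuadraticAlgebra.ext hre him

instance : IsArtinianRing QPi :=
  IsArtinianRing.of_finite (RatFunc ℚ) QPi

instance : IsSemisimpleRing QPi := IsArtinianRing.isSemisimpleRing_of_isReduced QPi

/-- `u` is `q ^ m` up to a power of `π`. -/
def IsMonomial (u : QPiˣ) (m : ℤ) : Prop := ∃ k : ℤ, u = ϖ ^ k * q ^ m

lemma IsMonomial.one : IsMonomial 1 0 := ⟨0, by simp⟩

lemma IsMonomial.mul {u w : QPiˣ} {m n : ℤ} (hu : IsMonomial u m) (hw : IsMonomial w n) :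
    IsMonomial (u * w) (m + n) := by
  obtain ⟨k, rfl⟩ := hu
  obtain ⟨l, rfl⟩ := hw
  exact ⟨k + l, by rw [zpow_add, zpow_add, mul_mul_mul_comm]⟩

lemma IsMonomial.zpow {u : QPiˣ} {m : ℤ} (hu : IsMonomial u m) (n : ℤ) :
    IsMonomial (u ^ n) (m * n) := by
  obtain ⟨k, rfl⟩ := hu
  exact ⟨k * n, by rw [mul_zpow, zpow_mul, zpow_mul]⟩

/-- Neither specialization of `u` at `π = ±1` is equal to `1`, since their squares are `q ^ (2 m)`. -/
lemma isUnit_sub_one_of_isMonomial {u : QPiˣ} {m : ℤ} (hu : IsMonomial u m) (hm : m ≠ 0) :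
    IsUnit ((u : QPi) - 1) := by
  obtain ⟨k, rfl⟩ := hu
  refine CartanSuperdatum.isUnit_of_ev fun s h => ?_
  have hq : Units.map (CartanSuperdatum.ev s).toMonoidHom q =
      Units.mk0 RatFunc.X RatFunc.X_ne_zero := by
    ext
    simp [CartanSuperdatum.ev, q, ← QuadraticAlgebra.C_eq_algebraMap]
  have hp : (Units.map (CartanSuperdatum.ev s).toMonoidHom ϖ) ^ 2 = 1 := by
    rw [← map_pow]
    have : ϖ ^ 2 = 1 := by
      ext1
      simp [ϖ, pow_two, QuadraticAlgebra.omega_mul_omega_eq_algebraMap]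
    rw [this, map_one]
  have h1 : Units.map (CartanSuperdatum.ev s).toMonoidHom (ϖ ^ k * q ^ m) = 1 := by
    ext1
    rw [map_sub, map_one, sub_eq_zero] at h
    exact h
  rw [map_mul, map_zpow, map_zpow, hq] at h1
  have h2 := congrArg (· ^ 2) h1
  simp only [mul_pow, one_pow] at h2
  rw [← zpow_natCast, ← zpow_mul, mul_comm k, zpow_mul, zpow_natCast, hp, one_zpow, one_mul,
    ← zpow_natCast, ← zpow_mul] at h2
  have h3 : (Units.mk0 (RatFunc.X : RatFunc ℚ) RatFunc.X_ne_zero) ^ (m * (2 : ℕ)).natAbs = 1 := by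
    rcases Int.natAbs_eq (m * (2 : ℕ)) with h4 | h4
    · rw [← zpow_natCast, ← h4, h2]
    · rw [h4, zpow_neg, inv_eq_one, zpow_natCast] at h2
      exact h2
  have h5 : (Polynomial.X : Polynomial ℚ) ^ (m * (2 : ℕ)).natAbs = 1 := by
    apply RatFunc.algebraMap_injective ℚ
    have := congrArg Units.val h3
    simpa [RatFunc.algebraMap_X] using this
  have h6 := congrArg Polynomial.natDegree h5
  simp at h6
  omega

section Bicharacter

variable {I : Type u} {P : Type v} [AddCommGroup P]

namespace CartanSuperdatum

variable (D : CartanSuperdatum I P)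

/-- The bicharacter `χ_ij = π^{p(i)p(j)} q_i^{-a_ij}`, in terms of which all the structure
constants of `U(𝔤)` are expressed: the signs of the super setting are absorbed in it. -/
def chi (i j : I) : QPiˣ := ϖ ^ (D.parity i * D.parity j) * D.qi i ^ (-D.a i j)

lemma varpi_sq : ϖ ^ 2 = 1 := by
  ext1
  simp [ϖ, pow_two, QuadraticAlgebra.omega_mul_omega_eq_algebraMap]

lemma qi_zpow (i : I) (n : ℤ) : D.qi i ^ n = q ^ ((D.d i : ℤ) * n) := by
  rw [qi, zpow_mul, zpow_natCast]

lemma chi_symm (i j : I) : D.chi i j = D.chi j i := by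
  rw [chi, chi, qi_zpow, qi_zpow, mul_comm (D.parity i)]
  congr 2
  have := D.symm i j
  linarith

lemma parity_mul_self (i : I) : D.parity i * D.parity i = D.parity i := by
  unfold parity; split_ifs <;> rfl

lemma chi_self_inv (i : I) : (D.chi i i)⁻¹ = D.pt i := by
  rw [inv_eq_iff_mul_eq_one, chi, pt, pii, D.a_diag, parity_mul_self, zpow_neg]
  have : (ϖ ^ D.parity i) * ϖ ^ D.parity i = 1 := by
    rw [← pow_two, ← pow_mul, mul_comm, pow_mul, varpi_sq, one_pow]
  calc _ = (ϖ ^ D.parity i * ϖ ^ D.parity i) * ((D.qi i ^ (2 : ℤ))⁻¹ * D.qi i ^ 2) := by ac_rfl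
    _ = 1 := by rw [this, one_mul]; exact inv_mul_cancel _

/-- `p̃_i ^ a_ij = q_i ^ (2 a_ij)`, because `a_ij` is even for odd `i`. -/
lemma pt_zpow_a (i j : I) : D.pt i ^ D.a i j = D.qi i ^ (2 * D.a i j) := by
  have : D.pii i ^ D.a i j = 1 := by
    unfold pii parity
    split_ifs with h
    · obtain ⟨k, hk⟩ := D.even_of_odd i h j
      rw [pow_one, hk, ← two_mul, zpow_mul]
      have : ϖ ^ (2 : ℤ) = 1 := varpi_sq
      rw [this, one_zpow]
    · simp
  rw [pt, mul_zpow, this, mul_one, zpow_mul]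
  rfl

lemma chi_sq (i j : I) : D.chi i j ^ 2 = D.qi i ^ (-(2 * D.a i j)) := by
  rw [chi, mul_pow, ← pow_mul, mul_comm _ 2, pow_mul, varpi_sq, one_pow, one_mul, ← zpow_natCast,
    ← zpow_mul]
  congr 1
  push_cast
  ring

lemma chi_sq' (i j : I) : D.chi i j ^ 2 = D.pt i ^ (-D.a i j) := by
  rw [chi_sq, zpow_neg, zpow_neg, pt_zpow_a]

lemma isMonomial_chi (i j : I) : IsMonomial (D.chi i j) (-(D.d i * D.a i j)) :=
  ⟨(D.parity i * D.parity j : ℕ), by rw [chi, qi_zpow, zpow_natCast, mul_neg]⟩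

lemma isMonomial_pt (i : I) : IsMonomial (D.pt i) (2 * D.d i) :=
  ⟨D.parity i, by
    rw [pt, pii, zpow_natCast, mul_comm, ← zpow_natCast (D.qi i), qi_zpow]
    congr 2
    push_cast
    ring⟩

/-- `1 / (1 - p̃_i)`. -/
def N (i : I) : QPi := Ring.inverse (1 - (D.pt i : QPi))

lemma N_mul (i : I) : D.N i * (1 - (D.pt i : QPi)) = 1 :=
  Ring.inverse_mul_cancel _ (D.isUnit_one_sub_pt i)

lemma isUnit_bra (i : I) (n : ℤ) (hn : n ≠ 0) : IsUnit (bra (D.pt i) (D.N i) n) := by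
  have h1 : IsUnit (D.N i) := .of_mul_eq_one _ (D.N_mul i)
  refine h1.mul ?_
  have h2 := isUnit_sub_one_of_isMonomial ((D.isMonomial_pt i).zpow n)
    (mul_ne_zero (mul_ne_zero two_ne_zero (by exact_mod_cast (D.d_pos i).ne')) hn)
  rw [← neg_sub]
  exact h2.neg

lemma isUnit_bra_swap (i : I) (n : ℤ) (hn : n ≠ 0) :
    IsUnit (bra (D.pt i)⁻¹ (-(D.pt i * D.N i)) n) := by
  have : bra (D.pt i)⁻¹ (-((D.pt i : QPi) * D.N i)) n = -((D.pt i : QPi) * bra (D.pt i) (D.N i) (-n)) := by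
    simp only [bra, inv_zpow, zpow_neg]; ring
  rw [this]
  exact ((Units.isUnit _).mul (D.isUnit_bra i (-n) (neg_ne_zero.2 hn))).neg

/-- The pairing of the coroot `h_i` with the element `∑ α_j` of the positive cone. -/
def aM (i : I) (β : Multiset I) : ℤ := (β.map (D.a i)).sum

@[simp] lemma aM_cons (i j : I) (β : Multiset I) : D.aM i (j ::ₘ β) = D.a i j + D.aM i β := by
  simp [aM]

@[simp] lemma aM_zero (i : I) : D.aM i 0 = 0 := by simp [aM]

lemma isMonomial_chiM (i : I) (β : Multiset I) :
    IsMonomial (chiM D.chi i β) (-(D.d i * D.aM i β)) := by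
  induction β using Multiset.induction with
  | empty => simpa using IsMonomial.one
  | cons j β ih =>
    rw [chiM_cons, aM_cons]
    convert (D.isMonomial_chi i j).mul ih using 1
    ring

lemma chiM_sq (i : I) (β : Multiset I) : chiM D.chi i β ^ 2 = D.pt i ^ (-D.aM i β) := by
  induction β using Multiset.induction with
  | empty => simp
  | cons j β ih => rw [chiM_cons, aM_cons, mul_pow, ih, chi_sq', neg_add, zpow_add]

/-- The exponent of `q` in the Casimir eigenvalue is positive if the highest weight and the
weight under consideration are both dominant; it is half of
`(λ, β) + (λ - β, β) + 2 (ρ, β)`. -/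
lemma isUnit_casimirScalar_sub_one (lam : I → ℤ) {β : Multiset I} (hβ : β ≠ 0)
    (h1 : ∀ i, 0 ≤ lam i) (h2 : ∀ i, 0 ≤ lam i - D.aM i β) :
    IsUnit ((casimirScalar D.chi (fun i => D.pt i ^ lam i) β : QPi) - 1) := by
  obtain ⟨m, hm, hE⟩ : ∃ m, IsMonomial (casimirScalar D.chi (fun i => D.pt i ^ lam i) β) m ∧
      m = (β.map fun i => D.d i * (lam i + (lam i - D.aM i β) + 2)).sum := by
    clear hβ h2
    induction β using Multiset.induction with
    | empty => exact ⟨0, by simpa using IsMonomial.one, by simp⟩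
    | cons i β ih =>
      obtain ⟨m, hm, hE⟩ := ih
      rw [casimirScalar_cons D.chi D.chi_symm]
      refine ⟨_, (((D.isMonomial_pt i).zpow (lam i)).mul
        ((D.isMonomial_chiM i β).zpow 2)).mul hm, ?_⟩
      have h3 : (β.map fun j => (D.d j : ℤ) * (lam j + (lam j - D.aM j (i ::ₘ β)) + 2)).sum =
          m - D.d i * D.aM i β := by
        have h4 : (β.map fun j => (D.d j : ℤ) * D.a j i).sum = D.d i * D.aM i β := by
          rw [aM, ← Multiset.sum_map_mul_left]
          congr 1
          exact Multiset.map_congr rfl fun j _ => D.symm j i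
        rw [hE, ← h4, eq_sub_iff_add_eq, ← Multiset.sum_map_add]
        congr 1
        refine Multiset.map_congr rfl fun j _ => ?_
        rw [aM_cons]
        ring
      rw [Multiset.map_cons, Multiset.sum_cons, h3, aM_cons, D.a_diag]
      ring
  refine isUnit_sub_one_of_isMonomial hm ?_
  rw [hE]
  obtain ⟨i, hi⟩ := Multiset.exists_mem_of_ne_zero hβ
  obtain ⟨γ, rfl⟩ := Multiset.exists_cons_of_mem hi
  have hpos : ∀ j, 0 < (D.d j : ℤ) * (lam j + (lam j - D.aM j (i ::ₘ γ)) + 2) := fun j =>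
    mul_pos (by exact_mod_cast D.d_pos j) (by linarith [h1 j, h2 j])
  rw [Multiset.map_cons, Multiset.sum_cons]
  refine (add_pos_of_pos_of_nonneg (hpos i) (Multiset.sum_nonneg fun x hx => ?_)).ne'
  obtain ⟨j, _, rfl⟩ := Multiset.mem_map.1 hx
  exact (hpos j).le

end CartanSuperdatum

end Bicharacter

/-! ### Integrable highest weight modules -/

section Integrable

open CartanSuperdatum

variable {I : Type u} {P : Type v} [AddCommGroup P] {D : CartanSuperdatum I P}
  {X : Type w} [AddCommGroup X] [Module QPi X] {e f K : I → Module.End QPi X}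

/-- The eigenspace of `K_i` for the eigenvalue `p̃_i ^ n`. -/
def eigW (D : CartanSuperdatum I P) (K : I → Module.End QPi X) (i : I) (n : ℤ) :
    Submodule QPi X where
  carrier := {u | K i u = ((D.pt i ^ n : QPiˣ) : QPi) • u}
  add_mem' ha hb := by
    simp only [Set.mem_ofPred_eq] at *
    rw [map_add, ha, hb, smul_add]
  zero_mem' := by simp
  smul_mem' c x hx := by
    simp only [Set.mem_ofPred_eq] at *
    rw [map_smul, hx, smul_comm]

lemma mem_eigW {i : I} {n : ℤ} {u : X} :
    u ∈ eigW D K i n ↔ K i u = ((D.pt i ^ n : QPiˣ) : QPi) • u := Iff.rfl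

/-- Restriction to the quantum `sl₂` generated by `e_i` and `f_i`. -/
lemma isRankOne_of_isQuantumModule (h : IsQuantumModule D.chi D.N e f K) (i : I) :
    IsRankOne (D.pt i) (D.N i) (e i) (f i) (eigW D K i) where
  e_mem n u hu := by
    rw [mem_eigW] at hu ⊢
    have h1 := h.eK i i u
    rw [hu, map_smul, chi_sq', D.a_diag] at h1
    have h2 := congrArg (fun x => ((D.pt i ^ (2 : ℤ) : QPiˣ) : QPi) • x) h1
    simp only [smul_smul, ← Units.val_mul, ← zpow_add] at h2
    rw [add_neg_cancel, zpow_zero, Units.val_one, one_smul] at h2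
    rw [← h2, add_comm]
  f_mem n u hu := by
    rw [mem_eigW] at hu ⊢
    rw [h.Kf, hu, map_smul, smul_smul, chi_sq', D.a_diag, ← Units.val_mul, ← zpow_add, neg_add_eq_sub]
  comm n u hu := by
    rw [mem_eigW] at hu
    rw [h.ef, if_pos rfl, hu, ← D.chi_self_inv, inv_inv, bra, mul_smul, sub_smul, one_smul]
  hN := D.N_mul i

variable {v : X} {lam : I → ℤ}

lemma opHom_f_mem_eigW (h : IsQuantumModule D.chi D.N e f K)
    (hv : IsHighestWeight h v fun i => D.pt i ^ lam i) (i : I) {β : Multiset I}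
    {y : FreeAlgebra QPi I} (hy : y ∈ homog QPi β) :
    opHom f y v ∈ eigW D K i (lam i - D.aM i β) := by
  rw [mem_eigW, h.K_opHom_f i hy, hv.K_hw, map_smul, smul_smul, chiM_sq, ← Units.val_mul,
    ← zpow_add, neg_add_eq_sub]

/-- A word in the `e_i` longer than the degree of a vector kills it. -/
lemma e_locally_nilpotent (h : IsQuantumModule D.chi D.N e f K)
    (hv : IsHighestWeight h v fun i => D.pt i ^ lam i) (i : I) (u : X) : ∃ k, (e i ^ k) u = 0 := by
  obtain ⟨y, rfl⟩ := hv.gen u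
  obtain ⟨s, z, hz, rfl⟩ := exists_eq_sum_homog y
  refine ⟨∑ β ∈ s, (Multiset.card β + 1), ?_⟩
  rw [map_sum, LinearMap.sum_apply, map_sum]
  refine Finset.sum_eq_zero fun β hβ => ?_
  have h1 : ∀ k, e i ^ k = opHom e (word QPi (List.replicate k i)) := by
    intro k
    simp [opHom, word, map_pow]
  rw [h1]
  refine IsQuantumModule.opHom_e_word_eq_zero h hv (fun hle => ?_) (hz β)
  have h2 := Multiset.card_le_card hle
  rw [Multiset.coe_card, List.length_replicate] at h2
  have h3 := Finset.single_le_sum (f := fun β : Multiset I => Multiset.card β + 1)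
    (fun _ _ => Nat.zero_le _) hβ
  omega

/-- The radical of the form acts by zero on every integrable highest weight module: this is the
quantum analogue of the theorem of Gabber and Kac. For an element of minimal degree `β` which does
not act by zero, integrability forces `⟨h_i, β⟩ ≤ 0` for all `i`, while the Casimir operator on the
Verma module of highest weight zero excludes this. -/
theorem opHom_f_of_mem_radical (h : IsQuantumModule D.chi D.N e f K)
    (hv : IsHighestWeight h v fun i => D.pt i ^ lam i)
    (hf : ∀ i (u : X), ∃ k, (f i ^ k) u = 0) {z : FreeAlgebra QPi I} (hz : z ∈ radical D.chi) :
    opHom f z = 0 := by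
  have main : ∀ n, ∀ β : Multiset I, Multiset.card β = n → ∀ z ∈ homog QPi β,
      z ∈ radical D.chi → opHom f z = 0 := by
    intro n
    induction n using Nat.strong_induction_on with
    | _ n ih =>
      intro β hβ z hz hzr
      by_cases hb : ∃ i, 0 < D.aM i β
      -- the derivatives of `z` act by zero, so that `z` commutes with `e_i` up to a unit, while it
      -- lowers the weights for `h_i`
      · obtain ⟨i, hi⟩ := hb
        have h1 := isRankOne_of_isQuantumModule h i
        have hβ0 : ∀ (L : FreeAlgebra QPi I →ₗ[QPi] FreeAlgebra QPi I),
            (∀ γ, ∀ y ∈ homog QPi (i ::ₘ γ), L y ∈ homog QPi γ) →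
            (∀ γ : Multiset I, i ∉ γ → ∀ y ∈ homog QPi γ, L y = 0) →
            (∀ y ∈ radical D.chi, L y ∈ radical D.chi) → opHom f (L z) = 0 := by
          intro L hL hL0 hLr
          by_cases hiβ : i ∈ β
          · obtain ⟨γ, rfl⟩ := Multiset.exists_cons_of_mem hiβ
            refine ih (Multiset.card γ) ?_ γ rfl _ (hL γ z hz) (hLr z hzr)
            rw [← hβ, Multiset.card_cons]
            omega
          · rw [hL0 β hiβ z hz, map_zero]
        have hD := hβ0 (derivL D.chi i) (fun γ y hy => derivL_mem_homog _ i hy)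
          (fun γ hγ y hy => derivL_of_notMem _ hγ hy) (fun y hy => derivL_mem_radical i hy)
        have hr := hβ0 ((twist D.chi i).toLinearMap ∘ₗ derivR D.chi i)
          (fun γ y hy => by
            rw [LinearMap.comp_apply, AlgHom.toLinearMap_apply,
              twist_of_homog _ i (derivR_mem_homog _ i hy)]
            exact Submodule.smul_mem _ _ (derivR_mem_homog _ i hy))
          (fun γ hγ y hy => by rw [LinearMap.comp_apply, derivR_of_notMem _ hγ hy, map_zero])
          (fun y hy => twist_mem_radical i (derivR_mem_radical D.chi_symm i hy))
        rw [LinearMap.comp_apply, AlgHom.toLinearMap_apply] at hr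
        ext u
        obtain ⟨y, rfl⟩ := hv.gen u
        obtain ⟨s, y', hy', rfl⟩ := exists_eq_sum_homog y
        rw [map_sum, LinearMap.sum_apply, map_sum, LinearMap.zero_apply]
        refine Finset.sum_eq_zero fun γ _ => ?_
        refine h1.eq_zero_of_intertwiner (D.isUnit_bra i) (D.isUnit_bra_swap i)
          (e_locally_nilpotent h hv i) (hf i) (opHom f z) (chiM D.chi i β) (D.aM i β) hi ?_ ?_
          (opHom_f_mem_eigW h hv i (hy' γ))
        · intro n u hu
          rw [mem_eigW] at hu ⊢
          rw [h.K_opHom_f i hz, hu, map_smul, smul_smul, chiM_sq, ← Units.val_mul, ← zpow_add, neg_add_eq_sub]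
        · intro u
          rw [h.e_opHom_f, hD, hr, twist_of_homog _ i hz]
          simp
      · push Not at hb
        by_cases hβ0 : β = 0
        · subst hβ0
          rw [eq_counit_of_homog_zero hz, counit_of_mem_radical hzr, zero_smul, map_zero]
        have h0 := D.isUnit_casimirScalar_sub_one (fun _ => 0) hβ0 (fun _ => le_rfl)
          (fun i => by linarith [hb i])
        simp only [zpow_zero] at h0
        exact radical_mem_of_isUnit D.chi_symm h.hN (LinearMap.ker (opHom f).toLinearMap)
          (fun y z hz => by
            rw [LinearMap.mem_ker, AlgHom.toLinearMap_apply] at hz ⊢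
            rw [map_mul, hz, mul_zero])
          (fun y z hz => by
            rw [LinearMap.mem_ker, AlgHom.toLinearMap_apply] at hz ⊢
            rw [map_mul, hz, zero_mul])
          h0 (fun γ hγ z hz hzr => ih _ (hβ ▸ hγ) γ rfl z hz hzr) hz hzr
  obtain ⟨s, y, hy, rfl⟩ := exists_eq_sum_homog z
  rw [map_sum]
  refine Finset.sum_eq_zero fun β hβ => main _ β rfl _ (hy β) ?_
  -- the homogeneous components of an element of the radical lie in the radical
  refine mem_radical_of_homog (hy β) fun w hw => ?_
  have h1 := hz (word QPi w)
  rw [map_sum, Finset.sum_eq_single_of_mem β hβ] at h1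
  · exact h1
  · intro γ _ hγ
    refine form_of_ne ?_ (hw ▸ word_mem_homog w) (hy γ)
    exact hγ.symm

/-- In an integrable highest weight module there are no vectors killed by all `e_i` except for the
highest weight vectors: such a vector has a dominant weight by the representation theory of the
quantum `sl₂`, and then its Casimir eigenvalue differs from `1`. -/
theorem eq_zero_of_singular_of_integrable (h : IsQuantumModule D.chi D.N e f K)
    (hv : IsHighestWeight h v fun i => D.pt i ^ lam i) (hlam : ∀ i, 0 ≤ lam i)
    (hf : ∀ i (u : X), ∃ k, (f i ^ k) u = 0) {β : Multiset I} (hβ : β ≠ 0)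
    {y : FreeAlgebra QPi I} (hy : y ∈ homog QPi β) (hsing : ∀ i, e i (opHom f y v) = 0) :
    opHom f y v = 0 := by
  by_cases hdom : ∀ i, 0 ≤ lam i - D.aM i β
  · exact h.eq_zero_of_singular hv (fun z hz => opHom_f_of_mem_radical h hv hf hz)
      (D.isUnit_casimirScalar_sub_one lam hβ hlam hdom) hy hsing
  · push Not at hdom
    obtain ⟨i, hi⟩ := hdom
    obtain ⟨k, hk⟩ := hf i (opHom f y v)
    refine (isRankOne_of_isQuantumModule h i).eq_zero_of_e_pow (D.isUnit_bra i) k 1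
      (m := -(lam i - D.aM i β)) (by push_cast; omega) ?_ (by simpa using hsing i) hk
    rw [neg_neg]
    exact opHom_f_mem_eigW h hv i hy

end Integrable

open CartanSuperdatum

/-! ### Modules over `U(𝔤)` -/

section UModules

variable {I : Type u} {P : Type v} [AddCommGroup P] (D : CartanSuperdatum I P)

namespace CartanSuperdatum

/-- The quotient map from the free algebra on the generators to `U(𝔤)`. -/
def toU : FreeAlgebra QPi (Gen I) →ₐ[QPi] D.U := RingQuot.mkAlgHom QPi D.Rel

lemma K_mul_Kinv (i : I) : D.K i * D.Kinv i = 1 := by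
  have := RingQuot.mkAlgHom_rel QPi (Rel.K_Kinv (D := D) i)
  rwa [map_mul, map_one] at this

lemma Kinv_mul_K (i : I) : D.Kinv i * D.K i = 1 := by
  have := RingQuot.mkAlgHom_rel QPi (Rel.Kinv_K (D := D) i)
  rwa [map_mul, map_one] at this

lemma K_mul_e (i j : I) :
    D.K i * D.e j = ((D.qi i ^ (2 * D.a i j) : QPiˣ) : QPi) • (D.e j * D.K i) := by
  have := RingQuot.mkAlgHom_rel QPi (Rel.K_e (D := D) i j)
  rw [map_mul, map_mul, map_smul] at this
  have h2 : D.K i * D.e j * D.Kinv i = ((D.qi i ^ (2 * D.a i j) : QPiˣ) : QPi) • D.e j := this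
  rw [← smul_mul_assoc, ← h2, mul_assoc _ (D.Kinv i), Kinv_mul_K, mul_one]

lemma K_mul_f (i j : I) :
    D.K i * D.f j = ((D.qi i ^ (-(2 * D.a i j)) : QPiˣ) : QPi) • (D.f j * D.K i) := by
  have := RingQuot.mkAlgHom_rel QPi (Rel.K_f (D := D) i j)
  rw [map_mul, map_mul, map_smul] at this
  have h2 : D.K i * D.f j * D.Kinv i = ((D.qi i ^ (-(2 * D.a i j)) : QPiˣ) : QPi) • D.f j := this
  rw [← smul_mul_assoc, ← h2, mul_assoc _ (D.Kinv i), Kinv_mul_K, mul_one]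

lemma e_mul_K (i j : I) : D.e j * D.K i = ((D.chi i j ^ 2 : QPiˣ) : QPi) • (D.K i * D.e j) := by
  rw [K_mul_e, smul_smul, chi_sq, ← Units.val_mul, ← zpow_add, neg_add_cancel, zpow_zero,
    Units.val_one, one_smul]

lemma e_mul_f_same (i : I) :
    D.e i * D.f i = (D.chi i i : QPi) • (D.f i * D.e i) + D.N i • (1 - D.K i) := by
  have := RingQuot.mkAlgHom_rel QPi (Rel.e_f_same (D := D) i)
  rw [map_sub, map_smul, map_mul, map_mul, map_smul, map_sub, map_one, sub_eq_iff_eq_add,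
    add_comm] at this
  exact this

lemma e_mul_f_ne {i j : I} (hij : i ≠ j) :
    D.e i * D.f j = (D.chi i j : QPi) • (D.f j * D.e i) := by
  have := RingQuot.mkAlgHom_rel QPi (Rel.e_f_ne (D := D) i j hij)
  rw [map_sub, map_smul, map_mul, map_mul, map_zero, sub_eq_zero] at this
  exact this

lemma map_divPow {A B : Type*} [Ring A] [Algebra QPi A] [Ring B] [Algebra QPi B]
    (φ : A →ₐ[QPi] B) (i : I) (x : A) (n : ℕ) : φ (D.divPow i x n) = D.divPow i (φ x) n := by
  simp [divPow]

lemma map_serre {A B : Type*} [Ring A] [Algebra QPi A] [Ring B] [Algebra QPi B]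
    (φ : A →ₐ[QPi] B) (i j : I) (x y : A) : φ (D.serre i j x y) = D.serre i j (φ x) (φ y) := by
  simp only [serre, map_sum, map_smul, map_mul, map_divPow]

lemma serre_f_eq_zero {i j : I} (hij : i ≠ j) : D.serre i j (D.f i) (D.f j) = 0 := by
  have h1 : D.toU (D.serre i j (FreeAlgebra.ι QPi (.f i)) (FreeAlgebra.ι QPi (.f j))) = D.toU 0 :=
    RingQuot.mkAlgHom_rel QPi (Rel.serre_f i j hij)
  rwa [map_serre, map_zero] at h1

lemma serre_e_eq_zero {i j : I} (hij : i ≠ j) : D.serre i j (D.e i) (D.e j) = 0 := by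
  have h1 : D.toU (D.serre i j (FreeAlgebra.ι QPi (.e i)) (FreeAlgebra.ι QPi (.e j))) = D.toU 0 :=
    RingQuot.mkAlgHom_rel QPi (Rel.serre_e i j hij)
  rwa [map_serre, map_zero] at h1

/-- Induction on `U(𝔤)`: a property stable under linear combinations and under left multiplication
with the generators. -/
lemma U_induction {p : D.U → Prop} (one : p 1) (add : ∀ x y, p x → p y → p (x + y))
    (smul : ∀ (c : QPi) x, p x → p (c • x)) (gen_mul : ∀ g x, p x → p (D.gen g * x)) (x : D.U) :
    p x := by
  obtain ⟨y, rfl⟩ := RingQuot.mkAlgHom_surjective QPi D.Rel x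
  induction y using freeAlgebra_induction_left with
  | one => rw [map_one]; exact one
  | add x y hx hy => rw [map_add]; exact add _ _ hx hy
  | smul c x hx => rw [map_smul]; exact smul c _ hx
  | ι_mul g x hx => rw [map_mul]; exact gen_mul g _ hx

/-! ### The antiautomorphism exchanging `e_i` and `f_i` -/

/-- The antiautomorphism of `U(𝔤)` exchanges the letters `e_i` and `f_i`. -/
def transposeGen : Gen I → Gen I
  | .e i => .f i
  | .f i => .e i
  | .K i => .K i
  | .Kinv i => .Kinv i

lemma mul_self_eq_one (i j : I) : (((ϖ ^ (D.parity i * D.parity j) : QPiˣ) : QPi)) ^ 2 = 1 := by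
  rw [← Units.val_pow_eq_pow_val, ← pow_mul, mul_comm, pow_mul, varpi_sq, one_pow, Units.val_one]

/-- The coefficients of the Serre expression are symmetric up to a common factor. -/
lemma serre_coeff_symm {i j : I} (hij : i ≠ j) : ∃ c : QPi,
    ∀ k ∈ Finset.range ((1 - D.a i j).toNat + 1),
      (-((ϖ ^ (D.parity i * D.parity j) : QPiˣ) : QPi)) ^ ((1 - D.a i j).toNat - k) *
        ((D.pii i ^ (((1 - D.a i j).toNat - k) * ((1 - D.a i j).toNat - k - 1) / 2) : QPiˣ) : QPi) =
      c * ((-((ϖ ^ (D.parity i * D.parity j) : QPiˣ) : QPi)) ^ k *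
        ((D.pii i ^ (k * (k - 1) / 2) : QPiˣ) : QPi)) := by
  set m := (1 - D.a i j).toNat with hm
  set s := -((ϖ ^ (D.parity i * D.parity j) : QPiˣ) : QPi) with hs
  have hs2 : s ^ 2 = 1 := by rw [hs, neg_sq, mul_self_eq_one]
  have h1 : ∀ k ≤ m, s ^ (m - k) = s ^ m * s ^ k := by
    intro k hk
    have : s ^ m = s ^ (m - k) * s ^ k := by rw [← pow_add, Nat.sub_add_cancel hk]
    rw [this, mul_assoc, ← pow_add, ← two_mul, pow_mul, hs2, one_pow, mul_one]
  by_cases hi : i ∈ D.odd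
  · have hp : D.pii i = ϖ := by simp [pii, parity, hi]
    obtain ⟨r, hr⟩ := D.even_of_odd i hi j
    have hmo : ∃ t, m = 2 * t + 1 := by
      have := D.a_nonpos i j hij
      exact ⟨(-r).toNat, by omega⟩
    obtain ⟨t, ht⟩ := hmo
    refine ⟨s ^ m * ((ϖ ^ (m * (m - 1) / 2) : QPiˣ) : QPi), fun k hk => ?_⟩
    have hk' : k ≤ m := Nat.lt_succ_iff.1 (Finset.mem_range.1 hk)
    have h2 : (ϖ ^ ((m - k) * (m - k - 1) / 2) : QPiˣ) =
        ϖ ^ (m * (m - 1) / 2) * ϖ ^ (k * (k - 1) / 2) := by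
      have h3 : ∀ n : ℕ, n * (n - 1) / 2 * 2 = n * (n - 1) := fun n =>
        Nat.div_mul_cancel (Nat.even_mul_pred_self n).two_dvd
      have h5 : ∀ n : ℕ, ((n * (n - 1) : ℕ) : ℤ) = n * (n - 1) := by
        intro n
        cases n <;> simp
      have h4 : (m - k) * (m - k - 1) / 2 + 2 * (k * t) =
          m * (m - 1) / 2 + k * (k - 1) / 2 := by
        have h6 : ∀ n : ℕ, ((n * (n - 1) / 2 : ℕ) : ℤ) * 2 = n * (n - 1) := by
          intro n
          rw [← h5]
          exact_mod_cast h3 n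
        have e1 := h6 m
        have e2 := h6 k
        have e3 := h6 (m - k)
        rw [Nat.cast_sub hk'] at e3
        have ht' : (m : ℤ) = 2 * t + 1 := by exact_mod_cast ht
        have e4 : (((m - k) * (m - k - 1) / 2 + 2 * (k * t) : ℕ) : ℤ) * 2 =
            ((m * (m - 1) / 2 + k * (k - 1) / 2 : ℕ) : ℤ) * 2 := by
          rw [Nat.cast_add, Nat.cast_add, add_mul, add_mul, e1, e2, e3, ht']
          push_cast
          ring
        exact_mod_cast mul_right_cancel₀ two_ne_zero e4
      rw [← pow_add, ← h4, pow_add _ _ (2 * (k * t)), pow_mul _ 2, varpi_sq, one_pow, mul_one]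
    rw [hp, h1 k hk', h2, Units.val_mul]
    ring
  · have hp : D.pii i = 1 := by simp [pii, parity, hi]
    refine ⟨s ^ m, fun k hk => ?_⟩
    rw [hp, one_pow, one_pow, Units.val_one, mul_one, mul_one,
      h1 k (Nat.lt_succ_iff.1 (Finset.mem_range.1 hk))]

open MulOpposite in
lemma op_divPow {A : Type*} [Ring A] [Algebra QPi A] (i : I) (x : A) (n : ℕ) :
    D.divPow i (op x) n = op (D.divPow i x n) := by
  simp [divPow]

open MulOpposite in
/-- The Serre expression is preserved by antiautomorphisms up to a factor. -/
lemma serre_op {A : Type*} [Ring A] [Algebra QPi A] {i j : I} (hij : i ≠ j) {x y : A}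
    (h : D.serre i j x y = 0) : D.serre i j (op x) (op y) = 0 := by
  obtain ⟨c, hc⟩ := D.serre_coeff_symm hij
  have : D.serre i j (op x) (op y) = op (c • D.serre i j x y) := by
    unfold serre
    rw [Finset.smul_sum, ← Finset.sum_range_reflect, Finset.op_sum]
    refine Finset.sum_congr rfl fun k hk => ?_
    have hk' : k ≤ (1 - D.a i j).toNat := Nat.lt_succ_iff.1 (Finset.mem_range.1 hk)
    rw [Nat.add_sub_cancel, hc k hk, op_divPow, op_divPow, Nat.sub_sub_self hk', ← op_mul,
      ← op_mul, ← op_smul, smul_smul, mul_assoc]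
  rw [this, h, smul_zero, op_zero]

open MulOpposite in
/-- The antiautomorphism of `U(𝔤)` exchanging `e_i` and `f_i` and fixing the `K_i`. -/
def transpose : D.U →ₐ[QPi] D.Uᵐᵒᵖ :=
  RingQuot.liftAlgHom QPi ⟨FreeAlgebra.lift QPi fun g => op (D.gen (transposeGen g)), by
    intro x y hxy
    have he : ∀ i, D.gen (.e i) = D.e i := fun _ => rfl
    have hf : ∀ i, D.gen (.f i) = D.f i := fun _ => rfl
    have hK : ∀ i, D.gen (.K i) = D.K i := fun _ => rfl
    have hKi : ∀ i, D.gen (.Kinv i) = D.Kinv i := fun _ => rfl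
    induction hxy with
    | K_Kinv i =>
      simp only [map_mul, map_one, FreeAlgebra.lift_ι_apply, transposeGen, ← op_mul, hK, hKi,
        Kinv_mul_K, op_one]
    | Kinv_K i =>
      simp only [map_mul, map_one, FreeAlgebra.lift_ι_apply, transposeGen, ← op_mul, hK, hKi,
        K_mul_Kinv, op_one]
    | K_K i j =>
      have := RingQuot.mkAlgHom_rel QPi (Rel.K_K (D := D) i j)
      rw [map_mul, map_mul] at this
      simp only [map_mul, FreeAlgebra.lift_ι_apply, transposeGen, ← op_mul]
      exact congrArg op this.symm
    | K_e i j =>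
      simp only [map_mul, map_smul, FreeAlgebra.lift_ι_apply, transposeGen, ← op_mul, ← op_smul, hK,
        hKi, hf]
      congr 1
      have h1 := D.K_mul_f i j
      have h2 : D.f j * D.K i = ((D.qi i ^ (2 * D.a i j) : QPiˣ) : QPi) • (D.K i * D.f j) := by
        rw [h1, smul_smul, ← Units.val_mul, ← zpow_add, add_neg_cancel, zpow_zero, Units.val_one,
          one_smul]
      rw [h2, mul_smul_comm, ← mul_assoc, Kinv_mul_K, one_mul]
    | K_f i j =>
      simp only [map_mul, map_smul, FreeAlgebra.lift_ι_apply, transposeGen, ← op_mul, ← op_smul, hK,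
        hKi, he]
      congr 1
      rw [e_mul_K, chi_sq, mul_smul_comm, ← mul_assoc, Kinv_mul_K, one_mul]
    | e_f_same i =>
      simp only [map_mul, map_smul, map_sub, map_one, FreeAlgebra.lift_ι_apply, transposeGen,
        ← op_mul, ← op_smul, ← op_sub, ← op_one, hK, he, hf]
      congr 1
      rw [sub_eq_iff_eq_add, add_comm]
      exact D.e_mul_f_same i
    | e_f_ne i j hij =>
      simp only [map_mul, map_smul, map_sub, map_zero, FreeAlgebra.lift_ι_apply, transposeGen,
        ← op_mul, ← op_smul, ← op_sub, he, hf]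
      rw [op_eq_zero_iff, sub_eq_zero, D.e_mul_f_ne (Ne.symm hij), D.chi_symm]
      rfl
    | serre_f i j hij =>
      rw [map_serre, map_zero, FreeAlgebra.lift_ι_apply, FreeAlgebra.lift_ι_apply]
      exact D.serre_op hij (D.serre_e_eq_zero hij)
    | serre_e i j hij =>
      rw [map_serre, map_zero, FreeAlgebra.lift_ι_apply, FreeAlgebra.lift_ι_apply]
      exact D.serre_op hij (D.serre_f_eq_zero hij)⟩

lemma transpose_gen (g : Gen I) : D.transpose (D.gen g) = MulOpposite.op (D.gen (transposeGen g)) := by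
  rw [transpose, gen]
  erw [RingQuot.liftAlgHom_mkAlgHom_apply]
  simp

end CartanSuperdatum

end UModules

/-! ### The operators of a `U(𝔤)`-module -/

section ModuleOperators

variable {I : Type u} {P : Type v} [AddCommGroup P] (D : CartanSuperdatum I P)

section

variable (Y : Type w) [AddCommGroup Y] [Module QPi Y] [Module D.U Y] [IsScalarTower QPi D.U Y]

/-- The operators by which the `f_i` act on a `U(𝔤)`-module. -/
def fOp (i : I) : Module.End QPi Y := Algebra.lsmul QPi QPi Y (D.f i)

/-- The operators by which the `K̃_i` act on a `U(𝔤)`-module. -/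
def KOp (i : I) : Module.End QPi Y := Algebra.lsmul QPi QPi Y (D.K i)

variable {Y}

@[simp] lemma eOp_apply (i : I) (u : Y) : eOp D Y i u = D.e i • u := rfl
@[simp] lemma fOp_apply (i : I) (u : Y) : fOp D Y i u = D.f i • u := rfl
@[simp] lemma KOp_apply (i : I) (u : Y) : KOp D Y i u = D.K i • u := rfl

lemma eOp_pow_apply (i : I) (n : ℕ) (u : Y) : (eOp D Y i ^ n) u = D.e i ^ n • u := by
  rw [eOp, ← map_pow]; rfl

lemma fOp_pow_apply (i : I) (n : ℕ) (u : Y) : (fOp D Y i ^ n) u = D.f i ^ n • u := by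
  rw [fOp, ← map_pow]; rfl

variable (Y) in
lemma isQuantumModule_of_module :
    IsQuantumModule D.chi D.N (eOp D Y) (fOp D Y) (KOp D Y) where
  symm := D.chi_symm
  hN i := by rw [D.chi_self_inv]; exact D.N_mul i
  ef i j u := by
    simp only [eOp_apply, fOp_apply, KOp_apply, smul_smul]
    by_cases hij : i = j
    · subst hij
      rw [e_mul_f_same, if_pos rfl, add_smul, smul_assoc, smul_assoc, sub_smul, one_smul]
    · rw [e_mul_f_ne D hij, if_neg hij, add_zero, smul_assoc]
  eK i j u := by
    simp only [eOp_apply, KOp_apply, smul_smul]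
    rw [e_mul_K, smul_assoc]
  Kf i j u := by
    simp only [fOp_apply, KOp_apply, smul_smul]
    rw [K_mul_f, smul_assoc, chi_sq]

/-- A `U(𝔤)`-module generated by a highest weight vector is spanned by the vectors
`f_{i_1} ⋯ f_{i_n} v`, since the span is stable under all generators. -/
lemma isHighestWeight_of_cyclic {v : Y} {lam : I → ℤ} (he : ∀ i, D.e i • v = 0)
    (hK : ∀ i, D.K i • v = ((D.pt i ^ lam i : QPiˣ) : QPi) • v)
    (hgen : ∀ u : Y, ∃ x : D.U, u = x • v) :
    IsHighestWeight (isQuantumModule_of_module D Y) v fun i => D.pt i ^ lam i where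
  e_hw := he
  K_hw := hK
  gen u := by
    have h := isQuantumModule_of_module D Y
    set S : Submodule QPi Y := LinearMap.range
      ((LinearMap.applyₗ v).comp (opHom (fOp D Y)).toLinearMap) with hS
    have hmem : ∀ y, opHom (fOp D Y) y v ∈ S := fun y => ⟨y, rfl⟩
    have hKS : ∀ i (β : Multiset I), ∀ y ∈ homog QPi β, D.K i • opHom (fOp D Y) y v =
        (((chiM D.chi i β ^ 2) * D.pt i ^ lam i : QPiˣ) : QPi) • opHom (fOp D Y) y v := by
      intro i β y hy
      have := h.K_opHom_f i hy v
      rw [KOp_apply, KOp_apply, hK, map_smul, smul_smul, ← Units.val_mul] at this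
      exact this
    have hstab : ∀ g, ∀ u ∈ S, D.gen g • u ∈ S := by
      rintro g _ ⟨y, rfl⟩
      change D.gen g • opHom (fOp D Y) y v ∈ S
      cases g with
      | e i =>
        have := h.e_opHom_f i y v
        rw [eOp_apply, eOp_apply, KOp_apply, he, hK, map_zero, zero_add, map_smul] at this
        change D.e i • opHom (fOp D Y) y v ∈ S
        rw [this]
        exact S.smul_mem _ (sub_mem (hmem _) (S.smul_mem _ (hmem _)))
      | f i =>
        change D.f i • opHom (fOp D Y) y v ∈ S
        rw [← fOp_apply, ← opHom_ι_mul]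
        exact hmem _
      | K i =>
        change D.K i • opHom (fOp D Y) y v ∈ S
        obtain ⟨s, z, hz, rfl⟩ := exists_eq_sum_homog y
        rw [map_sum, LinearMap.sum_apply, Finset.smul_sum]
        refine sum_mem fun β _ => ?_
        rw [hKS i β _ (hz β)]
        exact S.smul_mem _ (hmem _)
      | Kinv i =>
        change D.Kinv i • opHom (fOp D Y) y v ∈ S
        obtain ⟨s, z, hz, rfl⟩ := exists_eq_sum_homog y
        rw [map_sum, LinearMap.sum_apply, Finset.smul_sum]
        refine sum_mem fun β _ => ?_
        have h1 := congrArg (fun u => D.Kinv i • u) (hKS i β _ (hz β))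
        simp only [smul_smul, Kinv_mul_K, one_smul] at h1
        set c := chiM D.chi i β ^ 2 * D.pt i ^ lam i
        have h2 : D.Kinv i • opHom (fOp D Y) (z β) v =
            ((c⁻¹ : QPiˣ) : QPi) • opHom (fOp D Y) (z β) v := by
          conv_rhs => rw [h1]
          have hcomm : D.Kinv i • (c : QPi) • opHom (fOp D Y) (z β) v =
              (c : QPi) • D.Kinv i • opHom (fOp D Y) (z β) v :=
            (Algebra.lsmul QPi QPi Y (D.Kinv i)).map_smul _ _
          rw [hcomm, smul_smul, Units.inv_mul, one_smul]
        rw [h2]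
        exact S.smul_mem _ (hmem _)
    obtain ⟨x, rfl⟩ := hgen u
    have : x • v ∈ S := by
      induction x using U_induction with
      | one => rw [one_smul]; exact ⟨1, by simp⟩
      | add x y hx hy => rw [add_smul]; exact add_mem hx hy
      | smul c x hx => rw [smul_assoc]; exact S.smul_mem _ hx
      | gen_mul g x hx => rw [mul_smul]; exact hstab g _ hx
    obtain ⟨y, hy⟩ := this
    exact ⟨y, hy.symm⟩

/-- The Serre relation expresses `f_i ^ (1 - a_ij) f_j` by terms with more factors `f_i` on the
right, so that `f_j` preserves the vectors on which `f_i` is nilpotent. -/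
lemma exists_f_pow_smul_f_smul (i j : I) {u : Y} (hu : ∃ k, D.f i ^ k • u = 0) :
    ∃ k, D.f i ^ k • (D.f j • u) = 0 := by
  obtain ⟨n, hn⟩ := hu
  by_cases hij : i = j
  · subst hij
    exact ⟨n, by rw [smul_smul, ← pow_succ, pow_succ', mul_smul, hn, smul_zero]⟩
  set m := (1 - D.a i j).toNat with hm
  induction n using Nat.strong_induction_on generalizing u with
  | _ n ih =>
    cases n with
    | zero =>
      rw [pow_zero, one_smul] at hn
      exact ⟨0, by rw [hn, smul_zero, smul_zero]⟩
    | succ n =>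
      have h1 : ∀ k, ∃ l, D.f i ^ l • (D.f j • (D.f i ^ (k + 1) • u)) = 0 := by
        intro k
        refine ih n (Nat.lt_succ_self n) ?_
        rw [smul_smul, ← pow_add, add_comm, add_assoc, pow_add, mul_smul, add_comm 1 n, hn,
          smul_zero]
      choose l hl using h1
      set L := ∑ k ∈ Finset.range m, l k with hL
      refine ⟨L + m, ?_⟩
      have hs := congrArg (fun x => (D.f i ^ L * x) • u) (D.serre_f_eq_zero hij)
      simp only [mul_zero, zero_smul, serre, ← hm] at hs
      rw [Finset.sum_range_succ', mul_add, add_smul, Finset.mul_sum, Finset.sum_smul,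
        Finset.sum_eq_zero, zero_add] at hs
      · have hq : D.qfact i 0 = 1 := by simp [qfact]
        simp only [divPow, pow_zero, hq, Ring.inverse_one, one_smul, mul_one, Nat.sub_zero,
          smul_mul_assoc, mul_smul_comm, smul_assoc, zero_mul, Nat.zero_div, Units.val_one] at hs
        have hc : IsUnit (Ring.inverse (D.qfact i m)) := (D.isUnit_qfact i m).ringInverse
        rw [hc.smul_eq_zero] at hs
        rw [smul_smul, pow_add, mul_assoc]
        exact hs
      · intro k hk
        simp only [divPow, smul_mul_assoc, mul_smul_comm, smul_assoc]
        have hz : (D.f i ^ L * (D.f i ^ (m - (k + 1)) * D.f j * D.f i ^ (k + 1))) • u = 0 := by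
          obtain ⟨r, hr⟩ := Nat.exists_eq_add_of_le
            (Finset.single_le_sum (f := l) (fun _ _ => Nat.zero_le _) hk)
          have h5 : D.f i ^ L * (D.f i ^ (m - (k + 1)) * D.f j * D.f i ^ (k + 1)) =
              D.f i ^ (r + (m - (k + 1))) * (D.f i ^ l k * (D.f j * D.f i ^ (k + 1))) := by
            rw [mul_assoc, ← mul_assoc, ← mul_assoc (D.f i ^ (r + _)), ← pow_add, ← pow_add, hL, hr]
            congr 2
            omega
          rw [h5, mul_smul, mul_smul (D.f i ^ l k), mul_smul (D.f j), hl, smul_zero]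
        simp only [hz, smul_zero]

end

/-! ### The module `V(Λ)` -/

variable (Λ : P)

lemma e_smul_vhw (i : I) : D.e i • D.vhw Λ = 0 := by
  rw [vhw, ← map_smul, smul_eq_mul, mul_one, Submodule.mkQ_apply, Submodule.Quotient.mk_eq_zero]
  exact Submodule.subset_span (Or.inl (Or.inl ⟨i, rfl⟩))

lemma K_smul_vhw (i : I) :
    D.K i • D.vhw Λ = ((D.pt i ^ D.h i Λ : QPiˣ) : QPi) • D.vhw Λ := by
  rw [← sub_eq_zero, ← algebraMap_smul D.U ((D.pt i ^ D.h i Λ : QPiˣ) : QPi) (D.vhw Λ), ← sub_smul,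
    vhw, ← map_smul, smul_eq_mul, mul_one, Submodule.mkQ_apply, Submodule.Quotient.mk_eq_zero]
  exact Submodule.subset_span (Or.inl (Or.inr ⟨i, rfl⟩))

lemma f_pow_smul_vhw (i : I) : D.f i ^ ((D.h i Λ).toNat + 1) • D.vhw Λ = 0 := by
  rw [vhw, ← map_smul, smul_eq_mul, mul_one, Submodule.mkQ_apply, Submodule.Quotient.mk_eq_zero]
  exact Submodule.subset_span (Or.inr ⟨i, rfl⟩)

lemma exists_eq_smul_vhw (x : D.V Λ) : ∃ y : D.U, x = y • D.vhw Λ := by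
  obtain ⟨y, rfl⟩ := Submodule.mkQ_surjective _ x
  exact ⟨y, by rw [vhw, ← map_smul, smul_eq_mul, mul_one]⟩

lemma isHighestWeight_V :
    IsHighestWeight (isQuantumModule_of_module D (D.V Λ)) (D.vhw Λ) fun i => D.pt i ^ D.h i Λ :=
  isHighestWeight_of_cyclic D (e_smul_vhw D Λ) (K_smul_vhw D Λ) (exists_eq_smul_vhw D Λ)

lemma f_locally_nilpotent_V (i : I) (x : D.V Λ) : ∃ k, D.f i ^ k • x = 0 := by
  obtain ⟨y, rfl⟩ := (isHighestWeight_V D Λ).gen x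
  induction y using freeAlgebra_induction_left with
  | one => exact ⟨_, by rw [map_one, Module.End.one_apply]; exact f_pow_smul_vhw D Λ i⟩
  | add x y hx hy =>
    obtain ⟨k, hk⟩ := hx
    obtain ⟨l, hl⟩ := hy
    refine ⟨k + l, ?_⟩
    rw [map_add, LinearMap.add_apply, smul_add, add_comm k, pow_add, mul_smul, hk, smul_zero,
      zero_add, ← pow_add, add_comm l, pow_add, mul_smul, hl, smul_zero]
  | smul c x hx =>
    obtain ⟨k, hk⟩ := hx
    refine ⟨k, ?_⟩
    rw [map_smul, LinearMap.smul_apply, ← fOp_pow_apply, map_smul, fOp_pow_apply, hk, smul_zero]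
  | ι_mul j y hy =>
    rw [opHom_ι_mul, fOp_apply]
    exact exists_f_pow_smul_f_smul D i j hy

/-- The analogue for `V(Λ)` of simplicity over a field: a vector of weight `Λ - β`, `β ≠ 0`, killed by
all `e_i` vanishes. -/
theorem V_eq_zero_of_singular (hΛ : D.IsDominant Λ) {β : Multiset I} (hβ : β ≠ 0)
    {y : FreeAlgebra QPi I} (hy : y ∈ homog QPi β)
    (hsing : ∀ i, D.e i • opHom (fOp D (D.V Λ)) y (D.vhw Λ) = 0) :
    opHom (fOp D (D.V Λ)) y (D.vhw Λ) = 0 := by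
  refine eq_zero_of_singular_of_integrable _ (isHighestWeight_V D Λ) hΛ ?_ hβ hy hsing
  intro i u
  obtain ⟨k, hk⟩ := f_locally_nilpotent_V D Λ i u
  exact ⟨k, by rw [fOp_pow_apply, hk]⟩

end ModuleOperators

/-! ### Divided powers in rank one -/

section DividedPowers

variable {R : Type*} [CommRing R] (p : Rˣ) (N : R)

/-- The factorial `⟨1⟩ ⋯ ⟨n⟩`. -/
def braFact (n : ℕ) : R := ∏ k ∈ Finset.range n, bra p N (k + 1)

/-- The binomial coefficient `⟨a⟩ ⟨a - 1⟩ ⋯ ⟨a - t + 1⟩ / (⟨1⟩ ⋯ ⟨t⟩)`. -/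
def braChoose (a : ℤ) (t : ℕ) : R :=
  Ring.inverse (braFact p N t) * ∏ s ∈ Finset.range t, bra p N (a - s)

/-- The divided power `x ^ n / (⟨1⟩ ⋯ ⟨n⟩)`, which is zero for negative `n`. -/
def braPow {A : Type*} [Ring A] [Algebra R A] (x : A) (n : ℤ) : A :=
  if 0 ≤ n then Ring.inverse (braFact p N n.toNat) • x ^ n.toNat else 0

variable {p N}

lemma isUnit_braFact (hu : ∀ n : ℤ, n ≠ 0 → IsUnit (bra p N n)) (n : ℕ) :
    IsUnit (braFact p N n) := by
  induction n with
  | zero => simp [braFact]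
  | succ n ih =>
    rw [braFact, Finset.prod_range_succ]
    exact ih.mul (hu _ (by omega))

lemma inverse_braFact_succ (hu : ∀ n : ℤ, n ≠ 0 → IsUnit (bra p N n)) (n : ℕ) :
    bra p N (n + 1) * Ring.inverse (braFact p N (n + 1)) = Ring.inverse (braFact p N n) := by
  have h1 : braFact p N (n + 1) = braFact p N n * bra p N (n + 1) := by
    rw [braFact, Finset.prod_range_succ]; rfl
  have h2 := Ring.mul_inverse_cancel _ (isUnit_braFact hu (n + 1))
  have h3 := Ring.mul_inverse_cancel _ (isUnit_braFact hu n)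
  refine (isUnit_braFact hu n).mul_left_cancel ?_
  rw [h3, ← mul_assoc, ← h1, h2]

@[simp] lemma braChoose_zero (a : ℤ) : braChoose p N a 0 = 1 := by simp [braChoose, braFact]

lemma bra_mul_braChoose_succ (hu : ∀ n : ℤ, n ≠ 0 → IsUnit (bra p N n)) (a : ℤ) (t : ℕ) :
    bra p N (t + 1) * braChoose p N a (t + 1) = bra p N (a - t) * braChoose p N a t := by
  rw [braChoose, braChoose, Finset.prod_range_succ, ← mul_assoc, inverse_braFact_succ hu]
  ring

lemma bra_mul_braChoose_add_one (hu : ∀ n : ℤ, n ≠ 0 → IsUnit (bra p N n)) (a : ℤ) (t : ℕ) :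
    bra p N (t + 1) * braChoose p N (a + 1) (t + 1) = bra p N (a + 1) * braChoose p N a t := by
  rw [braChoose, braChoose, Finset.prod_range_succ', ← mul_assoc, inverse_braFact_succ hu]
  have : ∀ s : ℕ, a + 1 - ((s + 1 : ℕ) : ℤ) = a - s := fun s => by push_cast; ring
  simp only [this, Nat.cast_zero, sub_zero]
  ring

/-- The Pascal rule. -/
lemma braChoose_add_one (hu : ∀ n : ℤ, n ≠ 0 → IsUnit (bra p N n)) (a : ℤ) (t : ℕ) :
    braChoose p N (a + 1) (t + 1) =
      braChoose p N a (t + 1) + ((p ^ (a - t) : Rˣ) : R) * braChoose p N a t := by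
  refine (hu (t + 1) (by omega)).mul_left_cancel ?_
  rw [bra_mul_braChoose_add_one hu, mul_add, bra_mul_braChoose_succ hu]
  have h : p ^ (a - t) * p ^ (t + 1 : ℤ) = p ^ (a + 1) := by rw [← zpow_add]; congr 1; ring
  have h' := congrArg Units.val h
  rw [Units.val_mul] at h'
  simp only [bra]
  linear_combination (N * braChoose p N a t) * h'

/-- The binomial coefficients are Laurent polynomials in `p`. -/
lemma braChoose_mem (hu : ∀ n : ℤ, n ≠ 0 → IsUnit (bra p N n)) (A : Subring R)
    (hp : ∀ n : ℤ, ((p ^ n : Rˣ) : R) ∈ A) (a : ℤ) (t : ℕ) : braChoose p N a t ∈ A := by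
  induction t generalizing a with
  | zero => rw [braChoose_zero]; exact one_mem A
  | succ t ih =>
    induction a using Int.induction_on with
    | zero =>
      rw [braChoose, Finset.prod_eq_zero (Finset.mem_range.2 t.succ_pos) (by simp), mul_zero]
      exact zero_mem A
    | succ a h =>
      rw [braChoose_add_one hu]
      exact add_mem h (mul_mem (hp _) (ih _))
    | pred a h =>
      have h1 := braChoose_add_one hu (-(a : ℤ) - 1) t
      rw [sub_add_cancel] at h1
      rw [← sub_eq_iff_eq_add] at h1
      rw [← h1]
      exact sub_mem h (mul_mem (hp _) (ih _))

section

variable {A : Type*} [Ring A] [Algebra R A]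

@[simp] lemma braPow_zero (x : A) : braPow p N x 0 = 1 := by simp [braPow, braFact]

lemma mul_braPow (hu : ∀ n : ℤ, n ≠ 0 → IsUnit (bra p N n)) (x : A) (n : ℤ) :
    x * braPow p N x n = bra p N (n + 1) • braPow p N x (n + 1) := by
  rcases lt_trichotomy n (-1) with hn | rfl | hn
  · rw [braPow, braPow, if_neg (by omega), if_neg (by omega), mul_zero, smul_zero]
  · rw [braPow, if_neg (by omega), neg_add_cancel, bra_zero, mul_zero, zero_smul]
  · obtain ⟨k, rfl⟩ := Int.eq_ofNat_of_zero_le (show 0 ≤ n by omega)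
    have hk : ((k : ℤ) + 1).toNat = k + 1 := by omega
    rw [braPow, braPow, if_pos (by omega), if_pos (by omega), hk, Int.toNat_natCast,
      smul_smul, inverse_braFact_succ hu, mul_smul_comm, pow_succ']

end

variable {X : Type*} [AddCommGroup X] [Module R X] {e f : Module.End R X} {W : ℤ → Submodule R X}

namespace IsRankOne

lemma braPow_e_mem (h : IsRankOne p N e f W) (k : ℤ) {n : ℤ} {u : X} (hu : u ∈ W n) :
    braPow p N e k u ∈ W (n + 2 * k) := by
  unfold braPow
  split_ifs with hk
  · rw [LinearMap.smul_apply]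
    have := h.e_pow_mem k.toNat hu
    rw [Int.toNat_of_nonneg hk] at this
    exact Submodule.smul_mem _ _ this
  · rw [LinearMap.zero_apply]; exact zero_mem _

lemma e_braPow_f (h : IsRankOne p N e f W) (hu : ∀ n : ℤ, n ≠ 0 → IsUnit (bra p N n)) (m : ℤ)
    {n : ℤ} {u : X} (hn : u ∈ W n) :
    e (braPow p N f m u) = ((p ^ (-m) : Rˣ) : R) • braPow p N f m (e u) +
      (((p ^ (1 - m) : Rˣ) : R) * bra p N (n - m + 1)) • braPow p N f (m - 1) u := by
  rcases lt_trichotomy m 0 with hm | rfl | hm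
  · simp only [braPow]
    rw [if_neg (by omega), if_neg (by omega)]
    simp
  · have : braPow p N f (-1) = 0 := if_neg (by omega)
    simp [this]
  · obtain ⟨k, rfl⟩ : ∃ k : ℕ, m = k + 1 := ⟨(m - 1).toNat, by omega⟩
    have hk : ((k : ℤ) + 1).toNat = k + 1 := by omega
    rw [add_sub_cancel_right, braPow, braPow, if_pos (by omega), if_pos (by omega), hk,
      Int.toNat_natCast, LinearMap.smul_apply, LinearMap.smul_apply, LinearMap.smul_apply,
      map_smul, h.e_f_pow k hn, smul_add, smul_smul, smul_smul, smul_smul, smul_smul,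
      ← inverse_braFact_succ hu k, show n - ((k : ℤ) + 1) + 1 = n - k by ring,
      show 1 - ((k : ℤ) + 1) = -k by ring]
    congr 2 <;> ring

/-- The commutation relation of divided powers. -/
theorem braPow_e_braPow_f (h : IsRankOne p N e f W) (hu : ∀ n : ℤ, n ≠ 0 → IsUnit (bra p N n))
    (n : ℕ) (m : ℤ) {l : ℤ} {u : X} (hl : u ∈ W l) :
    braPow p N e n (braPow p N f m u) = ∑ t ∈ Finset.range (n + 1),
      (((p ^ (-(n * m) + ∑ s ∈ Finset.range (t + 1), (s : ℤ)) : Rˣ) : R) *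
        braChoose p N (l + n - m) t) • braPow p N f (m - t) (braPow p N e (n - t) u) := by
  induction n with
  | zero => simp
  | succ n ih =>
    refine (hu (n + 1) (by omega)).smul_left_cancel.1 ?_
    have h0 : ∀ y : X, bra p N (n + 1) • braPow p N e ((n + 1 : ℕ) : ℤ) y =
        e (braPow p N e n y) := fun y => by
      have := LinearMap.congr_fun (mul_braPow hu e n) y
      rw [Module.End.mul_apply, LinearMap.smul_apply] at this
      rw [this]; push_cast; rfl
    rw [h0, ih, map_sum, Finset.smul_sum]
    set T : ℕ → ℤ := fun t => ∑ s ∈ Finset.range (t + 1), (s : ℤ) with hT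
    have hT1 : ∀ t, T (t + 1) = T t + t + 1 := fun t => by
      simp only [hT]; rw [Finset.sum_range_succ]; push_cast; ring
    set L : ℤ := l + n - m with hL
    -- the two contributions to the coefficient of `f^(m - t) e^(n + 1 - t)`
    set c₁ : ℕ → R := fun t => ((p ^ (-(n * m) + T t) : Rˣ) : R) * braChoose p N L t *
      (((p ^ (-(m - t)) : Rˣ) : R) * bra p N (n - t + 1)) with hc₁
    set c₂ : ℕ → R := fun t => ((p ^ (-(n * m) + T t) : Rˣ) : R) * braChoose p N L t *
      (((p ^ (1 - (m - t)) : Rˣ) : R) * bra p N (l + 2 * (n - t) - (m - t) + 1)) with hc₂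
    set Y : ℕ → X := fun t => braPow p N f (m - t) (braPow p N e (n + 1 - t) u) with hY
    have h1 : ∀ t ∈ Finset.range (n + 1),
        e ((((p ^ (-(n * m) + T t) : Rˣ) : R) * braChoose p N L t) •
          braPow p N f (m - t) (braPow p N e (n - t) u)) = c₁ t • Y t + c₂ t • Y (t + 1) := by
      intro t _
      rw [map_smul, h.e_braPow_f hu _ (h.braPow_e_mem (n - t) hl)]
      have h2 := LinearMap.congr_fun (mul_braPow hu e ((n : ℤ) - t)) u
      rw [Module.End.mul_apply, LinearMap.smul_apply] at h2
      rw [h2, map_smul, smul_add, smul_smul, smul_smul, smul_smul]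
      simp only [hc₁, hc₂, hY]
      congr 2
      · ring
      · rw [show (n : ℤ) - t + 1 = n + 1 - t by ring]
      · push_cast
        rw [show m - ((t : ℤ) + 1) = m - t - 1 by ring,
          show (n : ℤ) + 1 - ((t : ℤ) + 1) = n - t by ring]
    rw [Finset.sum_congr rfl h1, Finset.sum_add_distrib]
    have h2 : c₁ (n + 1) = 0 := by
      simp only [hc₁]
      push_cast
      rw [show (n : ℤ) - (n + 1) + 1 = 0 by ring, bra_zero, mul_zero, mul_zero]
    rw [← add_zero (∑ x ∈ Finset.range (n + 1), c₁ x • Y x), ← zero_smul R (Y (n + 1)), ← h2,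
      ← Finset.sum_range_succ (fun x => c₁ x • Y x), Finset.sum_range_succ' _ (n + 1),
      Finset.sum_range_succ' _ (n + 1), add_right_comm, ← Finset.sum_add_distrib]
    congr 1
    · refine Finset.sum_congr rfl fun t _ => ?_
      rw [← add_smul, smul_smul]
      push_cast
      rw [show (n : ℤ) + 1 - ((t : ℤ) + 1) = (n + 1 : ℤ) - (t + 1 : ℕ) by push_cast; ring,
        show m - ((t : ℤ) + 1) = m - (t + 1 : ℕ) by push_cast; ring]
      congr 1
      change _ = bra p N (n + 1) * (((p ^ (-((n + 1) * m) + T (t + 1)) : Rˣ) : R) *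
        braChoose p N (l + (n + 1) - m) (t + 1))
      refine (hu (t + 1) (by omega)).mul_left_cancel ?_
      rw [show l + ((n : ℤ) + 1) - m = L + 1 by rw [hL]; ring]
      have e1 := bra_mul_braChoose_succ hu L t
      have e2 := bra_mul_braChoose_add_one hu L t
      simp only [hc₁, hc₂, hT1]
      rw [show l + 2 * ((n : ℤ) - t) - (m - t) + 1 = L + n - t + 1 by rw [hL]; ring]
      push_cast
      set r : Rˣ := p ^ (-((n + 1 : ℤ) * m) + (T t + t + 1)) with hr
      have e3 : p ^ (-((n : ℤ) * m) + (T t + t + 1)) * p ^ (-(m - ((t : ℤ) + 1))) =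
          r * p ^ ((t : ℤ) + 1) := by
        rw [hr, ← zpow_add, ← zpow_add]; congr 1; ring
      have e4 : p ^ (-((n : ℤ) * m) + T t) * p ^ (1 - (m - (t : ℤ))) = r := by
        rw [hr, ← zpow_add]; congr 1; ring
      have e3' := congrArg Units.val e3
      have e4' := congrArg Units.val e4
      rw [Units.val_mul, Units.val_mul] at e3'
      rw [Units.val_mul] at e4'
      have key : ((p ^ ((t : ℤ) + 1) : Rˣ) : R) * bra p N (n - (t + 1) + 1) * bra p N (L - t) +
          bra p N (t + 1) * bra p N (L + n - t + 1) = bra p N (n + 1) * bra p N (L + 1) := by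
        have g1 : p ^ ((t : ℤ) + 1) * p ^ ((n : ℤ) - (t + 1) + 1) = p ^ ((n : ℤ) + 1) := by
          rw [← zpow_add]; congr 1; ring
        have g2 : p ^ ((t : ℤ) + 1) * p ^ (L - t) = p ^ (L + 1) := by
          rw [← zpow_add]; congr 1; ring
        have g3 : p ^ (L + n - t + 1) = p ^ ((n : ℤ) - (t + 1) + 1) * p ^ (L + 1) := by
          rw [← zpow_add]; congr 1; ring
        have g1' := congrArg Units.val g1
        have g2' := congrArg Units.val g2
        have g3' := congrArg Units.val g3
        rw [Units.val_mul] at g1' g2' g3'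
        simp only [bra]
        rw [g3', ← g1', ← g2']
        ring
      linear_combination
        (bra p N (t + 1) * braChoose p N L (t + 1) * bra p N (n - (t + 1) + 1)) * e3' +
        (bra p N (t + 1) * braChoose p N L t * bra p N (L + n - t + 1)) * e4' +
        ((r : R) * ((p ^ ((t : ℤ) + 1) : Rˣ) : R) * bra p N (n - (t + 1) + 1)) * e1 -
        ((r : R) * bra p N (n + 1)) * e2 + ((r : R) * braChoose p N L t) * key
    · rw [smul_smul]
      simp only [hc₁, hY, hT]
      push_cast
      simp only [braChoose_zero, mul_one, sub_zero, Finset.range_one,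
        Finset.sum_singleton, Nat.cast_zero, add_zero]
      congr 1
      rw [← mul_assoc, ← Units.val_mul, ← zpow_add, mul_comm]
      congr 3
      ring

end IsRankOne

end DividedPowers

/-! ### The `𝔸^π`-form of a highest weight module -/

section IntegralForm

lemma q_zpow_mem_APi (m : ℤ) : ((q ^ m : QPiˣ) : QPi) ∈ APi := by
  obtain ⟨n, rfl | rfl⟩ := Int.eq_nat_or_neg m
  · rw [zpow_natCast, Units.val_pow_eq_pow_val]
    exact pow_mem (Subring.subset_closure (by simp)) n
  · rw [zpow_neg, ← inv_zpow, zpow_natCast, Units.val_pow_eq_pow_val]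
    exact pow_mem (Subring.subset_closure (by simp)) n

lemma varpi_zpow_mem_APi (m : ℤ) : ((ϖ ^ m : QPiˣ) : QPi) ∈ APi := by
  have hinv : (ϖ⁻¹ : QPiˣ) = ϖ := inv_eq_iff_mul_eq_one.2 ((pow_two ϖ).symm.trans varpi_sq)
  obtain ⟨n, rfl | rfl⟩ := Int.eq_nat_or_neg m
  · rw [zpow_natCast, Units.val_pow_eq_pow_val]
    exact pow_mem (Subring.subset_closure (by simp)) n
  · rw [zpow_neg, ← inv_zpow, zpow_natCast, Units.val_pow_eq_pow_val, hinv]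
    exact pow_mem (Subring.subset_closure (by simp)) n

lemma IsMonomial.mem_APi {u : QPiˣ} {m : ℤ} (h : IsMonomial u m) : (u : QPi) ∈ APi := by
  obtain ⟨k, rfl⟩ := h
  rw [Units.val_mul]
  exact mul_mem (varpi_zpow_mem_APi k) (q_zpow_mem_APi m)

lemma IsMonomial.inv {u : QPiˣ} {m : ℤ} (h : IsMonomial u m) : IsMonomial u⁻¹ (m * (-1)) := by
  have := h.zpow (-1)
  rwa [zpow_neg_one] at this

variable {I : Type u} {P : Type v} [AddCommGroup P] (D : CartanSuperdatum I P)

namespace CartanSuperdatum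

lemma isMonomial_qi (i : I) : IsMonomial (D.qi i) (D.d i) := ⟨0, by simp [qi]⟩

lemma qint_eq (i : I) (n : ℕ) :
    D.qint i n = ((D.qi i ^ (1 - (n : ℤ)) : QPiˣ) : QPi) * bra (D.pt i) (D.N i) n := by
  have h1 : bra (D.pt i) (D.N i) n = ∑ k ∈ Finset.range n, (D.pt i : QPi) ^ k := by
    have h2 := mul_neg_geom_sum (D.pt i : QPi) n
    rw [bra, zpow_natCast, Units.val_pow_eq_pow_val, ← h2, ← mul_assoc, N_mul, one_mul]
  rw [h1, qint, Finset.mul_sum]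
  refine Finset.sum_congr rfl fun k _ => ?_
  rw [← Units.val_pow_eq_pow_val, ← Units.val_mul, pt, zpow_add, mul_pow, zpow_mul]
  norm_cast
  simp [mul_assoc]

lemma qfact_eq (i : I) (n : ℕ) : ∃ (c : QPiˣ) (m : ℤ), IsMonomial c m ∧
    D.qfact i n = (c : QPi) * braFact (D.pt i) (D.N i) n := by
  induction n with
  | zero => exact ⟨1, 0, .one, by simp [qfact, braFact]⟩
  | succ n ih =>
    obtain ⟨c, m, hc, h⟩ := ih
    refine ⟨_, _, hc.mul ((D.isMonomial_qi i).zpow (1 - ((n + 1 : ℕ) : ℤ))), ?_⟩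
    have h1 : braFact (D.pt i) (D.N i) (n + 1) =
        braFact (D.pt i) (D.N i) n * bra (D.pt i) (D.N i) (n + 1) := by
      rw [braFact, Finset.prod_range_succ]; rfl
    have h2 : D.qfact i (n + 1) = D.qfact i n * D.qint i (n + 1) := by
      rw [qfact, Finset.prod_range_succ]; rfl
    rw [h1, h2, h, qint_eq, Units.val_mul]
    push_cast
    ring

/-- The normalizations of divided powers by `[n]_i^π!` and by `⟨1⟩ ⋯ ⟨n⟩` differ by a unit of
`𝔸^π`. -/
lemma divPow_eq (i : I) (n : ℕ) : ∃ (c : QPiˣ) (m : ℤ), IsMonomial c m ∧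
    ∀ {A : Type w} [Ring A] [Algebra QPi A] (x : A),
      D.divPow i x n = (c : QPi) • braPow (D.pt i) (D.N i) x n := by
  obtain ⟨c, m, hc, h⟩ := D.qfact_eq i n
  refine ⟨c⁻¹, _, hc.inv, fun x => ?_⟩
  rw [divPow, braPow, if_pos (Int.natCast_nonneg n), Int.toNat_natCast, smul_smul, h,
    Ring.mul_inverse_rev, mul_comm, Ring.inverse_unit]

@[simp] lemma divPow_zero {A : Type*} [Ring A] [Algebra QPi A] (i : I) (x : A) :
    D.divPow i x 0 = 1 := by simp [divPow, qfact]

end CartanSuperdatum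

section

variable {Y : Type w} [AddCommGroup Y] [Module QPi Y] [Module D.U Y] [IsScalarTower QPi D.U Y]

lemma divPow_e_smul (i : I) (n : ℕ) (u : Y) :
    D.divPow i (D.e i) n • u = D.divPow i (eOp D Y i) n u := by
  rw [eOp, ← map_divPow]; rfl

lemma divPow_f_smul (i : I) (n : ℕ) (u : Y) :
    D.divPow i (D.f i) n • u = D.divPow i (fOp D Y i) n u := by
  rw [fOp, ← map_divPow]; rfl

lemma smul_mem_of_mem_APi {S : Submodule APi Y} {c : QPi} (hc : c ∈ APi) {u : Y} (hu : u ∈ S) :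
    c • u ∈ S := S.smul_mem ⟨c, hc⟩ hu

lemma smul_smul_comm_U (x : D.U) (c : QPi) (u : Y) : x • c • u = c • x • u :=
  (Algebra.lsmul QPi QPi Y x).map_smul c u

lemma divPow_e_mul_divPow_f_ne {i j : I} (hij : i ≠ j) (n m : ℕ) :
    D.divPow i (D.e i) n * D.divPow j (D.f j) m =
      ((D.chi i j ^ (m * n) : QPiˣ) : QPi) • (D.divPow j (D.f j) m * D.divPow i (D.e i) n) := by
  have h1 : ∀ m, D.e i * D.f j ^ m = ((D.chi i j ^ m : QPiˣ) : QPi) • (D.f j ^ m * D.e i) := by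
    intro m
    induction m with
    | zero => simp
    | succ m ih =>
      rw [pow_succ, ← mul_assoc, ih, smul_mul_assoc, mul_assoc, e_mul_f_ne D hij, mul_smul_comm,
        smul_smul, ← mul_assoc, pow_succ, Units.val_mul]
  have h2 : ∀ n, D.e i ^ n * D.f j ^ m =
      ((D.chi i j ^ (m * n) : QPiˣ) : QPi) • (D.f j ^ m * D.e i ^ n) := by
    intro n
    induction n with
    | zero => simp
    | succ n ih =>
      rw [pow_succ', mul_assoc, ih, mul_smul_comm, ← mul_assoc, h1, smul_mul_assoc, smul_smul,
        mul_assoc, ← Units.val_mul, ← pow_add, mul_add, mul_one]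
  simp only [divPow, smul_mul_assoc, mul_smul_comm, h2]
  rw [smul_comm (Ring.inverse (D.qfact i n)), smul_comm (Ring.inverse (D.qfact i n)),
    smul_comm (Ring.inverse (D.qfact j m))]

/-- The product of divided powers of the `f_i` prescribed by a list. -/
def divWord (l : List (I × ℕ)) : D.U := (l.map fun a => D.divPow a.1 (D.f a.1) a.2).prod

/-- The `𝔸^π`-span of the vectors obtained from `v` by applying divided powers of the `f_i`. -/
def divSpan (v : Y) : Submodule APi Y :=
  Submodule.span APi (Set.range fun l => divWord D l • v)

variable {D}

lemma divPow_f_smul_mem_divSpan {v : Y} (i : I) (n : ℕ) {u : Y} (hu : u ∈ divSpan D v) :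
    D.divPow i (D.f i) n • u ∈ divSpan D v := by
  induction hu using Submodule.span_induction with
  | mem u hu =>
    obtain ⟨l, rfl⟩ := hu
    refine Submodule.subset_span ⟨(i, n) :: l, ?_⟩
    simp [divWord, mul_smul]
  | zero => rw [smul_zero]; exact zero_mem _
  | add x y _ _ hx hy => rw [smul_add]; exact add_mem hx hy
  | smul c x _ hx =>
    rw [Subring.smul_def, smul_smul_comm_U]
    exact smul_mem_of_mem_APi c.2 hx

lemma exists_divWord_smul_mem_eigW {v : Y} {i : I} {n : ℤ} (hv : v ∈ eigW D (KOp D Y) i n)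
    (l : List (I × ℕ)) : ∃ m, divWord D l • v ∈ eigW D (KOp D Y) i m := by
  induction l with
  | nil => exact ⟨n, by simpa [divWord] using hv⟩
  | cons a l ih =>
    obtain ⟨m, hm⟩ := ih
    have h1 : ∀ k : ℕ, (fOp D Y a.1 ^ k) (divWord D l • v) ∈
        eigW D (KOp D Y) i (m - k * D.a i a.1) := by
      intro k
      induction k with
      | zero => simpa using hm
      | succ k ih =>
        rw [pow_succ', Module.End.mul_apply]
        rw [mem_eigW] at ih ⊢
        rw [(isQuantumModule_of_module D Y).Kf, ih, map_smul, smul_smul, chi_sq', ← Units.val_mul,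
          ← zpow_add]
        congr 3
        push_cast
        ring
    refine ⟨m - a.2 * D.a i a.1, ?_⟩
    rw [divWord, List.map_cons, List.prod_cons, mul_smul, divPow, smul_assoc, ← fOp_pow_apply]
    exact Submodule.smul_mem _ _ (h1 a.2)

/-- The span of the divided power words is stable under the divided powers of the `e_i`, because the
commutation relation of divided powers has coefficients in `𝔸^π`. -/
lemma divPow_e_smul_mem_divSpan {v : Y} {lam : I → ℤ} (he : ∀ i, D.e i • v = 0)
    (hK : ∀ i, D.K i • v = ((D.pt i ^ lam i : QPiˣ) : QPi) • v) (i : I) (n : ℕ) {u : Y}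
    (hu : u ∈ divSpan D v) : D.divPow i (D.e i) n • u ∈ divSpan D v := by
  have hbra := D.isUnit_bra i
  have hword : ∀ l n, D.divPow i (D.e i) n • divWord D l • v ∈ divSpan D v := by
    intro l
    induction l with
    | nil =>
      intro n
      have h1 : divWord D ([] : List (I × ℕ)) • v = v := by simp [divWord]
      rw [h1]
      cases n with
      | zero => rw [divPow_zero, one_smul]; exact Submodule.subset_span ⟨[], h1⟩
      | succ n =>
        rw [divPow, smul_assoc, pow_succ, mul_smul, he, smul_zero, smul_zero]
        exact zero_mem _
    | cons a l ih =>
      intro n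
      obtain ⟨j, m⟩ := a
      have h1 : divWord D ((j, m) :: l) • v = D.divPow j (D.f j) m • divWord D l • v := by
        simp [divWord, mul_smul]
      rw [h1]
      by_cases hij : i = j
      · subst hij
        obtain ⟨k, hk⟩ := exists_divWord_smul_mem_eigW (D := D) (i := i) (hK i) l
        set u := divWord D l • v with hu
        obtain ⟨c₁, m₁, hc₁, h₁⟩ := D.divPow_eq i n
        obtain ⟨c₂, m₂, hc₂, h₂⟩ := D.divPow_eq i m
        rw [divPow_e_smul, divPow_f_smul, h₁, h₂, LinearMap.smul_apply, LinearMap.smul_apply,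
          map_smul, (isRankOne_of_isQuantumModule (isQuantumModule_of_module D Y) i
            ).braPow_e_braPow_f hbra n m hk]
        refine smul_mem_of_mem_APi hc₁.mem_APi (smul_mem_of_mem_APi hc₂.mem_APi
          (sum_mem fun t ht => smul_mem_of_mem_APi (mul_mem ((D.isMonomial_pt i).zpow _).mem_APi
            (braChoose_mem hbra _ (fun r => ((D.isMonomial_pt i).zpow r).mem_APi) _ _)) ?_))
        have hE : braPow (D.pt i) (D.N i) (eOp D Y i) (n - t) u ∈ divSpan D v := by
          obtain ⟨c, m', hc, h'⟩ := D.divPow_eq i (n - t)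
          have h3 := ih (n - t)
          rw [divPow_e_smul, h', LinearMap.smul_apply] at h3
          have h4 := smul_mem_of_mem_APi hc.inv.mem_APi h3
          rwa [smul_smul, Units.inv_mul, one_smul,
            Nat.cast_sub (Nat.lt_succ_iff.1 (Finset.mem_range.1 ht))] at h4
        by_cases hmt : t ≤ m
        · obtain ⟨c, m', hc, h'⟩ := D.divPow_eq i (m - t)
          have h3 := divPow_f_smul_mem_divSpan i (m - t) hE
          rw [divPow_f_smul, h', LinearMap.smul_apply] at h3
          have h4 := smul_mem_of_mem_APi hc.inv.mem_APi h3
          rwa [smul_smul, Units.inv_mul, one_smul, Nat.cast_sub hmt] at h4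
        · have : braPow (D.pt i) (D.N i) (fOp D Y i) ((m : ℤ) - t) = 0 := if_neg (by omega)
          rw [this, LinearMap.zero_apply]
          exact zero_mem _
      · rw [smul_smul, divPow_e_mul_divPow_f_ne D hij, smul_assoc, mul_smul]
        refine smul_mem_of_mem_APi ?_ (divPow_f_smul_mem_divSpan j m (ih n))
        rw [← zpow_natCast]
        exact ((D.isMonomial_chi i j).zpow _).mem_APi
  induction hu using Submodule.span_induction with
  | mem u hu =>
    obtain ⟨l, rfl⟩ := hu
    exact hword l n
  | zero => rw [smul_zero]; exact zero_mem _
  | add x y _ _ hx hy => rw [smul_add]; exact add_mem hx hy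
  | smul c x _ hx =>
    rw [Subring.smul_def, smul_smul_comm_U]
    exact smul_mem_of_mem_APi c.2 hx

lemma K_smul_mem_divSpan {v : Y} {lam : I → ℤ}
    (hK : ∀ i, D.K i • v = ((D.pt i ^ lam i : QPiˣ) : QPi) • v) (i : I) {u : Y}
    (hu : u ∈ divSpan D v) : D.K i • u ∈ divSpan D v ∧ D.Kinv i • u ∈ divSpan D v := by
  induction hu using Submodule.span_induction with
  | mem u hu =>
    obtain ⟨l, rfl⟩ := hu
    obtain ⟨k, hk⟩ := exists_divWord_smul_mem_eigW (D := D) (i := i) (hK i) l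
    have hl : divWord D l • v ∈ divSpan D v := Submodule.subset_span ⟨l, rfl⟩
    rw [mem_eigW, KOp_apply] at hk
    have h2 : D.Kinv i • divWord D l • v = (((D.pt i ^ k)⁻¹ : QPiˣ) : QPi) • divWord D l • v := by
      have h3 := congrArg (fun u => D.Kinv i • u) hk
      rw [smul_smul, Kinv_mul_K, one_smul, smul_smul_comm_U] at h3
      conv_rhs => rw [h3]
      rw [← mul_smul (Units.val _) (Units.val _), Units.inv_mul, one_smul]
    rw [h2, hk]
    exact ⟨smul_mem_of_mem_APi ((D.isMonomial_pt i).zpow k).mem_APi hl,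
      smul_mem_of_mem_APi ((D.isMonomial_pt i).zpow k).inv.mem_APi hl⟩
  | zero => rw [smul_zero, smul_zero]; exact ⟨zero_mem _, zero_mem _⟩
  | add x y _ _ hx hy =>
    rw [smul_add, smul_add]; exact ⟨add_mem hx.1 hy.1, add_mem hx.2 hy.2⟩
  | smul c x _ hx =>
    rw [Subring.smul_def, smul_smul_comm_U, smul_smul_comm_U]
    exact ⟨smul_mem_of_mem_APi c.2 hx.1, smul_mem_of_mem_APi c.2 hx.2⟩

lemma UA_smul_mem_divSpan {v : Y} {lam : I → ℤ} (he : ∀ i, D.e i • v = 0)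
    (hK : ∀ i, D.K i • v = ((D.pt i ^ lam i : QPiˣ) : QPi) • v) {x : D.U} (hx : x ∈ D.UA) {u : Y}
    (hu : u ∈ divSpan D v) : x • u ∈ divSpan D v := by
  induction hx using Algebra.adjoin_induction generalizing u with
  | mem x hx =>
    rcases hx with ((⟨i, n, _, rfl⟩ | ⟨i, n, _, rfl⟩) | ⟨i, rfl⟩) | ⟨i, rfl⟩
    · exact divPow_e_smul_mem_divSpan he hK i n hu
    · exact divPow_f_smul_mem_divSpan i n hu
    · exact (K_smul_mem_divSpan hK i hu).1
    · exact (K_smul_mem_divSpan hK i hu).2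
  | algebraMap r =>
    have : algebraMap APi D.U r • u = (r : QPi) • u := algebraMap_smul D.U (r : QPi) u
    rw [this]
    exact smul_mem_of_mem_APi r.2 hu
  | add x y _ _ hx hy => rw [add_smul]; exact add_mem (hx hu) (hy hu)
  | mul x y _ _ hx hy => rw [mul_smul]; exact hx (hy hu)

end

variable (Λ : P)

lemma divPow_f_mem_UA (i : I) (n : ℕ) : D.divPow i (D.f i) n ∈ D.UA := by
  cases n with
  | zero => rw [divPow_zero]; exact one_mem _
  | succ n =>
    exact Algebra.subset_adjoin (Or.inl (Or.inl (Or.inr ⟨i, n + 1, n.succ_pos, rfl⟩)))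

lemma mem_VA {x : D.V Λ} : x ∈ D.VA Λ ↔ ∃ y ∈ D.UA, x = y • D.vhw Λ := by
  refine ⟨?_, ?_⟩
  · rintro ⟨y, hy, rfl⟩
    exact ⟨y, hy, by rw [vhw, ← map_smul, smul_eq_mul, mul_one]; rfl⟩
  · rintro ⟨y, hy, rfl⟩
    exact ⟨y, hy, by rw [vhw, ← map_smul, smul_eq_mul, mul_one]; rfl⟩

lemma smul_mem_VA {y : D.U} (hy : y ∈ D.UA) {x : D.V Λ} (hx : x ∈ D.VA Λ) : y • x ∈ D.VA Λ := by
  rw [mem_VA] at hx ⊢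
  obtain ⟨z, hz, rfl⟩ := hx
  exact ⟨y * z, mul_mem hy hz, by rw [mul_smul]⟩

/-- `V_{𝔸^π}(Λ)` is spanned by the vectors `f_{i_1}^{{n_1}} ⋯ f_{i_r}^{{n_r}} v_Λ`. -/
theorem VA_eq_divSpan : D.VA Λ = divSpan D (D.vhw Λ) := by
  refine le_antisymm (fun x hx => ?_) ?_
  · obtain ⟨y, hy, rfl⟩ := (mem_VA D Λ).1 hx
    refine UA_smul_mem_divSpan (e_smul_vhw D Λ) (K_smul_vhw D Λ) hy (Submodule.subset_span ⟨[], ?_⟩)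
    simp [divWord]
  · refine Submodule.span_le.2 ?_
    rintro _ ⟨l, rfl⟩
    refine (mem_VA D Λ).2 ⟨divWord D l, ?_, rfl⟩
    refine list_prod_mem fun x hx => ?_
    obtain ⟨a, _, rfl⟩ := List.mem_map.1 hx
    exact divPow_f_mem_UA D a.1 a.2

end IntegralForm

/-! ### Perfect bases -/

section PerfectBasis

variable {I : Type u} {P : Type v} [AddCommGroup P] {D : CartanSuperdatum I P}
  {X : Type w} [AddCommGroup X] [Module QPi X] {e : I → Module.End QPi X}

lemma pow_eps_succ_apply (i : I) {x : X} (hx : ∃ n, (e i ^ n) x = 0) :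
    (e i ^ (eps e i x + 1)) x = 0 := by
  have hne : {n | (e i ^ (n + 1)) x = 0}.Nonempty := by
    obtain ⟨n, hn⟩ := hx
    refine ⟨n, ?_⟩
    rw [Set.mem_ofPred_eq, pow_succ', Module.End.mul_apply, hn, map_zero]
  exact Nat.sInf_mem hne

lemma pow_apply_eq_zero_of_le {g : Module.End QPi X} {x : X} {n m : ℕ} (h : n ≤ m)
    (hn : (g ^ n) x = 0) : (g ^ m) x = 0 := by
  rw [← Nat.sub_add_cancel h, pow_add, Module.End.mul_apply, hn, map_zero]

lemma pow_eps_apply_ne_zero (i : I) {x : X} (hx : x ≠ 0) : (e i ^ eps e i x) x ≠ 0 := by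
  intro h
  cases hl : eps e i x with
  | zero => rw [hl, pow_zero, Module.End.one_apply] at h; exact hx h
  | succ l =>
    rw [hl] at h
    have h1 : eps e i x ≤ l := Nat.sInf_le h
    omega

lemma eps_eq_of_pow {i : I} {x : X} {l : ℕ} (h1 : (e i ^ (l + 1)) x = 0) (h2 : (e i ^ l) x ≠ 0) :
    eps e i x = l := by
  refine le_antisymm (Nat.sInf_le h1) ?_
  by_contra hlt
  exact h2 (pow_apply_eq_zero_of_le (by omega) (pow_eps_succ_apply i ⟨_, h1⟩))

omit [AddCommGroup P] in
lemma ne_zero_of_mem_perfectBasis {wt : P → Submodule QPi X} {B : Set X}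
    (hB : IsPerfectBasis wt e B) {b : X} (hb : b ∈ B) : b ≠ 0 :=
  hB.linearIndependent.ne_zero ⟨b, hb⟩

/-- A perfect basis as a family of vectors. -/
def perfectBasis {wt : P → Submodule QPi X} {B : Set X} (hB : IsPerfectBasis wt e B) :
    Module.Basis B QPi X :=
  Module.Basis.mk hB.linearIndependent (by rw [Subtype.range_coe]; exact hB.span_eq_top.ge)

omit [AddCommGroup P] in
@[simp] lemma perfectBasis_apply {wt : P → Submodule QPi X} {B : Set X}
    (hB : IsPerfectBasis wt e B) (b : B) : perfectBasis hB b = b := by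
  simp [perfectBasis]

section Strong

variable {wt : P → Submodule QPi X} {B : Set X} (hB : IsStrongPerfectBasis D wt e B)
  (hnil : ∀ i x, ∃ n, (e i ^ n) x = 0)

include hB hnil

/-- The operator `ẽ_i` is defined on the basis vectors with `ε_i > 0` and lowers `ε_i` by one. -/
lemma exists_eTilde (i : I) {b : X} (hb : b ∈ B) (h0 : 0 < eps e i b) :
    ∃ b' c, IsETilde e B i b b' c ∧ eps e i b' + 1 = eps e i b ∧
      ∃ (r : QPiˣ) (m : ℤ), IsMonomial r m ∧ (c : QPi) = r * D.qint i (eps e i b) := by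
  have hb0 := ne_zero_of_mem_perfectBasis hB.toIsPerfectBasis hb
  have hne := pow_eps_apply_ne_zero (e := e) i hb0
  have hz := pow_eps_succ_apply (e := e) i (hnil i b)
  obtain ⟨l, hl⟩ : ∃ l, eps e i b = l + 1 := ⟨eps e i b - 1, by omega⟩
  have heb : e i b ≠ 0 := fun h => hne (by
    rw [hl, pow_succ, Module.End.mul_apply, h, map_zero])
  obtain ⟨b', ⟨c, hc⟩, -⟩ := hB.existsUnique_eTilde b hb i heb
  refine ⟨b', c, hc, ?_, ?_⟩
  · have h1 := hc.2
    rw [hl, Nat.add_sub_cancel, LinearMap.mem_ker, map_sub, sub_eq_zero, map_smul] at h1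
    rw [hl, pow_succ, Module.End.mul_apply] at hne
    rw [hl, pow_succ, Module.End.mul_apply] at hz
    rw [hl, eps_eq_of_pow (l := l)]
    · have h2 : e i ((e i ^ l) (e i b)) = (c : QPi) • e i ((e i ^ l) b') := by
        rw [h1, map_smul]
      rw [← Module.End.mul_apply, ← pow_succ', hz, eq_comm, c.isUnit.smul_eq_zero] at h2
      rw [pow_succ', Module.End.mul_apply, h2]
    · intro h2
      rw [h1, h2, smul_zero] at hne
      exact hne rfl
  · obtain ⟨m, s, hs⟩ := hB.strong b hb i heb b' c hc
    exact ⟨_, m, ⟨s, by rw [zpow_natCast]⟩, hs⟩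

/-- The maximal divided power `e_i^{{l}}`, `l = ε_i(b)`, maps `b` to a basis vector, up to a unit
of `𝔸^π`, and distinct `b` with the same `ε_i(b)` to distinct basis vectors. -/
lemma exists_top (i : I) (l : ℕ) : ∃ t : X → X,
    (∀ b ∈ B, eps e i b = l → t b ∈ B ∧ ∃ (r : QPiˣ) (m : ℤ), IsMonomial r m ∧
      D.divPow i (e i) l b = (r : QPi) • t b) ∧
    ∀ b₁ ∈ B, ∀ b₂ ∈ B, eps e i b₁ = l → eps e i b₂ = l → t b₁ = t b₂ → b₁ = b₂ := by
  induction l with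
  | zero => exact ⟨id, fun b hb _ => ⟨hb, 1, 0, .one, by simp⟩, fun b₁ _ b₂ _ _ _ h => h⟩
  | succ l ih =>
    obtain ⟨t, ht, hinj⟩ := ih
    have hex : ∀ b : X, ∃ b', b ∈ B → eps e i b = l + 1 → ∃ c, IsETilde e B i b b' c ∧
        eps e i b' + 1 = eps e i b ∧ ∃ (r : QPiˣ) (m : ℤ), IsMonomial r m ∧
          (c : QPi) = r * D.qint i (eps e i b) := by
      intro b
      by_cases h : b ∈ B ∧ eps e i b = l + 1
      · obtain ⟨b', hb'⟩ := exists_eTilde hB hnil i h.1 (by omega)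
        exact ⟨b', fun _ _ => hb'⟩
      · exact ⟨b, fun h1 h2 => absurd ⟨h1, h2⟩ h⟩
    choose g hg using hex
    refine ⟨t ∘ g, fun b hb hbl => ?_, fun b₁ h₁ b₂ h₂ hl₁ hl₂ h => ?_⟩
    · obtain ⟨c, hc, hbl', r, m, hr, hcr⟩ := hg b hb hbl
      obtain ⟨h1, r', m', hr', h2⟩ := ht (g b) hc.1 (by omega)
      refine ⟨h1, _, _, hr.mul hr', ?_⟩
      have h3 := hc.2
      rw [hbl, Nat.add_sub_cancel, LinearMap.mem_ker, map_sub, sub_eq_zero, map_smul] at h3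
      rw [divPow, LinearMap.smul_apply] at h2 ⊢
      rw [pow_succ, Module.End.mul_apply, h3, hcr, hbl, Function.comp_apply, Units.val_mul,
        mul_smul (r : QPi) (r' : QPi), ← h2, smul_smul, smul_smul]
      congr 1
      have e1 : D.qfact i (l + 1) = D.qfact i l * D.qint i (l + 1) := by
        rw [qfact, Finset.prod_range_succ]; rfl
      have e2 := Ring.inverse_mul_cancel _ (D.isUnit_qint i (l + 1) l.succ_pos)
      rw [e1, Ring.mul_inverse_rev]
      linear_combination (r * Ring.inverse (D.qfact i l)) * e2
    · obtain ⟨c₁, hc₁, hl₁', -⟩ := hg b₁ h₁ hl₁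
      obtain ⟨c₂, hc₂, hl₂', -⟩ := hg b₂ h₂ hl₂
      have h3 := hinj _ hc₁.1 _ hc₂.1 (by omega) (by omega) h
      exact hB.eTilde_injective i b₁ h₁ b₂ h₂ (by omega) (by omega) _ c₁ c₂ hc₁ (h3 ▸ hc₂)

omit hB in
lemma divPow_eps_lt {i : I} {b : X} {l : ℕ} (h : eps e i b < l) : D.divPow i (e i) l b = 0 := by
  rw [divPow, LinearMap.smul_apply, pow_apply_eq_zero_of_le h (pow_eps_succ_apply i (hnil i b)),
    smul_zero]

/-- Triangularity of the divided powers: if `l` bounds `ε_i` on the support of `m`, the coefficients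
of `m` at the basis vectors with `ε_i = l` can be read off from `e_i^{{l}} m`. -/
lemma exists_repr_divPow (i : I) {b₀ : X} (hb₀ : b₀ ∈ B) :
    ∃ (b₁ : B) (r : QPiˣ) (k : ℤ), IsMonomial r k ∧
      D.divPow i (e i) (eps e i b₀) b₀ = (r : QPi) • (b₁ : X) ∧
      ∀ m, (∀ b, (perfectBasis hB.toIsPerfectBasis).repr m b ≠ 0 → eps e i (b : X) ≤ eps e i b₀) →
        (perfectBasis hB.toIsPerfectBasis).repr (D.divPow i (e i) (eps e i b₀) m) b₁ =
          r * (perfectBasis hB.toIsPerfectBasis).repr m ⟨b₀, hb₀⟩ := by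
  obtain ⟨t, ht, hinj⟩ := exists_top hB hnil i (eps e i b₀)
  set 𝔟 := perfectBasis hB.toIsPerfectBasis with h𝔟
  have hrepr : ∀ (b : X) (hb : b ∈ B), 𝔟.repr b = Finsupp.single ⟨b, hb⟩ 1 := fun b hb => by
    rw [← 𝔟.repr_self ⟨b, hb⟩, h𝔟, perfectBasis_apply]
  obtain ⟨h1, r, k, hr, h2⟩ := ht b₀ hb₀ rfl
  refine ⟨⟨t b₀, h1⟩, r, k, hr, h2, fun m hm => ?_⟩
  conv_lhs => rw [← 𝔟.linearCombination_repr m, Finsupp.linearCombination_apply, Finsupp.sum,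
    map_sum, map_sum, Finsupp.finsetSum_apply]
  rw [Finset.sum_eq_single ⟨b₀, hb₀⟩]
  · rw [h𝔟, perfectBasis_apply, map_smul, h2, map_smul, map_smul, ← h𝔟,
      hrepr _ h1]
    simp [mul_comm]
  · intro b hbm hbne
    have hle := hm b (Finsupp.mem_support_iff.1 hbm)
    rw [h𝔟, perfectBasis_apply, map_smul, map_smul, ← h𝔟, Finsupp.smul_apply]
    rcases hle.lt_or_eq with hlt | heq
    · rw [divPow_eps_lt hnil hlt, map_zero, Finsupp.zero_apply, smul_zero]
    · obtain ⟨h3, r', k', -, h4⟩ := ht b b.2 heq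
      rw [h4, map_smul, hrepr _ h3, Finsupp.smul_apply, Finsupp.single_eq_of_ne, smul_zero, smul_zero]
      intro h5
      exact hbne (Subtype.ext (hinj b b.2 b₀ hb₀ heq rfl (congrArg Subtype.val h5).symm))
  · intro hn
    rw [Finsupp.notMem_support_iff.1 hn, zero_smul, map_zero, map_zero, Finsupp.zero_apply]

end Strong

end PerfectBasis

/-! ### Weights -/

section Weights

variable {P : Type v} {R : Type*} [Ring R] {X : Type w} [AddCommGroup X] [Module R X]
  {wt : P → Submodule R X}

lemma eq_of_mem_of_mem (h : iSupIndep wt) {x : X} (hx : x ≠ 0) {μ ν : P} (h1 : x ∈ wt μ)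
    (h2 : x ∈ wt ν) : μ = ν := by
  by_contra hne
  exact hx (Submodule.disjoint_def.1 (h.pairwiseDisjoint hne) x h1 h2)

/-- A family of submodules of the members of an independent family which spans everything is the
whole family. -/
lemma eq_of_le_of_iSup_eq_top (h : iSupIndep wt) {S : P → Submodule R X} (hS : ∀ μ, S μ ≤ wt μ)
    (htop : ⨆ μ, S μ = ⊤) (μ : P) : S μ = wt μ := by
  refine le_antisymm (hS μ) fun x hx => ?_
  have h1 : x ∈ S μ ⊔ ⨆ (ν) (_ : ν ≠ μ), S ν := by
    refine (htop.ge.trans (iSup_le fun ν => ?_)) (Submodule.mem_top (x := x))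
    by_cases hν : ν = μ
    · exact hν ▸ le_sup_left
    · exact (le_iSup₂ (f := fun ν (_ : ν ≠ μ) => S ν) ν hν).trans le_sup_right
  obtain ⟨y, hy, z, hz, rfl⟩ := Submodule.mem_sup.1 h1
  have h2 : z ∈ ⨆ (ν) (_ : ν ≠ μ), wt ν := iSup₂_mono (fun ν _ => hS ν) hz
  have h3 : z ∈ wt μ := (Submodule.add_mem_iff_right _ (hS μ hy)).1 hx
  rw [Submodule.disjoint_def.1 (h μ) z h3 h2, add_zero]
  exact hy

lemma eq_zero_of_sum_eq_zero (h : iSupIndep wt) {ι : Type*} {g : ι → P}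
    (hg : Function.Injective g) {s : Finset ι} {y : ι → X} (hy : ∀ β, y β ∈ wt (g β))
    (hsum : ∑ β ∈ s, y β = 0) : ∀ β ∈ s, y β = 0 := by
  classical
  intro β hβ
  refine Submodule.disjoint_def.1 (h (g β)) _ (hy β) ?_
  rw [← Finset.add_sum_erase s y hβ] at hsum
  rw [eq_neg_of_add_eq_zero_left hsum]
  refine neg_mem (sum_mem fun γ hγ => ?_)
  have hne : g γ ≠ g β := fun h => (Finset.mem_erase.1 hγ).1 (hg h)
  exact Submodule.mem_iSup_of_mem (g γ) (Submodule.mem_iSup_of_mem hne (hy γ))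

end Weights

section RootCone

variable {I : Type u} {P : Type v} [AddCommGroup P] (D : CartanSuperdatum I P)

namespace CartanSuperdatum

/-- The element `∑ α_i` of the positive cone attached to a multiset of indices. -/
def rootSum (β : Multiset I) : P := (β.map D.α).sum

@[simp] lemma rootSum_zero : D.rootSum 0 = 0 := by simp [rootSum]

@[simp] lemma rootSum_cons (i : I) (β : Multiset I) :
    D.rootSum (i ::ₘ β) = D.α i + D.rootSum β := by simp [rootSum]

lemma rootSum_add (β γ : Multiset I) : D.rootSum (β + γ) = D.rootSum β + D.rootSum γ := by
  simp [rootSum]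

lemma rootSum_replicate (i : I) (n : ℕ) : D.rootSum (Multiset.replicate n i) = n • D.α i := by
  simp [rootSum]

lemma rootSum_injective : Function.Injective D.rootSum := by
  classical
  have h1 : ∀ β, D.rootSum β = Finsupp.linearCombination ℤ D.α
      (β.map fun i => (Finsupp.single i 1 : I →₀ ℤ)).sum := by
    intro β
    rw [rootSum, map_multiset_sum, Multiset.map_map]
    congr 1
    refine Multiset.map_congr rfl fun i _ => ?_
    simp
  have h2 : ∀ (β : Multiset I) (j : I),
      (β.map fun i => (Finsupp.single i 1 : I →₀ ℤ)).sum j = β.count j := by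
    intro β j
    induction β using Multiset.induction with
    | empty => simp
    | cons i β ih =>
      rw [Multiset.map_cons, Multiset.sum_cons, Finsupp.add_apply, ih, Multiset.count_cons,
        Finsupp.single_apply]
      push_cast
      rw [add_comm]
      simp only [eq_comm]
  intro β γ h
  rw [h1, h1] at h
  have h3 := D.α_indep h
  ext j
  have h4 := DFunLike.congr_fun h3 j
  rw [h2, h2] at h4
  exact_mod_cast h4

lemma exists_rootSum_of_mem_Qplus {x : P} (hx : x ∈ D.Qplus) : ∃ β, x = D.rootSum β := by
  induction hx using AddSubmonoid.closure_induction with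
  | mem x hx => obtain ⟨i, rfl⟩ := hx; exact ⟨{i}, by simp [rootSum]⟩
  | zero => exact ⟨0, by simp⟩
  | add x y _ _ hx hy =>
    obtain ⟨β, rfl⟩ := hx
    obtain ⟨γ, rfl⟩ := hy
    exact ⟨β + γ, (D.rootSum_add β γ).symm⟩

end CartanSuperdatum

end RootCone

/-! ### The coordinates of a perfect basis on an `𝔸^π`-form -/

section PerfectForm

variable {I : Type u} {P : Type v} [AddCommGroup P] {D : CartanSuperdatum I P} {Λ : P}
  {M : Type w} [AddCommGroup M] [Module QPi M] [Module D.U M] [IsScalarTower QPi D.U M]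
  {wt : P → Submodule QPi M}

/-- `MA` is an `𝔸^π`-form, stable under the divided powers of the `e_i`, of an integrable module
with weights in `Λ - Q⁺`, and contains a strong perfect basis `B` whose only highest weight vector
`vΛ` generates the part of `MA` of weight `Λ`. -/
structure IsPerfectForm (D : CartanSuperdatum I P) (Λ : P) {M : Type w} [AddCommGroup M]
    [Module QPi M] [Module D.U M] [IsScalarTower QPi D.U M] (wt : P → Submodule QPi M)
    (MA : Submodule APi M) (vΛ : M) (B : Set M) : Prop where
  dominant : D.IsDominant Λ
  integrable : D.IsIntegrable wt
  weights : ∀ μ, wt μ ≠ ⊥ → Λ - μ ∈ D.Qplus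
  divPow_mem : ∀ (i : I) (n : ℕ), ∀ x ∈ MA, D.divPow i (D.e i) n • x ∈ MA
  mem_wt : vΛ ∈ wt Λ
  inf_wt : MA ⊓ (wt Λ).restrictScalars APi = Submodule.span APi {vΛ}
  subset : B ⊆ MA
  strong : IsStrongPerfectBasis D wt (eOp D M) B
  highest : {b ∈ B | ∀ i, D.e i • b = 0} = {vΛ}

lemma divPow_e_smul_mem_wt (hwt : D.IsWeighted wt) (i : I) (n : ℕ) {μ : P} {x : M}
    (hx : x ∈ wt μ) : D.divPow i (D.e i) n • x ∈ wt (μ + n • D.α i) := by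
  rw [divPow, smul_assoc]
  refine Submodule.smul_mem _ _ ?_
  induction n with
  | zero => simpa using hx
  | succ n ih =>
    rw [pow_succ', mul_smul, succ_nsmul, ← add_assoc]
    exact hwt.e_mem _ _ _ ih

lemma mem_eigW_of_mem_wt (hwt : D.IsWeighted wt) (i : I) {μ : P} {x : M} (hx : x ∈ wt μ) :
    x ∈ eigW D (KOp D M) i (D.h i μ) :=
  hwt.K_smul i μ x hx

namespace IsPerfectForm

variable {MA : Submodule APi M} {vΛ : M} {B : Set M} (h : IsPerfectForm D Λ wt MA vΛ B)

include h

lemma e_nilpotent (i : I) (x : M) : ∃ n, (eOp D M i ^ n) x = 0 := by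
  obtain ⟨n, hn⟩ := h.integrable.e_nilp i x
  exact ⟨n, by rw [eOp_pow_apply, hn]⟩

lemma f_nilpotent (i : I) (x : M) : ∃ n, (fOp D M i ^ n) x = 0 := by
  obtain ⟨n, hn⟩ := h.integrable.f_nilp i x
  exact ⟨n, by rw [fOp_pow_apply, hn]⟩

lemma hw_mem : vΛ ∈ B :=
  (h.highest.ge rfl).1

lemma e_smul_hw (i : I) : D.e i • vΛ = 0 :=
  (h.highest.ge rfl).2 i

/-- The perfect basis as a family of vectors. -/
def basis : Module.Basis B QPi M := perfectBasis h.strong.toIsPerfectBasis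

@[simp] lemma basis_apply (b : B) : h.basis b = b := perfectBasis_apply _ b

lemma repr_apply {b : M} (hb : b ∈ B) : h.basis.repr b = Finsupp.single ⟨b, hb⟩ 1 := by
  rw [← h.basis.repr_self ⟨b, hb⟩, basis_apply]

lemma ne_zero {b : M} (hb : b ∈ B) : b ≠ 0 :=
  ne_zero_of_mem_perfectBasis h.strong.toIsPerfectBasis hb

lemma exists_rootSum {μ : P} {x : M} (hx : x ∈ wt μ) (h0 : x ≠ 0) :
    ∃ β, μ = Λ - D.rootSum β := by
  obtain ⟨β, hβ⟩ := D.exists_rootSum_of_mem_Qplus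
    (h.weights μ (fun hb => h0 ((Submodule.eq_bot_iff _).1 hb x hx)))
  exact ⟨β, by rw [← hβ, sub_sub_cancel]⟩

/-- `Λ + α_i` is not a weight. -/
lemma eq_zero_of_mem_wt_add (i : I) {x : M} (hx : x ∈ wt (Λ + D.α i)) : x = 0 := by
  by_contra h0
  obtain ⟨β, hβ⟩ := h.exists_rootSum hx h0
  have h1 : D.rootSum (i ::ₘ β) = D.rootSum 0 := by
    rw [rootSum_cons, rootSum_zero, ← sub_eq_zero, sub_zero]
    have : D.α i = -D.rootSum β := by
      rw [sub_eq_add_neg] at hβ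
      exact add_left_cancel hβ
    rw [this, neg_add_cancel]
  exact Multiset.cons_ne_zero (D.rootSum_injective h1)

/-- A basis of weight vectors contains a basis of each weight space. -/
lemma mem_span_inter {μ : P} {x : M} (hx : x ∈ wt μ) :
    x ∈ Submodule.span QPi (B ∩ wt μ : Set M) := by
  have hle : ∀ ν, Submodule.span QPi (B ∩ wt ν : Set M) ≤ wt ν := fun ν =>
    Submodule.span_le.2 fun y hy => hy.2
  have h1 := eq_of_le_of_iSup_eq_top h.integrable.indep hle (by
    rw [eq_top_iff, ← h.strong.span_eq_top]
    refine Submodule.span_le.2 fun b hb => ?_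
    obtain ⟨ν, hν⟩ := h.strong.homogeneous b hb
    exact Submodule.mem_iSup_of_mem ν (Submodule.subset_span ⟨hb, hν⟩)) μ
  rw [h1]
  exact hx

lemma mem_wt_of_repr_ne_zero {μ : P} {x : M} (hx : x ∈ wt μ) {b : B}
    (hb : h.basis.repr x b ≠ 0) : (b : M) ∈ wt μ := by
  have h1 := h.mem_span_inter hx
  have h2 : (B ∩ wt μ : Set M) = h.basis '' {b | (b : M) ∈ wt μ} := by
    ext y
    constructor
    · rintro ⟨hy, hy'⟩
      exact ⟨⟨y, hy⟩, hy', by simp⟩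
    · rintro ⟨b, hb, rfl⟩
      rw [basis_apply]
      exact ⟨b.2, hb⟩
  rw [h2, Module.Basis.mem_span_image] at h1
  exact h1 (Finsupp.mem_support_iff.2 hb)

lemma exists_repr_divPow (i : I) {b₀ : M} (hb₀ : b₀ ∈ B) :
    ∃ (b₁ : B) (r : QPiˣ) (k : ℤ), IsMonomial r k ∧
      D.divPow i (D.e i) (eps (eOp D M) i b₀) • b₀ = (r : QPi) • (b₁ : M) ∧
      ∀ m, (∀ b, h.basis.repr m b ≠ 0 → eps (eOp D M) i (b : M) ≤ eps (eOp D M) i b₀) →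
        h.basis.repr (D.divPow i (D.e i) (eps (eOp D M) i b₀) • m) b₁ =
          r * h.basis.repr m ⟨b₀, hb₀⟩ := by
  simp only [divPow_e_smul]
  exact QuantumSuper.exists_repr_divPow h.strong h.e_nilpotent i hb₀

lemma mem_span_hw {m : M} (hm : ∀ b, h.basis.repr m b ≠ 0 → (b : M) = vΛ) :
    m = h.basis.repr m ⟨vΛ, h.hw_mem⟩ • vΛ := by
  refine h.basis.repr.injective (Finsupp.ext fun b => ?_)
  rw [map_smul, h.repr_apply h.hw_mem, Finsupp.smul_apply]
  by_cases hb : b = ⟨vΛ, h.hw_mem⟩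
  · rw [hb, Finsupp.single_eq_same, smul_eq_mul, mul_one]
  · rw [Finsupp.single_eq_of_ne hb, smul_zero]
    by_contra h0
    exact hb (Subtype.ext (hm b h0))

/-- The elements of the form have coordinates in `𝔸^π`. For the proof one descends along the depth
of the weights, using that a divided power `e_i^{{l}}` with `l` maximal on the support exhibits one
of the coefficients. -/
lemma repr_mem_APi {m : M} (hm : m ∈ MA) (b : B) : h.basis.repr m b ∈ APi := by
  classical
  have key : ∀ n, ∀ m ∈ MA, (∀ b, h.basis.repr m b ≠ 0 →
      ∃ β, Multiset.card β < n ∧ (b : M) ∈ wt (Λ - D.rootSum β)) →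
        ∀ b, h.basis.repr m b ∈ APi := by
    intro n
    induction n with
    | zero =>
      intro m _ hsupp b
      by_cases hb : h.basis.repr m b = 0
      · rw [hb]; exact zero_mem _
      · obtain ⟨β, hβ, -⟩ := hsupp b hb
        exact absurd hβ (Nat.not_lt_zero _)
    | succ n ih =>
      intro m hm hsupp
      generalize hs : (h.basis.repr m).support.card = s
      induction s using Nat.strong_induction_on generalizing m with
      | _ s ihs =>
      -- either one of the coefficients can be split off, or `m` is a multiple of `vΛ`
      by_cases hex : ∃ i, ∃ b, h.basis.repr m b ≠ 0 ∧ 0 < eps (eOp D M) i (b : M)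
      · obtain ⟨i, b', hb', hpos⟩ := hex
        obtain ⟨b₀, hb₀, hmax⟩ := Finset.exists_max_image (h.basis.repr m).support
          (fun b => eps (eOp D M) i (b : M)) ⟨b', Finsupp.mem_support_iff.2 hb'⟩
        have hl := hpos.trans_le (hmax b' (Finsupp.mem_support_iff.2 hb'))
        obtain ⟨b₁, r, k, hr, -, h3⟩ := h.exists_repr_divPow i b₀.2
        set l := eps (eOp D M) i (b₀ : M) with hl_def
        have h4 : h.basis.repr (D.divPow i (D.e i) l • m) b₁ ∈ APi := by
          refine ih _ (h.divPow_mem i l m hm) (fun b hb => ?_) b₁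
          rw [← h.basis.linearCombination_repr m, Finsupp.linearCombination_apply, Finsupp.sum,
            Finset.smul_sum, map_sum, Finsupp.finsetSum_apply] at hb
          obtain ⟨b'', hb'', hne⟩ := Finset.exists_ne_zero_of_sum_ne_zero hb
          rw [smul_smul_comm_U, map_smul, Finsupp.smul_apply, basis_apply] at hne
          obtain ⟨β, hβ, hmem⟩ := hsupp b'' (Finsupp.mem_support_iff.1 hb'')
          have h5 := h.mem_wt_of_repr_ne_zero
            (divPow_e_smul_mem_wt h.integrable.toIsWeighted i l hmem) (right_ne_zero_of_smul hne)
          obtain ⟨γ, hγ⟩ := h.exists_rootSum h5 (h.ne_zero b.2)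
          have h6 : β = γ + Multiset.replicate l i := by
            refine D.rootSum_injective ?_
            rw [rootSum_add, rootSum_replicate]
            have := congrArg (fun x => Λ - x + l • D.α i) hγ
            have e1 : D.rootSum β = Λ - (Λ - D.rootSum β + l • D.α i) + l • D.α i := by abel
            have e2 : Λ - (Λ - D.rootSum γ) + l • D.α i = D.rootSum γ + l • D.α i := by abel
            rw [e1, this, e2]
          refine ⟨γ, ?_, hγ ▸ h5⟩
          rw [h6, Multiset.card_add, Multiset.card_replicate] at hβ
          omega
        rw [h3 m fun b hb => hmax b (Finsupp.mem_support_iff.2 hb)] at h4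
        have h5 : h.basis.repr m b₀ ∈ APi := by
          have := mul_mem hr.inv.mem_APi h4
          rwa [← mul_assoc, Units.inv_mul, one_mul] at this
        have h6 : h.basis.repr (m - h.basis.repr m b₀ • (b₀ : M)) =
            (h.basis.repr m).erase b₀ := by
          rw [map_sub, map_smul, h.repr_apply b₀.2, Finsupp.smul_single, smul_eq_mul, mul_one,
            sub_eq_iff_eq_add]
          exact (Finsupp.erase_add_single b₀ _).symm
        have h7 := ihs _ ?_ (m - h.basis.repr m b₀ • (b₀ : M))
          (sub_mem hm (smul_mem_of_mem_APi h5 (h.subset b₀.2))) (fun b hb => hsupp b fun h0 => ?_)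
          rfl
        · intro b
          by_cases hb : b = b₀
          · rw [hb]; exact h5
          · have := h7 b
            rwa [h6, Finsupp.erase_ne hb] at this
        · rw [h6, Finsupp.support_erase, ← hs]
          exact Finset.card_erase_lt_of_mem hb₀
        · refine hb ?_
          rw [h6]
          by_cases hb' : b = b₀
          · rw [hb', Finsupp.erase_same]
          · rw [Finsupp.erase_ne hb', h0]
      · push Not at hex
        have h1 : ∀ b, h.basis.repr m b ≠ 0 → (b : M) = vΛ := by
          intro b hb
          refine h.highest.le ⟨b.2, fun i => ?_⟩
          have h2 := pow_eps_succ_apply (e := eOp D M) i (h.e_nilpotent i (b : M))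
          rwa [Nat.le_zero.1 (hex i b hb), zero_add, pow_one] at h2
        have h2 := h.mem_span_hw h1
        have h3 : m ∈ Submodule.span APi {vΛ} := by
          rw [← h.inf_wt]
          refine ⟨hm, ?_⟩
          change m ∈ wt Λ
          rw [h2]
          exact Submodule.smul_mem _ _ h.mem_wt
        obtain ⟨a, ha⟩ := Submodule.mem_span_singleton.1 h3
        intro b
        by_cases hb : h.basis.repr m b = 0
        · rw [hb]; exact zero_mem _
        · have hb' : b = ⟨vΛ, h.hw_mem⟩ := Subtype.ext (h1 b hb)
          rw [← ha, Subring.smul_def, map_smul, h.repr_apply h.hw_mem, hb', Finsupp.smul_apply,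
            Finsupp.single_eq_same, smul_eq_mul, mul_one]
          exact a.2
  have hdepth : ∀ b : B, ∃ β, (b : M) ∈ wt (Λ - D.rootSum β) := fun b => by
    obtain ⟨μ, hμ⟩ := h.strong.homogeneous b b.2
    obtain ⟨β, rfl⟩ := h.exists_rootSum hμ (h.ne_zero b.2)
    exact ⟨β, hμ⟩
  choose β hβ using hdepth
  refine key (∑ b ∈ (h.basis.repr m).support, (Multiset.card (β b) + 1)) m hm (fun b hb => ?_) b
  exact ⟨β b, Finset.single_le_sum (f := fun b => Multiset.card (β b) + 1)
    (fun _ _ => Nat.zero_le _) (Finsupp.mem_support_iff.2 hb), hβ b⟩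

lemma mem_iff_repr {m : M} : m ∈ MA ↔ ∀ b, h.basis.repr m b ∈ APi := by
  refine ⟨fun hm b => h.repr_mem_APi hm b, fun hm => ?_⟩
  rw [← h.basis.linearCombination_repr m, Finsupp.linearCombination_apply]
  refine sum_mem fun b _ => smul_mem_of_mem_APi (hm b) ?_
  rw [basis_apply]
  exact h.subset b.2

lemma span_eq : Submodule.span APi B = MA := by
  refine le_antisymm (Submodule.span_le.2 h.subset) fun m hm => ?_
  rw [← h.basis.linearCombination_repr m, Finsupp.linearCombination_apply]
  refine sum_mem fun b _ => smul_mem_of_mem_APi (h.repr_mem_APi hm b) ?_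
  rw [basis_apply]
  exact Submodule.subset_span b.2

lemma linearIndependent_APi : LinearIndependent APi (Subtype.val : B → M) :=
  h.strong.linearIndependent.restrict_scalars fun a b hab => by
    simpa [Subring.smul_def] using hab

/-- The coefficient of the highest weight vector. -/
def hwCoord : M →ₗ[QPi] QPi := h.basis.coord ⟨vΛ, h.hw_mem⟩

lemma hwCoord_hw : h.hwCoord vΛ = 1 := by
  rw [hwCoord, Module.Basis.coord_apply, h.repr_apply h.hw_mem, Finsupp.single_eq_same]

lemma hwCoord_of_ne {μ : P} (hμ : μ ≠ Λ) {x : M} (hx : x ∈ wt μ) : h.hwCoord x = 0 := by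
  by_contra h0
  exact hμ (eq_of_mem_of_mem h.integrable.indep (h.ne_zero h.hw_mem)
    (h.mem_wt_of_repr_ne_zero hx h0) h.mem_wt)

lemma hwCoord_mem_APi {m : M} (hm : m ∈ MA) : h.hwCoord m ∈ APi := h.repr_mem_APi hm _

/-- To verify a linear identity it suffices to consider weight vectors. -/
lemma weight_induction {p : M → Prop} (hp0 : p 0) (hadd : ∀ x y, p x → p y → p (x + y))
    (hwt : ∀ μ, ∀ x ∈ wt μ, p x) (x : M) : p x := by
  have hx : x ∈ ⨆ μ, wt μ := by rw [h.integrable.iSup_eq_top]; exact Submodule.mem_top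
  induction hx using Submodule.iSup_induction' with
  | mem μ x hx => exact hwt μ x hx
  | zero => exact hp0
  | add x y _ _ hx hy => exact hadd x y hx hy

end IsPerfectForm

end PerfectForm

/-! ### Weight spaces of `V(Λ)` -/

section WeightSpaces

variable {I : Type u} {P : Type v} [AddCommGroup P] (D : CartanSuperdatum I P) (Λ : P)

lemma smul_vhw (y : D.U) : y • D.vhw Λ = (D.hwIdeal Λ).mkQ y := by
  rw [vhw, ← map_smul, smul_eq_mul, mul_one]

lemma smul_vhw_eq_zero {y : D.U} : y • D.vhw Λ = 0 ↔ y ∈ D.hwIdeal Λ := by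
  rw [smul_vhw, Submodule.mkQ_apply, Submodule.Quotient.mk_eq_zero]

lemma prod_gen_smul_vhw_mem_Vwt (l : List (Gen I)) :
    (l.map D.gen).prod • D.vhw Λ ∈ D.Vwt Λ (Λ + (l.map D.genWeight).sum) := by
  rw [smul_vhw]
  exact ⟨_, Submodule.subset_span ⟨l, by rw [add_sub_cancel_left], rfl⟩, rfl⟩

variable {D Λ} in
lemma Vwt_induction {μ : P} {p : ∀ x : D.V Λ, x ∈ D.Vwt Λ μ → Prop} (zero : p 0 (zero_mem _))
    (add : ∀ x y hx hy, p x hx → p y hy → p (x + y) (add_mem hx hy))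
    (smul : ∀ (c : QPi) x hx, p x hx → p (c • x) (Submodule.smul_mem _ c hx))
    (mem : ∀ (l : List (Gen I)) (hl : Λ + (l.map D.genWeight).sum = μ),
      p ((l.map D.gen).prod • D.vhw Λ) (hl ▸ prod_gen_smul_vhw_mem_Vwt D Λ l))
    {x : D.V Λ} (hx : x ∈ D.Vwt Λ μ) : p x hx := by
  suffices h : ∃ hx, p x hx from h.2
  obtain ⟨y, hy, rfl⟩ := hx
  change ∃ hx, p ((D.hwIdeal Λ).mkQ y) hx
  rw [← smul_vhw]
  change y ∈ D.rootSpace (μ - Λ) at hy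
  induction hy using Submodule.span_induction with
  | mem y hy =>
    obtain ⟨l, hl, rfl⟩ := hy
    exact ⟨_, mem l (by rw [hl, add_sub_cancel])⟩
  | zero => rw [zero_smul]; exact ⟨_, zero⟩
  | add x y _ _ hx hy => rw [add_smul]; exact ⟨_, add _ _ _ _ hx.2 hy.2⟩
  | smul c x _ hx => rw [smul_assoc]; exact ⟨_, smul c _ _ hx.2⟩

lemma gen_smul_mem_Vwt (g : Gen I) {μ : P} {x : D.V Λ} (hx : x ∈ D.Vwt Λ μ) :
    D.gen g • x ∈ D.Vwt Λ (μ + D.genWeight g) := by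
  induction hx using Vwt_induction with
  | zero => rw [smul_zero]; exact zero_mem _
  | add x y _ _ hx hy => rw [smul_add]; exact add_mem hx hy
  | smul c x _ hx => rw [smul_smul_comm_U]; exact Submodule.smul_mem _ _ hx
  | mem l hl =>
    have := prod_gen_smul_vhw_mem_Vwt D Λ (g :: l)
    simp only [List.map_cons, List.prod_cons, mul_smul, List.sum_cons] at this
    rwa [add_comm (D.genWeight g), ← add_assoc, hl] at this

lemma divPow_f_smul_mem_Vwt (i : I) (n : ℕ) {μ : P} {x : D.V Λ} (hx : x ∈ D.Vwt Λ μ) :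
    D.divPow i (D.f i) n • x ∈ D.Vwt Λ (μ - n • D.α i) := by
  rw [divPow, smul_assoc]
  refine Submodule.smul_mem _ _ ?_
  induction n with
  | zero => simpa using hx
  | succ n ih =>
    rw [pow_succ', mul_smul, succ_nsmul, ← sub_sub, sub_eq_add_neg _ (D.α i)]
    exact gen_smul_mem_Vwt D Λ (.f i) ih

lemma vhw_mem_Vwt : D.vhw Λ ∈ D.Vwt Λ Λ := by
  simpa using prod_gen_smul_vhw_mem_Vwt D Λ []

lemma opHom_f_vhw_mem_Vwt {β : Multiset I} {z : FreeAlgebra QPi I} (hz : z ∈ homog QPi β) :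
    opHom (fOp D (D.V Λ)) z (D.vhw Λ) ∈ D.Vwt Λ (Λ - D.rootSum β) := by
  induction hz using homog_induction with
  | hw w hw =>
    subst hw
    induction w with
    | nil => simpa using vhw_mem_Vwt D Λ
    | cons i w ih =>
      rw [word_cons, opHom_ι_mul, fOp_apply, ← Multiset.cons_coe, rootSum_cons, add_comm, ← sub_sub,
        sub_eq_add_neg _ (D.α i)]
      exact gen_smul_mem_Vwt D Λ (.f i) ih
  | zero => rw [map_zero]; exact zero_mem _
  | add x y _ _ hx hy => rw [map_add]; exact add_mem hx hy
  | smul c x _ hx => rw [map_smul]; exact Submodule.smul_mem _ _ hx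

lemma iSup_Vwt : ⨆ μ, D.Vwt Λ μ = ⊤ := by
  refine eq_top_iff.2 fun x _ => ?_
  obtain ⟨y, rfl⟩ := (isHighestWeight_V D Λ).gen x
  obtain ⟨s, z, hz, rfl⟩ := exists_eq_sum_homog y
  rw [map_sum, LinearMap.sum_apply]
  exact sum_mem fun β _ => Submodule.mem_iSup_of_mem _ (opHom_f_vhw_mem_Vwt D Λ (hz β))

/-- A homogeneous vector of a subspace of `V(Λ)` which is stable under all `e_i` and meets the
highest weight space in zero is zero: otherwise the subspace would contain a singular vector. -/
lemma V_eq_zero_of_mem (hΛ : D.IsDominant Λ) (S : Submodule QPi (D.V Λ))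
    (he : ∀ i, ∀ x ∈ S, D.e i • x ∈ S) (h0 : ∀ c : QPi, c • D.vhw Λ ∈ S → c • D.vhw Λ = 0)
    {β : Multiset I} {z : FreeAlgebra QPi I} (hz : z ∈ homog QPi β)
    (hmem : opHom (fOp D (D.V Λ)) z (D.vhw Λ) ∈ S) : opHom (fOp D (D.V Λ)) z (D.vhw Λ) = 0 := by
  generalize hn : Multiset.card β = n
  induction n generalizing β z with
  | zero =>
    rw [Multiset.card_eq_zero] at hn
    subst hn
    rw [eq_counit_of_homog_zero hz, map_smul, map_one, LinearMap.smul_apply,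
      Module.End.one_apply] at hmem ⊢
    exact h0 _ hmem
  | succ n ih =>
    refine V_eq_zero_of_singular D Λ hΛ (β := β) (by rintro rfl; simp at hn) hz fun i => ?_
    have h1 := he i _ hmem
    have h2 := (isQuantumModule_of_module D (D.V Λ)).e_opHom_hw (isHighestWeight_V D Λ) i z
    rw [eOp_apply] at h2
    rw [h2] at h1 ⊢
    by_cases hi : i ∈ β
    · obtain ⟨γ, rfl⟩ := Multiset.exists_cons_of_mem hi
      refine ih (IsQuantumModule.lower_mem_homog i hz) h1 ?_
      rw [Multiset.card_cons] at hn
      omega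
    · rw [IsQuantumModule.lower_of_notMem hi hz, map_zero, LinearMap.zero_apply]

/-- A bilinear form on `V(Λ)` for which `e_i` and `f_i` are adjoint to each other is determined by
its value at `v_Λ`. -/
lemma bilinForm_eq_zero {C : LinearMap.BilinForm QPi (D.V Λ)}
    (he : ∀ i x y, C (D.e i • x) y = C x (D.f i • y))
    (hf : ∀ i x y, C (D.f i • x) y = C x (D.e i • y)) (h0 : C (D.vhw Λ) (D.vhw Λ) = 0) :
    C = 0 := by
  have h1 : ∀ y, C (D.vhw Λ) y = 0 := by
    intro y
    obtain ⟨z, rfl⟩ := (isHighestWeight_V D Λ).gen y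
    induction z using freeAlgebra_induction_left with
    | one => rw [map_one]; exact h0
    | add x y hx hy => rw [map_add, LinearMap.add_apply, map_add, hx, hy, add_zero]
    | smul c x hx => rw [map_smul, LinearMap.smul_apply, map_smul, hx, smul_zero]
    | ι_mul i x hx => rw [opHom_ι_mul, fOp_apply, ← he, e_smul_vhw, map_zero, LinearMap.zero_apply]
  refine LinearMap.ext fun x => LinearMap.ext fun y => ?_
  rw [LinearMap.zero_apply, LinearMap.zero_apply]
  obtain ⟨z, rfl⟩ := (isHighestWeight_V D Λ).gen x
  induction z using freeAlgebra_induction_left generalizing y with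
  | one => rw [map_one]; exact h1 y
  | add x z hx hz => rw [map_add, LinearMap.add_apply, map_add, LinearMap.add_apply, hx, hz, add_zero]
  | smul c x hx => rw [map_smul, LinearMap.smul_apply, map_smul, LinearMap.smul_apply, hx, smul_zero]
  | ι_mul i x hx => rw [opHom_ι_mul, fOp_apply, hf, hx]

end WeightSpaces

/-! ### The map `V(Λ) → M` and the pairing of `M` with `V(Λ)` -/

section Pairing

variable {I : Type u} {P : Type v} [AddCommGroup P] {D : CartanSuperdatum I P} {Λ : P}
  {M : Type w} [AddCommGroup M] [Module QPi M] [Module D.U M] [IsScalarTower QPi D.U M]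
  {wt : P → Submodule QPi M}

namespace IsPerfectForm

variable {MA : Submodule APi M} {vΛ : M} {B : Set M} (h : IsPerfectForm D Λ wt MA vΛ B)

include h

/-- The vector `f_i ^ (⟨h_i, Λ⟩ + 1) vΛ` is killed by `e_i` and has a negative weight for `h_i`, so
that it vanishes by integrability. -/
lemma f_pow_hw (i : I) : D.f i ^ ((D.h i Λ).toNat + 1) • vΛ = 0 := by
  have hr := isRankOne_of_isQuantumModule (isQuantumModule_of_module D M) i
  have hn : ((D.h i Λ).toNat : ℤ) = D.h i Λ := Int.toNat_of_nonneg (h.dominant i)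
  set n := (D.h i Λ).toNat
  have hv := mem_eigW_of_mem_wt h.integrable.toIsWeighted i h.mem_wt
  rw [← hn] at hv
  obtain ⟨s, hs⟩ := h.f_nilpotent i (D.f i ^ (n + 1) • vΛ)
  refine hr.eq_zero_of_e_pow (D.isUnit_bra i) s 1 (m := n + 2) (by push_cast; omega) ?_ ?_ hs
  · have := hr.f_pow_mem (n + 1) hv
    rw [fOp_pow_apply] at this
    rwa [show -((n : ℤ) + 2) = n - 2 * (n + 1 : ℕ) by push_cast; ring]
  · have := hr.e_f_pow n hv
    rw [fOp_pow_apply, eOp_apply, eOp_apply, h.e_smul_hw, map_zero, smul_zero, sub_self, bra_zero,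
      mul_zero, zero_smul, add_zero] at this
    rwa [pow_one, eOp_apply]

lemma hwIdeal_le_ker : D.hwIdeal Λ ≤ LinearMap.ker (LinearMap.toSpanSingleton D.U M vΛ) := by
  refine Submodule.span_le.2 ?_
  rintro _ ((⟨i, rfl⟩ | ⟨i, rfl⟩) | ⟨i, rfl⟩)
  · exact h.e_smul_hw i
  · change (D.K i - _) • vΛ = 0
    rw [sub_smul, algebraMap_smul, sub_eq_zero]
    exact h.integrable.K_smul i Λ vΛ h.mem_wt
  · exact h.f_pow_hw i

/-- The homomorphism `V(Λ) → M` which maps `v_Λ` to `vΛ`. -/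
def toModule : D.V Λ →ₗ[D.U] M :=
  (D.hwIdeal Λ).liftQ (LinearMap.toSpanSingleton D.U M vΛ) h.hwIdeal_le_ker

lemma toModule_vhw : h.toModule (D.vhw Λ) = vΛ := by
  rw [toModule, vhw, Submodule.mkQ_apply, Submodule.liftQ_apply, LinearMap.toSpanSingleton_apply,
    one_smul]

lemma toModule_smul (c : QPi) (x : D.V Λ) : h.toModule (c • x) = c • h.toModule x := by
  rw [← algebraMap_smul D.U c x, map_smul, algebraMap_smul]

lemma gen_smul_mem_wt (g : Gen I) {μ : P} {x : M} (hx : x ∈ wt μ) :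
    D.gen g • x ∈ wt (μ + D.genWeight g) := by
  cases g with
  | e i => exact h.integrable.e_mem i μ x hx
  | f i =>
    rw [genWeight, ← sub_eq_add_neg]
    exact h.integrable.f_mem i μ x hx
  | K i =>
    rw [genWeight, add_zero]
    have : D.gen (.K i) • x = _ := h.integrable.K_smul i μ x hx
    rw [this]
    exact Submodule.smul_mem _ _ hx
  | Kinv i =>
    rw [genWeight, add_zero]
    have h1 := congrArg (fun u => D.Kinv i • u) (h.integrable.K_smul i μ x hx)
    rw [smul_smul, Kinv_mul_K, one_smul, smul_smul_comm_U] at h1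
    have h2 : D.gen (.Kinv i) • x = (((D.pt i ^ D.h i μ)⁻¹ : QPiˣ) : QPi) • x := by
      conv_rhs => rw [h1]
      rw [smul_smul, Units.inv_mul, one_smul]
      rfl
    rw [h2]
    exact Submodule.smul_mem _ _ hx

lemma toModule_mem_wt {μ : P} {x : D.V Λ} (hx : x ∈ D.Vwt Λ μ) : h.toModule x ∈ wt μ := by
  induction hx using Vwt_induction with
  | zero => rw [map_zero]; exact zero_mem _
  | add x y _ _ hx hy => rw [map_add]; exact add_mem hx hy
  | smul c x _ hx => rw [toModule_smul]; exact Submodule.smul_mem _ _ hx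
  | mem l hl =>
    subst hl
    rw [map_smul, toModule_vhw]
    induction l with
    | nil => simpa using h.mem_wt
    | cons g l ih =>
      simp only [List.map_cons, List.prod_cons, mul_smul, List.sum_cons]
      rw [add_comm (D.genWeight g), ← add_assoc]
      exact h.gen_smul_mem_wt g ih

/-- The kernel is stable under the `e_i` and contains no multiples of `v_Λ` except zero, because `vΛ`
is a basis vector. -/
lemma toModule_injective : Function.Injective h.toModule := by
  rw [injective_iff_map_eq_zero]
  intro x hx
  obtain ⟨y, rfl⟩ := (isHighestWeight_V D Λ).gen x
  obtain ⟨s, z, hz, rfl⟩ := exists_eq_sum_homog y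
  rw [map_sum, LinearMap.sum_apply] at hx ⊢
  rw [map_sum] at hx
  have h1 := eq_zero_of_sum_eq_zero h.integrable.indep
    (g := fun β : Multiset I => Λ - D.rootSum β)
    (fun β γ hβγ => D.rootSum_injective (sub_right_injective hβγ))
    (fun β => h.toModule_mem_wt (opHom_f_vhw_mem_Vwt D Λ (hz β))) hx
  refine Finset.sum_eq_zero fun β hβ => ?_
  refine V_eq_zero_of_mem D Λ h.dominant ((LinearMap.ker h.toModule).restrictScalars QPi)
    (fun i x hx => ?_) (fun c hc => ?_) (hz β) (h1 β hβ)
  · exact Submodule.smul_mem (LinearMap.ker h.toModule) _ hx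
  · have h2 : h.toModule (c • D.vhw Λ) = 0 := hc
    rw [toModule_smul, toModule_vhw] at h2
    have h3 := congrArg h.hwCoord h2
    rw [map_smul, hwCoord_hw, map_zero, smul_eq_mul, mul_one] at h3
    rw [h3, zero_smul]

open MulOpposite in
/-- The functional `m ↦ (v_Λ)^* (yᵗ m)`, where `ᵗ` exchanges `e_i` and `f_i`, depends on the vector
`y v_Λ` of `V(Λ)` only. -/
lemma hwCoord_transpose_smul_eq_zero {y : D.U} (hy : y ∈ D.hwIdeal Λ) (m : M) :
    h.hwCoord (unop (D.transpose y) • m) = 0 := by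
  have hgen : ∀ g : Gen I, unop (D.transpose (D.gen g)) = D.gen (transposeGen g) := fun g => by
    rw [transpose_gen, unop_op]
  induction hy using Submodule.span_induction generalizing m with
  | mem y hy =>
    revert m
    refine h.weight_induction (by rw [smul_zero, map_zero])
      (fun x y hx hy => by rw [smul_add, map_add, hx, hy, add_zero]) fun μ x hx => ?_
    rcases hy with (⟨i, rfl⟩ | ⟨i, rfl⟩) | ⟨i, rfl⟩
    · have h1 : unop (D.transpose (D.e i)) = D.f i := hgen (.e i)
      rw [h1]
      by_cases hμ : μ - D.α i = Λ
      · rw [sub_eq_iff_eq_add] at hμ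
        have h0 : x = 0 := h.eq_zero_of_mem_wt_add i (hμ ▸ hx)
        rw [h0, smul_zero, map_zero]
      · exact h.hwCoord_of_ne hμ (h.integrable.f_mem i μ x hx)
    · have h1 : unop (D.transpose (D.K i)) = D.K i := hgen (.K i)
      rw [map_sub, unop_sub, h1, AlgHom.commutes, sub_smul, MulOpposite.algebraMap_apply, unop_op,
        algebraMap_smul, h.integrable.K_smul i μ x hx, ← sub_smul, map_smul]
      by_cases hμ : μ = Λ
      · rw [hμ, sub_self, zero_smul]
      · rw [h.hwCoord_of_ne hμ hx, smul_zero]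
    · have h1 : unop (D.transpose (D.f i)) = D.e i := hgen (.f i)
      rw [map_pow, unop_pow, h1]
      set n := (D.h i Λ).toNat with hn_def
      have hn : (n : ℤ) = D.h i Λ := Int.toNat_of_nonneg (h.dominant i)
      have he : ∀ k : ℕ, D.e i ^ k • x ∈ wt (μ + k • D.α i) := by
        intro k
        induction k with
        | zero => simpa using hx
        | succ k ih =>
          rw [pow_succ', mul_smul, succ_nsmul, ← add_assoc]
          exact h.integrable.e_mem _ _ _ ih
      by_cases hμ : μ + (n + 1) • D.α i = Λ
      · have hμ' : D.h i μ = -(n + 2) := by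
          have := congrArg (D.h i) hμ
          rw [map_add, map_nsmul, D.pairing, D.a_diag, ← hn, nsmul_eq_mul] at this
          push_cast at this
          linarith
        obtain ⟨s, hs⟩ := h.f_nilpotent i x
        have h2 := mem_eigW_of_mem_wt h.integrable.toIsWeighted i hx
        rw [hμ'] at h2
        have h3 : x = 0 := by
          refine (isRankOne_of_isQuantumModule (isQuantumModule_of_module D M) i).eq_zero_of_e_pow
            (D.isUnit_bra i) s (n + 2) (m := n + 2) (by push_cast; omega) h2 ?_ hs
          rw [eOp_pow_apply]
          have h4 := he (n + 2)
          rw [succ_nsmul, ← add_assoc, hμ] at h4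
          exact h.eq_zero_of_mem_wt_add i h4
        rw [h3, smul_zero, map_zero]
      · exact h.hwCoord_of_ne hμ (he (n + 1))
  | zero => rw [map_zero, unop_zero, zero_smul, map_zero]
  | add x y _ _ hx hy => rw [map_add, unop_add, add_smul, map_add, hx, hy, add_zero]
  | smul a x _ hx => rw [smul_eq_mul, map_mul, unop_mul, mul_smul, hx]

open MulOpposite in
lemma hwCoord_transpose_smul_congr {y y' : D.U} (hy : y • D.vhw Λ = y' • D.vhw Λ) (m : M) :
    h.hwCoord (unop (D.transpose y) • m) = h.hwCoord (unop (D.transpose y') • m) := by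
  rw [← sub_eq_zero, ← map_sub, ← sub_smul, ← unop_sub, ← map_sub]
  refine h.hwCoord_transpose_smul_eq_zero ((smul_vhw_eq_zero D Λ).1 ?_) m
  rw [sub_smul, hy, sub_self]

open MulOpposite in
/-- The pairing `M × V(Λ) → ℚ(q)^π`, `(m, y v_Λ) ↦ (v_Λ)^* (yᵗ m)`. -/
def pair : M →ₗ[QPi] D.V Λ →ₗ[QPi] QPi :=
  LinearMap.mk₂ QPi
    (fun m x => h.hwCoord (unop (D.transpose (exists_eq_smul_vhw D Λ x).choose) • m))
    (fun m m' x => by rw [smul_add, map_add])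
    (fun c m x => by rw [smul_smul_comm_U, map_smul])
    (fun m x x' => by
      rw [← map_add, ← add_smul, ← unop_add, ← map_add]
      refine h.hwCoord_transpose_smul_congr ?_ m
      rw [add_smul, ← (exists_eq_smul_vhw D Λ x).choose_spec,
        ← (exists_eq_smul_vhw D Λ x').choose_spec, ← (exists_eq_smul_vhw D Λ _).choose_spec])
    (fun c m x => by
      rw [← map_smul, ← smul_assoc, ← unop_smul, ← map_smul]
      refine h.hwCoord_transpose_smul_congr ?_ m
      rw [smul_assoc, ← (exists_eq_smul_vhw D Λ x).choose_spec,
        ← (exists_eq_smul_vhw D Λ _).choose_spec])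

open MulOpposite in
lemma pair_smul_vhw (m : M) (y : D.U) :
    h.pair m (y • D.vhw Λ) = h.hwCoord (unop (D.transpose y) • m) :=
  h.hwCoord_transpose_smul_congr (exists_eq_smul_vhw D Λ (y • D.vhw Λ)).choose_spec.symm m

lemma pair_vhw (m : M) : h.pair m (D.vhw Λ) = h.hwCoord m := by
  have := h.pair_smul_vhw m 1
  rwa [one_smul, map_one, MulOpposite.unop_one, one_smul] at this

lemma pair_gen_smul (g : Gen I) (m : M) (x : D.V Λ) :
    h.pair m (D.gen g • x) = h.pair (D.gen (transposeGen g) • m) x := by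
  obtain ⟨y, rfl⟩ := exists_eq_smul_vhw D Λ x
  rw [smul_smul, pair_smul_vhw, pair_smul_vhw, map_mul, MulOpposite.unop_mul, transpose_gen,
    MulOpposite.unop_op, mul_smul]

lemma pair_f_smul (i : I) (m : M) (x : D.V Λ) :
    h.pair m (D.f i • x) = h.pair (D.e i • m) x := h.pair_gen_smul (.f i) m x

lemma pair_e_smul (i : I) (m : M) (x : D.V Λ) :
    h.pair m (D.e i • x) = h.pair (D.f i • m) x := h.pair_gen_smul (.e i) m x

lemma pair_divPow_f_smul (i : I) (n : ℕ) (m : M) (x : D.V Λ) :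
    h.pair m (D.divPow i (D.f i) n • x) = h.pair (D.divPow i (D.e i) n • m) x := by
  have h1 : h.pair m (D.f i ^ n • x) = h.pair (D.e i ^ n • m) x := by
    induction n generalizing m with
    | zero => rw [pow_zero, pow_zero, one_smul, one_smul]
    | succ n ih => rw [pow_succ', pow_succ, mul_smul, mul_smul, pair_f_smul, ih]
  rw [divPow, divPow, smul_assoc, smul_assoc, LinearMap.map_smul, h1, LinearMap.map_smul,
    LinearMap.smul_apply]

/-- Different weight spaces are orthogonal. -/
lemma pair_of_ne {μ ν : P} (hμν : μ ≠ ν) {m : M} (hm : m ∈ wt μ) {x : D.V Λ}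
    (hx : x ∈ D.Vwt Λ ν) : h.pair m x = 0 := by
  induction hx using Vwt_induction with
  | zero => rw [map_zero]
  | add x y _ _ hx hy => rw [map_add, hx, hy, add_zero]
  | smul c x _ hx => rw [map_smul, hx, smul_zero]
  | mem l hl =>
    subst hl
    induction l generalizing μ m with
    | nil =>
      simp only [List.map_nil, List.prod_nil, one_smul, List.sum_nil, add_zero] at hμν ⊢
      rw [pair_vhw]
      exact h.hwCoord_of_ne hμν hm
    | cons g l ih =>
      rw [List.map_cons, List.prod_cons, mul_smul, pair_gen_smul]
      refine ih (h.gen_smul_mem_wt _ hm) ?_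
      intro h1
      refine hμν ?_
      have h2 : D.genWeight (transposeGen g) = -D.genWeight g := by
        cases g <;> simp [transposeGen, genWeight]
      rw [h2] at h1
      rw [List.map_cons, List.sum_cons, add_left_comm, ← h1]
      abel

/-- The elements of the form pair integrally with `V_{𝔸^π}(Λ)`. -/
lemma pair_mem_APi {m : M} (hm : m ∈ MA) {y : D.V Λ} (hy : y ∈ D.VA Λ) : h.pair m y ∈ APi := by
  rw [VA_eq_divSpan] at hy
  induction hy using Submodule.span_induction with
  | mem y hy =>
    obtain ⟨l, rfl⟩ := hy
    dsimp only
    induction l generalizing m with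
    | nil =>
      simp only [divWord, List.map_nil, List.prod_nil, one_smul, pair_vhw]
      exact h.hwCoord_mem_APi hm
    | cons a l ih =>
      rw [divWord, List.map_cons, List.prod_cons, mul_smul, pair_divPow_f_smul]
      exact ih (h.divPow_mem _ _ _ hm)
  | zero => rw [map_zero]; exact zero_mem _
  | add x y _ _ hx hy => rw [map_add]; exact add_mem hx hy
  | smul c x _ hx =>
    rw [Subring.smul_def, map_smul, smul_eq_mul]
    exact mul_mem c.2 hx

/-! ### The contravariant form -/

/-- The contravariant form on `V(Λ)`: the pairing of `M` with `V(Λ)`, transported by the map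
`V(Λ) → M`. -/
def contravariantForm : LinearMap.BilinForm QPi (D.V Λ) :=
  h.pair ∘ₗ { h.toModule with map_smul' := h.toModule_smul }

lemma contravariantForm_apply (x y : D.V Λ) :
    h.contravariantForm x y = h.pair (h.toModule x) y := rfl

lemma contravariantForm_symm (x y : D.V Λ) :
    h.contravariantForm x y = h.contravariantForm y x := by
  have h1 := bilinForm_eq_zero D Λ (C := h.contravariantForm - LinearMap.flip h.contravariantForm)
    (fun i x y => by
      simp only [LinearMap.sub_apply, LinearMap.flip_apply, contravariantForm_apply, map_smul,
        pair_f_smul, pair_e_smul])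
    (fun i x y => by
      simp only [LinearMap.sub_apply, LinearMap.flip_apply, contravariantForm_apply, map_smul,
        pair_f_smul, pair_e_smul])
    (by rw [LinearMap.sub_apply, LinearMap.sub_apply, LinearMap.flip_apply, sub_self])
  have h2 := LinearMap.congr_fun (LinearMap.congr_fun h1 x) y
  rwa [LinearMap.sub_apply, LinearMap.sub_apply, LinearMap.flip_apply, LinearMap.zero_apply,
    LinearMap.zero_apply, sub_eq_zero] at h2

/-- The radical of the contravariant form is stable under the `e_i` and contains no multiples of `v_Λ`
except zero, so that it vanishes. -/
lemma eq_zero_of_contravariantForm {x : D.V Λ} (hx : ∀ y, h.contravariantForm x y = 0) : x = 0 := by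
  obtain ⟨y, rfl⟩ := (isHighestWeight_V D Λ).gen x
  obtain ⟨s, z, hz, rfl⟩ := exists_eq_sum_homog y
  rw [map_sum, LinearMap.sum_apply] at hx ⊢
  refine Finset.sum_eq_zero fun β hβ => ?_
  refine V_eq_zero_of_mem D Λ h.dominant (LinearMap.ker h.contravariantForm)
    (fun i x hx => ?_) (fun c hc => ?_) (hz β) ?_
  · rw [LinearMap.mem_ker] at hx ⊢
    refine LinearMap.ext fun y => ?_
    rw [contravariantForm_apply, map_smul, ← pair_f_smul, ← contravariantForm_apply, hx]
    simp
  · have h2 := LinearMap.congr_fun (LinearMap.mem_ker.1 hc) (D.vhw Λ)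
    rw [contravariantForm_apply, toModule_smul, toModule_vhw, pair_vhw, map_smul, hwCoord_hw,
      smul_eq_mul, mul_one, LinearMap.zero_apply] at h2
    rw [h2, zero_smul]
  · -- the homogeneous components of a vector of the radical lie in the radical
    rw [LinearMap.mem_ker]
    refine LinearMap.ext fun y => ?_
    rw [LinearMap.zero_apply]
    have hy : y ∈ ⨆ μ, D.Vwt Λ μ := by rw [iSup_Vwt]; exact Submodule.mem_top
    induction hy using Submodule.iSup_induction' with
    | mem μ y hy =>
      by_cases hμ : Λ - D.rootSum β = μ
      · have h3 := hx y
        rw [map_sum, LinearMap.sum_apply, Finset.sum_eq_single_of_mem β hβ] at h3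
        · exact h3
        · intro γ _ hγ
          refine h.pair_of_ne (fun h4 => hγ ?_)
            (h.toModule_mem_wt (opHom_f_vhw_mem_Vwt D Λ (hz γ))) hy
          exact D.rootSum_injective (sub_right_injective (h4.trans hμ.symm))
      · exact h.pair_of_ne hμ (h.toModule_mem_wt (opHom_f_vhw_mem_Vwt D Λ (hz β))) hy
    | zero => rw [map_zero]
    | add x y _ _ hx hy => rw [map_add, hx, hy, add_zero]

theorem isContravariantForm : D.IsContravariantForm Λ h.contravariantForm where
  symm := h.contravariantForm_symm
  nondegenerate := ⟨fun _ hx => h.eq_zero_of_contravariantForm hx, fun y hy =>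
    h.eq_zero_of_contravariantForm fun x => by rw [contravariantForm_symm, hy]⟩
  vhw := by rw [contravariantForm_apply, toModule_vhw, pair_vhw, hwCoord_hw]
  adjoint i x y := by rw [contravariantForm_apply, map_smul, ← pair_f_smul]; rfl

end IsPerfectForm

lemma isContravariantForm_unique {form form' : LinearMap.BilinForm QPi (D.V Λ)}
    (hf : D.IsContravariantForm Λ form) (hf' : D.IsContravariantForm Λ form') : form' = form := by
  rw [← sub_eq_zero]
  refine bilinForm_eq_zero D Λ (fun i x y => ?_) (fun i x y => ?_) ?_
  · simp only [LinearMap.sub_apply, hf.adjoint, hf'.adjoint]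
  · simp only [LinearMap.sub_apply]
    rw [hf.symm, hf'.symm, ← hf.adjoint, ← hf'.adjoint, hf.symm, hf'.symm]
  · rw [LinearMap.sub_apply, LinearMap.sub_apply, hf.vhw, hf'.vhw, sub_self]

end Pairing

/-! ### The basis of `V_{𝔸^π}(Λ)` dual to the perfect basis -/

section DualBasis

variable {I : Type u} {P : Type v} [AddCommGroup P] {D : CartanSuperdatum I P} {Λ : P}
  {M : Type w} [AddCommGroup M] [Module QPi M] [Module D.U M] [IsScalarTower QPi D.U M]
  {wt : P → Submodule QPi M}

namespace IsPerfectForm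

variable {MA : Submodule APi M} {vΛ : M} {B : Set M} (h : IsPerfectForm D Λ wt MA vΛ B)

include h

lemma finite_wt (μ : P) : Finite {b : B // (b : M) ∈ wt μ} := by
  have hfin : Module.Finite QPi (wt μ) := Module.Finite.iff_fg.2 (h.integrable.fg μ)
  have hli : LinearIndependent QPi (fun b : {b : B // (b : M) ∈ wt μ} => (⟨b.1, b.2⟩ : wt μ)) := by
    refine LinearIndependent.of_comp (wt μ).subtype ?_
    exact h.strong.linearIndependent.comp (fun b : {b : B // (b : M) ∈ wt μ} => b.1)
      Subtype.val_injective
  exact hli.finite_of_isNoetherian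

lemma eps_pos {i : I} {b : M} (hb : D.e i • b ≠ 0) : 0 < eps (eOp D M) i b := by
  by_contra h0
  have h1 := pow_eps_succ_apply (e := eOp D M) i (h.e_nilpotent i b)
  rw [Nat.eq_zero_of_not_pos h0, zero_add, pow_one] at h1
  exact hb h1

/-- The coordinate functionals of the perfect basis are given by vectors of `V_{𝔸^π}(Λ)`. They are
constructed by induction on the depth; to obtain the functional of `b` one applies `f_i^{{l}}`,
`l = ε_i(b)`, to the vector for the basis element proportional to the leading part of `e_i^{{l}} b`
and subtracts multiples of the vectors for the `b'` with `ε_i(b') > l`. -/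
lemma exists_dual (b : B) {μ : P} (hμ : (b : M) ∈ wt μ) :
    ∃ y ∈ D.VA Λ, y ∈ D.Vwt Λ μ ∧ ∀ m, h.pair m y = h.basis.repr m b := by
  classical
  obtain ⟨β, rfl⟩ := h.exists_rootSum hμ (h.ne_zero b.2)
  generalize hn : Multiset.card β = n
  induction n using Nat.strong_induction_on generalizing β b with
  | _ n ih =>
  by_cases hhw : ∀ i, D.e i • (b : M) = 0
  · have hb : (b : M) = vΛ := h.highest.le ⟨b.2, hhw⟩
    have hb' : b = ⟨vΛ, h.hw_mem⟩ := Subtype.ext hb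
    have hβ : Λ - D.rootSum β = Λ :=
      eq_of_mem_of_mem h.integrable.indep (h.ne_zero h.hw_mem) (hb ▸ hμ) h.mem_wt
    refine ⟨D.vhw Λ, (mem_VA D Λ).2 ⟨1, one_mem _, (one_smul _ _).symm⟩, ?_, fun m => ?_⟩
    · rw [hβ]; exact vhw_mem_Vwt D Λ
    · rw [h.pair_vhw, hb']; rfl
  push Not at hhw
  obtain ⟨i, hi⟩ := hhw
  have hpos := h.eps_pos hi
  set μ := Λ - D.rootSum β with hμ_def
  have hfin := h.finite_wt μ
  have hfin' : {b : B | (b : M) ∈ wt μ}.Finite := hfin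
  obtain ⟨L, hL⟩ : ∃ L, ∀ b : B, (b : M) ∈ wt μ → eps (eOp D M) i (b : M) ≤ L := by
    obtain ⟨L, hL⟩ := (hfin'.image fun b : B => eps (eOp D M) i (b : M)).bddAbove
    exact ⟨L, fun b hb => hL ⟨b, hb, rfl⟩⟩
  clear hi
  generalize hk : L - eps (eOp D M) i (b : M) = k
  induction k using Nat.strong_induction_on generalizing b with
  | _ k ihk =>
  set l := eps (eOp D M) i (b : M) with hl
  obtain ⟨b₁, r, k', hr, h2, h3⟩ := h.exists_repr_divPow i b.2
  rw [← hl] at h2 h3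
  have hb₁ : (b₁ : M) ∈ wt (μ + l • D.α i) := by
    have := divPow_e_smul_mem_wt h.integrable.toIsWeighted i l hμ
    rw [h2] at this
    have h4 := Submodule.smul_mem _ ((r⁻¹ : QPiˣ) : QPi) this
    rwa [smul_smul, Units.inv_mul, one_smul] at h4
  obtain ⟨γ, hγ⟩ := h.exists_rootSum hb₁ (h.ne_zero b₁.2)
  have hβγ : β = γ + Multiset.replicate l i := by
    refine D.rootSum_injective ?_
    rw [rootSum_add, rootSum_replicate]
    have e1 : D.rootSum β = Λ - (μ + l • D.α i) + l • D.α i := by rw [hμ_def]; abel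
    rw [e1, hγ]
    abel
  obtain ⟨y₁, hy₁, hy₁', hy₁''⟩ := ih (Multiset.card γ) (by
    rw [← hn, hβγ, Multiset.card_add, Multiset.card_replicate]; omega) b₁ γ (hγ ▸ hb₁) rfl
  have hex : ∀ b' : B, ∃ y, (b' : M) ∈ wt μ → l < eps (eOp D M) i (b' : M) →
      y ∈ D.VA Λ ∧ y ∈ D.Vwt Λ μ ∧ ∀ m, h.pair m y = h.basis.repr m b' := by
    intro b'
    by_cases hb' : (b' : M) ∈ wt μ ∧ l < eps (eOp D M) i (b' : M)
    · obtain ⟨y, hy⟩ := ihk (L - eps (eOp D M) i (b' : M)) (by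
        have h4 := hL b' hb'.1
        have h5 := hb'.2
        omega) b' (by omega) hb'.1 rfl
      exact ⟨y, fun _ _ => hy⟩
    · exact ⟨0, fun h1 h2 => absurd ⟨h1, h2⟩ hb'⟩
  choose y' hy' using hex
  set T := hfin'.toFinset.filter fun b' : B => l < eps (eOp D M) i (b' : M) with hT
  have hTmem : ∀ b' : B, b' ∈ T ↔ (b' : M) ∈ wt μ ∧ l < eps (eOp D M) i (b' : M) := fun b' => by
    rw [hT, Finset.mem_filter, Set.Finite.mem_toFinset]; rfl
  set a : B → QPi := fun b' => h.basis.repr (D.divPow i (D.e i) l • (b' : M)) b₁ with ha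
  set y₀ := D.divPow i (D.f i) l • y₁ with hy₀
  have hy₀wt : y₀ ∈ D.Vwt Λ μ := by
    have := divPow_f_smul_mem_Vwt D Λ i l hy₁'
    rwa [← hγ, add_sub_cancel_right] at this
  have hy₀pair : ∀ b' : B, h.pair b' y₀ = a b' := fun b' => by
    rw [hy₀, pair_divPow_f_smul, hy₁'']
  refine ⟨((r⁻¹ : QPiˣ) : QPi) • (y₀ - ∑ b' ∈ T, a b' • y' b'), ?_, ?_, ?_⟩
  · refine smul_mem_of_mem_APi hr.inv.mem_APi
      (sub_mem (smul_mem_VA D Λ (divPow_f_mem_UA D i l) hy₁) (sum_mem fun b' hb' => ?_))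
    obtain ⟨h4, h5⟩ := (hTmem b').1 hb'
    exact smul_mem_of_mem_APi (h.repr_mem_APi (h.divPow_mem i l _ (h.subset b'.2)) b₁)
      (hy' b' h4 h5).1
  · refine Submodule.smul_mem _ _ (sub_mem hy₀wt (sum_mem fun b' hb' => ?_))
    obtain ⟨h4, h5⟩ := (hTmem b').1 hb'
    exact Submodule.smul_mem _ _ (hy' b' h4 h5).2.1
  · intro m
    set y := ((r⁻¹ : QPiˣ) : QPi) • (y₀ - ∑ b' ∈ T, a b' • y' b') with hy
    suffices h4 : LinearMap.flip h.pair y = h.basis.coord b from LinearMap.congr_fun h4 m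
    refine h.basis.ext fun b'' => ?_
    rw [LinearMap.flip_apply, basis_apply, Module.Basis.coord_apply, hy, map_smul, map_sub, map_sum,
      hy₀pair, h.repr_apply b''.2]
    have h5 : ∀ b' ∈ T, h.pair (b'' : M) (a b' • y' b') = if b'' = b' then a b'' else 0 := by
      intro b' hb'
      obtain ⟨h6, h7⟩ := (hTmem b').1 hb'
      rw [map_smul, (hy' b' h6 h7).2.2, h.repr_apply b''.2, Finsupp.single_apply]
      split_ifs with h8
      · subst h8; simp
      · simp
    rw [Finset.sum_congr rfl h5, Finset.sum_ite_eq]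
    split_ifs with hT''
    · have h6 : b ≠ b'' := by
        rintro rfl
        exact lt_irrefl _ ((hTmem b).1 hT'').2
      rw [sub_self, smul_zero, Finsupp.single_eq_of_ne h6]
    · rw [sub_zero]
      by_cases hb'' : (b'' : M) ∈ wt μ
      · have hle : eps (eOp D M) i (b'' : M) ≤ l := by
          by_contra h6
          exact hT'' ((hTmem b'').2 ⟨hb'', not_le.1 h6⟩)
        have h6 := h3 b'' fun b' hb' => by
          rw [h.repr_apply b''.2] at hb'
          have : b' = b'' := by
            by_contra h7
            exact hb' (Finsupp.single_eq_of_ne h7)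
          rwa [this]
        simp only [ha]
        rw [h6, h.repr_apply b''.2, smul_eq_mul, ← mul_assoc, Units.inv_mul, one_mul]
      · obtain ⟨ν, hν⟩ := h.strong.homogeneous b'' b''.2
        have h6 : ν ≠ μ := by rintro rfl; exact hb'' hν
        have h7 : b ≠ b'' := by rintro rfl; exact hb'' hμ
        rw [← hy₀pair, h.pair_of_ne h6 hν hy₀wt, smul_zero, Finsupp.single_eq_of_ne h7]

/-- The vector of `V_{𝔸^π}(Λ)` dual to an element of the perfect basis. -/
def dualVector (b : B) : D.V Λ :=
  (h.exists_dual b (h.strong.homogeneous b b.2).choose_spec).choose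

lemma dualVector_mem_VA (b : B) : h.dualVector b ∈ D.VA Λ :=
  (h.exists_dual b (h.strong.homogeneous b b.2).choose_spec).choose_spec.1

lemma dualVector_mem_Vwt {b : B} {μ : P} (hb : (b : M) ∈ wt μ) :
    h.dualVector b ∈ D.Vwt Λ μ := by
  rw [eq_of_mem_of_mem h.integrable.indep (h.ne_zero b.2) hb
    (h.strong.homogeneous b b.2).choose_spec]
  exact (h.exists_dual b (h.strong.homogeneous b b.2).choose_spec).choose_spec.2.1

lemma pair_dualVector (m : M) (b : B) : h.pair m (h.dualVector b) = h.basis.repr m b :=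
  (h.exists_dual b (h.strong.homogeneous b b.2).choose_spec).choose_spec.2.2 m

/-! ### The isomorphism of `M` with `V(Λ)` -/

/-- The linear map `M → V(Λ)` which sends each basis vector to its dual vector is injective and
preserves weights. Its composition with `V(Λ) → M` is an injective endomorphism of each weight space,
and a finitely generated module over the Artinian ring `ℚ(q)^π` has no other injective endomorphisms
than the bijective ones. -/
lemma toModule_surjective : Function.Surjective h.toModule := by
  set s : M →ₗ[QPi] D.V Λ := h.basis.constr QPi h.dualVector with hs
  have hs_basis : ∀ b : B, s b = h.dualVector b := fun b => by
    rw [hs, ← h.basis_apply b, Module.Basis.constr_basis]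
  have hpair : ∀ (b' : B) m, h.pair b' (s m) = h.basis.repr m b' := by
    intro b' m
    suffices h4 : h.pair b' ∘ₗ s = h.basis.coord b' from LinearMap.congr_fun h4 m
    refine h.basis.ext fun b => ?_
    rw [LinearMap.comp_apply, basis_apply, hs_basis, pair_dualVector, Module.Basis.coord_apply,
      h.repr_apply b.2, h.repr_apply b'.2]
    by_cases hb : b = b'
    · rw [hb]
    · rw [Finsupp.single_eq_of_ne hb, Finsupp.single_eq_of_ne (Ne.symm hb)]
  have hs_inj : ∀ m, s m = 0 → m = 0 := fun m hm =>
    h.basis.repr.map_eq_zero_iff.1 (Finsupp.ext fun b => by rw [← hpair, hm, map_zero]; rfl)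
  have hs_wt : ∀ μ, ∀ m ∈ wt μ, s m ∈ D.Vwt Λ μ := by
    intro μ m hm
    rw [hs, Module.Basis.constr_apply]
    refine sum_mem fun b hb => Submodule.smul_mem _ _ (h.dualVector_mem_Vwt ?_)
    exact h.mem_wt_of_repr_ne_zero hm (Finsupp.mem_support_iff.1 hb)
  set G : M →ₗ[QPi] M := { h.toModule with map_smul' := h.toModule_smul } ∘ₗ s with hG
  have hG_apply : ∀ m, G m = h.toModule (s m) := fun _ => rfl
  intro m
  revert m
  refine h.weight_induction ⟨0, map_zero _⟩ ?_ fun μ x hx => ?_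
  · rintro x y ⟨x', rfl⟩ ⟨y', rfl⟩
    exact ⟨x' + y', map_add _ _ _⟩
  · have hfin : Module.Finite QPi (wt μ) := Module.Finite.iff_fg.2 (h.integrable.fg μ)
    have hG_wt : ∀ m ∈ wt μ, G m ∈ wt μ := fun m hm => h.toModule_mem_wt (hs_wt μ m hm)
    have hinj : Function.Injective (G.restrict hG_wt) := by
      rw [injective_iff_map_eq_zero]
      intro m hm
      have h1 : h.toModule (s m) = 0 := congrArg Subtype.val hm
      exact Subtype.ext (hs_inj m ((injective_iff_map_eq_zero _).1 h.toModule_injective _ h1))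
    obtain ⟨x', hx'⟩ := IsArtinian.surjective_of_injective_endomorphism _ hinj ⟨x, hx⟩
    exact ⟨s x', congrArg Subtype.val hx'⟩

/-- The isomorphism `V(Λ) ≃ M` which maps `v_Λ` to `vΛ`. -/
def equivModule : D.V Λ ≃ₗ[D.U] M :=
  LinearEquiv.ofBijective h.toModule ⟨h.toModule_injective, h.toModule_surjective⟩

lemma equivModule_apply (x : D.V Λ) : h.equivModule x = h.toModule x := rfl

lemma toModule_equivModule_symm (m : M) : h.toModule (h.equivModule.symm m) = m :=
  h.equivModule.apply_symm_apply m

lemma mem_symm_image {S : Set M} {x : D.V Λ} :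
    x ∈ h.equivModule.symm '' S ↔ h.toModule x ∈ S := by
  constructor
  · rintro ⟨m, hm, rfl⟩
    rwa [toModule_equivModule_symm]
  · exact fun hx => ⟨h.toModule x, hx, h.equivModule.symm_apply_apply x⟩

lemma toModule_mem_wt_iff {μ : P} {x : D.V Λ} : h.toModule x ∈ wt μ ↔ x ∈ D.Vwt Λ μ := by
  refine ⟨fun hx => ?_, h.toModule_mem_wt⟩
  set j : D.V Λ →ₗ[QPi] M := { h.toModule with map_smul' := h.toModule_smul }
  have h1 := eq_of_le_of_iSup_eq_top h.integrable.indep (S := fun μ => (D.Vwt Λ μ).map j)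
    (fun μ => Submodule.map_le_iff_le_comap.2 fun x hx => h.toModule_mem_wt hx) (by
      rw [← Submodule.map_iSup, iSup_Vwt, Submodule.map_top, LinearMap.range_eq_top]
      exact h.toModule_surjective) μ
  rw [← h1] at hx
  obtain ⟨x', hx', h2⟩ := hx
  rwa [← h.toModule_injective h2]

/-- An element of `M` lies in the form if and only if it pairs integrally with the dual vectors, that
is, with all of `V_{𝔸^π}(Λ)`. -/
lemma toModule_mem_iff {x : D.V Λ} :
    h.toModule x ∈ MA ↔ x ∈ D.VAdual Λ h.contravariantForm := by
  refine ⟨fun hx y hy => h.pair_mem_APi hx hy, fun hx => h.mem_iff_repr.2 fun b => ?_⟩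
  rw [← pair_dualVector]
  exact hx _ (h.dualVector_mem_VA b)

/-! ### Duality of the two `𝔸^π`-forms of `V(Λ)` -/

lemma eq_sum_repr {μ : P} [Fintype {b : B // (b : M) ∈ wt μ}] {m : M} (hm : m ∈ wt μ) :
    m = ∑ b : {b : B // (b : M) ∈ wt μ}, h.basis.repr m b.1 • (b.1 : M) := by
  classical
  refine h.basis.repr.injective (Finsupp.ext fun b' => ?_)
  rw [map_sum, Finsupp.finsetSum_apply]
  by_cases hb' : (b' : M) ∈ wt μ
  · rw [Finset.sum_eq_single ⟨b', hb'⟩]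
    · rw [map_smul, h.repr_apply b'.2]
      simp
    · intro b _ hb
      rw [map_smul, h.repr_apply b.1.2, Finsupp.smul_apply, Finsupp.single_eq_of_ne, smul_zero]
      exact fun h1 => hb (Subtype.ext h1.symm)
    · intro h1
      exact absurd (Finset.mem_univ _) h1
  · rw [Finset.sum_eq_zero]
    · by_contra h0
      exact hb' (h.mem_wt_of_repr_ne_zero hm h0)
    · intro b _
      rw [map_smul, h.repr_apply b.1.2, Finsupp.smul_apply, Finsupp.single_eq_of_ne, smul_zero]
      rintro rfl
      exact hb' b.2

/-- The pairing of the parts of weight `μ` of `V_{𝔸^π}(Λ)` and its dual form. -/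
def formPairing (μ : P) :
    D.VAwt Λ μ →ₗ[APi] Module.Dual APi (D.VAdualwt Λ h.contravariantForm μ) :=
  LinearMap.mk₂ APi
    (fun y x => (⟨h.contravariantForm (x : D.V Λ) (y : D.V Λ), x.2.1 _ y.2.1⟩ : APi))
    (fun _ _ _ => Subtype.ext (map_add _ _ _))
    (fun c y x => Subtype.ext (map_smul (h.contravariantForm (x : D.V Λ)) (c : QPi) (y : D.V Λ)))
    (fun _ _ _ => Subtype.ext (LinearMap.map_add₂ _ _ _ _))
    (fun c _ _ => Subtype.ext (LinearMap.map_smul₂ h.contravariantForm (c : QPi) _ _))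

lemma coe_formPairing {μ : P} (y : D.VAwt Λ μ) (x : D.VAdualwt Λ h.contravariantForm μ) :
    ((h.formPairing μ y x : APi) : QPi) = h.contravariantForm (x : D.V Λ) (y : D.V Λ) := rfl

/-- The element of the dual form of `V(Λ)` corresponding to a basis vector. -/
def basisVector {μ : P} (b : {b : B // (b : M) ∈ wt μ}) :
    D.VAdualwt Λ h.contravariantForm μ :=
  ⟨h.equivModule.symm b.1, h.toModule_mem_iff.1 (by
      rw [toModule_equivModule_symm]; exact h.subset b.1.2),
    h.toModule_mem_wt_iff.1 (by rw [toModule_equivModule_symm]; exact b.2)⟩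

lemma toModule_basisVector {μ : P} (b : {b : B // (b : M) ∈ wt μ}) :
    h.toModule (h.basisVector b : D.V Λ) = b.1 := h.toModule_equivModule_symm _

lemma formPairing_injective (μ : P) : Function.Injective (h.formPairing μ) := by
  rw [injective_iff_map_eq_zero]
  intro y hy
  refine Subtype.ext (h.eq_zero_of_contravariantForm fun x => ?_)
  rw [contravariantForm_symm, contravariantForm_apply]
  suffices h4 : LinearMap.flip h.pair (y : D.V Λ) = 0 from LinearMap.congr_fun h4 _
  refine h.basis.ext fun b => ?_
  rw [LinearMap.flip_apply, basis_apply, LinearMap.zero_apply]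
  by_cases hb : (b : M) ∈ wt μ
  · have h1 := congrArg (fun g => ((g (h.basisVector ⟨b, hb⟩) : APi) : QPi)) hy
    rw [coe_formPairing, contravariantForm_apply, toModule_basisVector] at h1
    exact h1
  · obtain ⟨ν, hν⟩ := h.strong.homogeneous b b.2
    exact h.pair_of_ne (by rintro rfl; exact hb hν) hν y.2.2

/-- A functional `g` is given by the vector `∑ g(b) y_b`, where `y_b` is dual to `b`. -/
lemma formPairing_surjective (μ : P) : Function.Surjective (h.formPairing μ) := by
  intro g
  have hfin := h.finite_wt μ
  have hfin' := Fintype.ofFinite {b : B // (b : M) ∈ wt μ}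
  refine ⟨⟨∑ b : {b : B // (b : M) ∈ wt μ}, g (h.basisVector b) • h.dualVector b.1, ?_, ?_⟩, ?_⟩
  · exact sum_mem fun b _ => Submodule.smul_mem _ _ (h.dualVector_mem_VA b.1)
  · exact sum_mem fun b _ => Submodule.smul_mem _ _ (h.dualVector_mem_Vwt b.2)
  · refine LinearMap.ext fun x => Subtype.ext ?_
    rw [coe_formPairing, contravariantForm_apply]
    have hx : x = ∑ b : {b : B // (b : M) ∈ wt μ},
        (⟨h.basis.repr (h.toModule x) b.1, h.repr_mem_APi (h.toModule_mem_iff.2 x.2.1) b.1⟩ : APi) •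
          h.basisVector b := by
      refine Subtype.ext (h.toModule_injective ?_)
      rw [AddSubmonoidClass.coe_finsetSum, map_sum]
      conv_lhs => rw [h.eq_sum_repr (h.toModule_mem_wt_iff.2 x.2.2)]
      refine Finset.sum_congr rfl fun b _ => ?_
      rw [Submodule.coe_smul, Subring.smul_def, toModule_smul, toModule_basisVector]
    conv_rhs => rw [hx, map_sum]
    rw [map_sum, AddSubmonoidClass.coe_finsetSum]
    refine Finset.sum_congr rfl fun b _ => ?_
    rw [Subring.smul_def, map_smul, map_smul, pair_dualVector, smul_eq_mul, smul_eq_mul, mul_comm]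
    rfl

end IsPerfectForm

end DualBasis

end

end QuantumSuper

theorem mainTheorem6 {I : Type*} {P : Type*} [AddCommGroup P] [Module.Free ℤ P]
    (D : CartanSuperdatum I P) (Λ : P) (hΛ : D.IsDominant Λ)
    {M : Type*} [AddCommGroup M] [Module QPi M] [Module D.U M] [IsScalarTower QPi D.U M]
    (wt : P → Submodule QPi M) (hM : D.IsIntegrable wt)
    (hwt : ∀ μ, wt μ ≠ ⊥ → Λ - μ ∈ D.Qplus)
    (MA : Submodule APi M)
    (hMAe : ∀ (i : I) (n : ℕ), ∀ x ∈ MA, D.divPow i (D.e i) n • x ∈ MA)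
    (vΛ : M) (hvΛ : vΛ ∈ wt Λ)
    (hMAΛ : MA ⊓ (wt Λ).restrictScalars APi = Submodule.span APi {vΛ})
    (B : Set M) (hBMA : B ⊆ MA) (hB : IsStrongPerfectBasis D wt (eOp D M) B)
    (hBH : {b ∈ B | ∀ i, D.e i • b = 0} = {vΛ}) :
    ∃ form : LinearMap.BilinForm QPi (D.V Λ),
      (D.IsContravariantForm Λ form ∧
        ∀ form', D.IsContravariantForm Λ form' → form' = form) ∧
      (∃ φ : M ≃ₗ[D.U] D.V Λ,
        φ vΛ = D.vhw Λ ∧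
        (∀ μ, φ '' (wt μ : Set M) = D.Vwt Λ μ) ∧
        φ '' (MA : Set M) = D.VAdual Λ form) ∧
      (LinearIndependent APi (Subtype.val : B → M) ∧ Submodule.span APi B = MA) ∧
      ∀ μ, ∃ Ψ : D.VAwt Λ μ ≃ₗ[APi] Module.Dual APi (D.VAdualwt Λ form μ),
        ∀ (y : D.VAwt Λ μ) (x : D.VAdualwt Λ form μ),
          ((Ψ y x : APi) : QPi) = form (x : D.V Λ) (y : D.V Λ) := by
  have h : IsPerfectForm D Λ wt MA vΛ B :=
    ⟨hΛ, hM, hwt, hMAe, hvΛ, hMAΛ, hBMA, hB, hBH⟩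
  refine ⟨h.contravariantForm, ⟨h.isContravariantForm, fun form' hform' =>
    isContravariantForm_unique h.isContravariantForm hform'⟩, ⟨h.equivModule.symm, ?_, ?_, ?_⟩,
    ⟨h.linearIndependent_APi, h.span_eq⟩, fun μ => ⟨LinearEquiv.ofBijective (h.formPairing μ)
      ⟨h.formPairing_injective μ, h.formPairing_surjective μ⟩, fun y x => h.coe_formPairing y x⟩⟩
  · rw [LinearEquiv.symm_apply_eq, h.equivModule_apply, h.toModule_vhw]
  · intro μ
    ext x
    rw [h.mem_symm_image, SetLike.mem_coe, SetLike.mem_coe]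
    exact h.toModule_mem_wt_iff
  · ext x
    rw [h.mem_symm_image, SetLike.mem_coe, SetLike.mem_coe]
    exact h.toModule_mem_iff
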